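/- Let $N\in\mathbb N=\{1,2,\dots\}$, let $X$ be a complex Banach space, let $p\in\{0\}\cup[1,\infty]$ and $\mathbf X=l^p(\mathbb Z^N,X)$ with the usual norm, where $l^0(\mathbb Z^N,X)$ denotes the closure in $l^\infty(\mathbb Z^N,X)$ of the set of finitely supported sequences. Let $\mathcal P=(P_n)$, where $P_n$ is the operator of multiplication by the characteristic function of $\{-n,\dots,n\}^N$, and let $\mathcal L(\mathbf X)$ be the algebra of bounded linear operators on $\mathbf X$. Let $$\mathcal K(\mathbf X,\mathcal P)=\{K\in\mathcal L(\mathbf X):\|(I-P_n)K\|+\|K(I-P_n)\|\to0\},$$ $$\mathcal L(\mathbf X,\mathcal P)=\{A\in\mathcal L(\mathbf X): AK,KA\in\mathcal K(\mathbf X,\mathcal P)\text{ for all }K\in\mathcal K(\mathbf X,\mathcal P)\}.$$ Then $\mathcal K(\mathbf X,\mathcal P)$ is a two-sided ideal of $\mathcal L(\mathbf X,\mathcal P)$. The quotient algebra $\mathcal L(\mathbf X,\mathcal P)/\mathcal K(\mathbf X,\mathcal P)$ carries the quotient norm $\|A+\mathcal K(\mathbf X,\mathcal P)\|=\inf_{K\in\mathcal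 K(\mathbf X,\mathcal P)}\|A+K\|$. An operator $A\in\mathcal L(\mathbf X,\mathcal P)$ is called $\mathcal P$-Fredholm if $A+\mathcal K(\mathbf X,\mathcal P)$ is invertible in this quotient algebra. An operator $B\in\mathcal L(\mathbf X)$ is called a $\mathcal P$-regularizer of $A$ if $AB-I$ and $BA-I$ belong to $\mathcal K(\mathbf X,\mathcal P)$. For $k\in\mathbb Z^N$ let $V_k(x_i)_i=(x_{i-k})_i$. A band operator is a finite sum $\sum_\alpha a_\alpha V_\alpha$, $\alpha\in\mathbb Z^N$, where each $a_\alpha\in l^\infty(\mathbb Z^N,\mathcal L(X))$ acts by $(a_\alpha x)_i=a_\alpha(i)x_i$. A band-dominated operator is a limit of band operators in the operator norm. For a sequence $h=(h_n)$ in $\mathbb Z^N$ with $|h_n|\to\infty$, the limit operator $A_h$ of $A$ is the operator with $\|K(V_{-h_n}AV_{h_n}-A_h)\|+\|(V_{-h_n}AV_{h_n}-A_h)K\|\to0$ for all $K\in\mathcal K(\mathbf X,\mathcal P)$, if it exists. Let $\sigma^{\mathrm{op}}(A)$ be the set of all limit operators of $A$. An operator $A\in\mathcal L(\mathbf X,\mathcal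 P)$ is called rich if every sequence $h$ in $\mathbb Z^N$ with $|h_n|\to\infty$ has a subsequence $g$ such that $A_g$ exists. Put $\|b^{-1}\|:=\infty$ if $b$ is not invertible. Let $A\in\mathcal L(\mathbf X,\mathcal P)$ be rich and band-dominated. (a) If $A$ is $\mathcal P$-Fredholm and $B\in\mathcal L(\mathbf X)$ is a $\mathcal P$-regularizer of $A$, then $B\in\mathcal L(\mathbf X,\mathcal P)$ and $$\|(A+\mathcal K(\mathbf X,\mathcal P))^{-1}\|=\|B+\mathcal K(\mathbf X,\mathcal P)\|=\max_{B_h\in\sigma^{\mathrm{op}}(B)}\|B_h\|=\max_{A_h\in\sigma^{\mathrm{op}}(A)}\|A_h^{-1}\|,$$ where both maxima are attained. (b) If $A$ is not $\mathcal P$-Fredholm, then $\|(A+\mathcal K(\mathbf X,\mathcal P))^{-1}\|=\infty=\max_{A_h\in\sigma^{\mathrm{op}}(A)}\|A_h^{-1}\|$; in particular, some limit operator of $A$ is not invertible. -/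

import Mathlib

open Filter Topology
open scoped ENNReal

noncomputable section

namespace LimitOp

/-! ### Invertibility modulo `P`-compact operators

Here `Y` is a complex normed space and `P = (P_n)` a sequence of bounded operators on it. -/

section Abstract

variable {Y : Type*} [NormedAddCommGroup Y] [NormedSpace ℂ Y]

/-- The set `K(Y, P)` of all `P`-compact operators: those bounded `K` with
`‖(I - P_n) K‖ + ‖K (I - P_n)‖ → 0`. -/
def pCompact (P : ℕ → Y →L[ℂ] Y) : Submodule ℂ (Y →L[ℂ] Y) where
  carrier := {K | Tendsto (fun n => ‖(1 - P n) * K‖ + ‖K * (1 - P n)‖) atTop (𝓝 0)}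
  zero_mem' := by simp
  add_mem' := by
    intro a b ha hb
    have h := Tendsto.add (Set.mem_ofPred_eq ▸ ha) (Set.mem_ofPred_eq ▸ hb)
    rw [add_zero] at h
    refine squeeze_zero (fun n => by positivity) (fun n => ?_) h
    have h1 := norm_add_le ((1 - P n) * a) ((1 - P n) * b)
    have h2 := norm_add_le (a * (1 - P n)) (b * (1 - P n))
    rw [mul_add, add_mul]
    linarith
  smul_mem' := by
    intro c a ha
    have h := Tendsto.const_mul ‖c‖ (Set.mem_ofPred_eq ▸ ha)
    rw [mul_zero] at h
    refine h.congr fun n => ?_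
    rw [mul_smul_comm, smul_mul_assoc, norm_smul, norm_smul, mul_add]

theorem mem_pCompact {P : ℕ → Y →L[ℂ] Y} {K : Y →L[ℂ] Y} :
    K ∈ pCompact P ↔
      Tendsto (fun n => ‖(1 - P n) * K‖ + ‖K * (1 - P n)‖) atTop (𝓝 0) :=
  Iff.rfl

theorem mul_mem_pCompact {P : ℕ → Y →L[ℂ] Y} {K L : Y →L[ℂ] Y}
    (hK : K ∈ pCompact P) (hL : L ∈ pCompact P) : K * L ∈ pCompact P := by
  rw [mem_pCompact] at hK hL ⊢
  have h := (hK.mul_const ‖L‖).add (hL.const_mul ‖K‖)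
  rw [zero_mul, mul_zero, add_zero] at h
  refine squeeze_zero (fun n => by positivity) (fun n => ?_) h
  have h1 : ‖(1 - P n) * (K * L)‖ ≤ ‖(1 - P n) * K‖ * ‖L‖ := by
    rw [← mul_assoc]; exact norm_mul_le _ _
  have h2 : ‖K * L * (1 - P n)‖ ≤ ‖K‖ * ‖L * (1 - P n)‖ := by
    rw [mul_assoc]; exact norm_mul_le _ _
  have h3 : 0 ≤ ‖K * (1 - P n)‖ * ‖L‖ := by positivity
  have h4 : 0 ≤ ‖K‖ * ‖(1 - P n) * L‖ := by positivity
  rw [add_mul, mul_add]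
  linarith

/-- The algebra `L(Y, P)` of all bounded operators `A` such that `A K` and `K A` are `P`-compact
whenever `K` is `P`-compact. -/
def pAlg (P : ℕ → Y →L[ℂ] Y) : Subalgebra ℂ (Y →L[ℂ] Y) where
  carrier := {A | ∀ K ∈ pCompact P, A * K ∈ pCompact P ∧ K * A ∈ pCompact P}
  mul_mem' := by
    intro a b ha hb K hK
    rw [mul_assoc, ← mul_assoc K]
    exact ⟨(ha _ (hb K hK).1).1, (hb _ (ha K hK).2).2⟩
  add_mem' := by
    intro a b ha hb K hK
    rw [add_mul, mul_add]
    exact ⟨add_mem (ha K hK).1 (hb K hK).1, add_mem (ha K hK).2 (hb K hK).2⟩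
  algebraMap_mem' := by
    intro c K hK
    rw [Algebra.algebraMap_eq_smul_one, smul_mul_assoc, mul_smul_comm, one_mul, mul_one]
    exact ⟨Submodule.smul_mem _ c hK, Submodule.smul_mem _ c hK⟩

/-- `K(Y, P)` as an ideal of `L(Y, P)`. -/
def pIdeal (P : ℕ → Y →L[ℂ] Y) : Ideal (pAlg P) where
  carrier := {A | (A : Y →L[ℂ] Y) ∈ pCompact P}
  add_mem' := fun {a b} ha hb => (pCompact P).add_mem (x := a.1) (y := b.1) ha hb
  zero_mem' := zero_mem (pCompact P)
  smul_mem' := fun a _ hK => (a.2 _ hK).1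

instance pIdeal_isTwoSided (P : ℕ → Y →L[ℂ] Y) : (pIdeal P).IsTwoSided :=
  ⟨fun {a} b ha => (b.2 a.1 ha).2⟩

/-- The quotient norm on `L(Y, P) / K(Y, P)`, that is
`‖A + K(Y, P)‖ = inf {‖A + K‖ : K ∈ K(Y, P)}`. -/
instance quotientNorm (P : ℕ → Y →L[ℂ] Y) : Norm (pAlg P ⧸ pIdeal P) :=
  (Submodule.Quotient.seminormedAddCommGroup (pIdeal P)).toNorm

/-- The coset `A + K(Y, P)` in the quotient algebra `L(Y, P) / K(Y, P)`. -/
def coset (P : ℕ → Y →L[ℂ] Y) (A : pAlg P) : pAlg P ⧸ pIdeal P :=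
  Ideal.Quotient.mk (pIdeal P) A

/-- `A ∈ L(Y, P)` is `P`-Fredholm if its coset is invertible in `L(Y, P) / K(Y, P)`. -/
def IsPFredholm (P : ℕ → Y →L[ℂ] Y) (A : pAlg P) : Prop :=
  IsUnit (coset P A)

/-- `B` is a `P`-regularizer of `A`. -/
def IsPRegularizer (P : ℕ → Y →L[ℂ] Y) (A B : Y →L[ℂ] Y) : Prop :=
  A * B - 1 ∈ pCompact P ∧ B * A - 1 ∈ pCompact P

/-- `P`-strong convergence of a sequence of operators. -/
def PTendsto (P : ℕ → Y →L[ℂ] Y) (A : ℕ → Y →L[ℂ] Y) (L : Y →L[ℂ] Y) : Prop :=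
  ∀ K ∈ pCompact P, Tendsto (fun n => ‖K * (A n - L)‖ + ‖(A n - L) * K‖) atTop (𝓝 0)

end Abstract

open Classical in
/-- The norm `‖a⁻¹‖ ∈ [0, ∞]` of the inverse of `a`, with `‖a⁻¹‖ = ∞` if `a` is not invertible. -/
def invNorm {R : Type*} [MonoidWithZero R] [Norm R] (a : R) : ℝ≥0∞ :=
  if IsUnit a then ENNReal.ofReal ‖Ring.inverse a‖ else ∞

/-! ### The sequence spaces -/

/-- The index group `ℤ^N`; its norm is the maximum norm. -/
abbrev Idx (N : ℕ) : Type := Fin N → ℤ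

/-- The set `{0} ∪ [1, ∞]` of admissible exponents. -/
inductive Exponent : Type
  | zero : Exponent
  | ofGE (p : ℝ≥0∞) (hp : 1 ≤ p) : Exponent

/-- The exponent of the norm: `l^0` carries the norm of `l^∞`. -/
def Exponent.normExp : Exponent → ℝ≥0∞
  | .zero => ∞
  | .ofGE p _ => p

instance Exponent.fact_one_le (p : Exponent) : Fact (1 ≤ p.normExp) :=
  ⟨match p with
    | .zero => le_top
    | .ofGE _ hp => hp⟩

section Spaces

variable (N : ℕ) (X : Type*) [NormedAddCommGroup X] [NormedSpace ℂ X]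

/-- The finitely supported sequences in `l^q(ℤ^N, X)`. -/
def finSupp (q : ℝ≥0∞) [Fact (1 ≤ q)] : Submodule ℂ (lp (fun _ : Idx N => X) q) where
  carrier := {x | {i | x i ≠ 0}.Finite}
  zero_mem' := by simp
  add_mem' := by
    intro x y hx hy
    refine (Set.Finite.union hx hy).subset fun i hi => ?_
    by_contra h
    simp only [Set.mem_union, Set.mem_ofPred_eq, not_or, not_not] at h
    exact hi (by simp [h.1, h.2])
  smul_mem' := by
    intro c x hx
    refine Set.Finite.subset hx fun i hi h => hi ?_
    simp [h]

/-- `l^p(ℤ^N, X)` as a subspace of Mathlib's `lp`: all of it for `1 ≤ p ≤ ∞`, and for `p = 0` the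
closure in `l^∞(ℤ^N, X)` of the finitely supported sequences. -/
def seqSubmodule : (p : Exponent) → Submodule ℂ (lp (fun _ : Idx N => X) p.normExp)
  | .zero => (finSupp N X ∞).topologicalClosure
  | .ofGE _ _ => ⊤

/-- The sequence space `l^p(ℤ^N, X)`, `p ∈ {0} ∪ [1, ∞]`, with its usual norm. -/
def SeqSpace (p : Exponent) : Type _ := seqSubmodule N X p

instance SeqSpace.normedAddCommGroup (p : Exponent) : NormedAddCommGroup (SeqSpace N X p) :=
  inferInstanceAs (NormedAddCommGroup (seqSubmodule N X p))

instance SeqSpace.normedSpace (p : Exponent) : NormedSpace ℂ (SeqSpace N X p) :=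
  inferInstanceAs (NormedSpace ℂ (seqSubmodule N X p))

variable {N X}

/-- The inclusion of `l^p(ℤ^N, X)` into Mathlib's `lp`. -/
def SeqSpace.val {p : Exponent} (x : SeqSpace N X p) : lp (fun _ : Idx N => X) p.normExp :=
  Subtype.val (p := (· ∈ seqSubmodule N X p)) x

/-- `x i` is the `i`-th entry of the sequence `x`. -/
instance SeqSpace.coeFun (p : Exponent) : CoeFun (SeqSpace N X p) (fun _ => Idx N → X) :=
  ⟨fun x i => x.val i⟩

theorem SeqSpace.ext {p : Exponent} {x y : SeqSpace N X p} (h : ∀ i, x i = y i) : x = y :=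
  Subtype.ext (lp.ext (funext h))

theorem SeqSpace.norm_val {p : Exponent} (x : SeqSpace N X p) : ‖x.val‖ = ‖x‖ := rfl

end Spaces

section Operators

variable {N : ℕ} {X : Type*} [NormedAddCommGroup X] [NormedSpace ℂ X]

/-- An operator on `lp` that maps finitely supported sequences to finitely supported ones leaves
`l^p(ℤ^N, X)` invariant. -/
theorem map_mem_seqSubmodule (p : Exponent)
    (T : lp (fun _ : Idx N => X) p.normExp →L[ℂ] lp (fun _ : Idx N => X) p.normExp)
    (hT : ∀ x ∈ finSupp N X p.normExp, T x ∈ finSupp N X p.normExp)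
    (x : lp (fun _ : Idx N => X) p.normExp) (hx : x ∈ seqSubmodule N X p) :
    T x ∈ seqSubmodule N X p := by
  cases p with
  | zero => exact map_mem_closure T.continuous hx hT
  | ofGE p hp => trivial

/-- Restriction of an operator to `l^p(ℤ^N, X)`. -/
def restrictOp (p : Exponent)
    (T : lp (fun _ : Idx N => X) p.normExp →L[ℂ] lp (fun _ : Idx N => X) p.normExp)
    (hT : ∀ x ∈ finSupp N X p.normExp, T x ∈ finSupp N X p.normExp) :
    SeqSpace N X p →L[ℂ] SeqSpace N X p :=
  show seqSubmodule N X p →L[ℂ] seqSubmodule N X p from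
    (T.comp (seqSubmodule N X p).subtypeL).codRestrict (seqSubmodule N X p)
      fun x => map_mem_seqSubmodule p T hT x x.2

/-- The multiplication operator `a I`, `(a x)_i = a_i x_i`, of a bounded sequence
`a ∈ l^∞(ℤ^N, L(X))`. -/
def mulOp (p : Exponent) (a : lp (fun _ : Idx N => X →L[ℂ] X) ∞) :
    SeqSpace N X p →L[ℂ] SeqSpace N X p :=
  restrictOp p
    (lp.mapCLM p.normExp (fun i => a i) (norm_nonneg a)
      fun i => lp.norm_apply_le_norm ENNReal.top_ne_zero a i)
    fun x hx => Set.Finite.subset hx fun i hi h => hi (by simp [h])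

theorem mulOp_apply (p : Exponent) (a : lp (fun _ : Idx N => X →L[ℂ] X) ∞)
    (x : SeqSpace N X p) (i : Idx N) : mulOp p a x i = a i (x i) :=
  rfl

/-- The characteristic function of the cube `{-n, …, n}^N`, with values in `L(X)`. -/
def cube (N : ℕ) (X : Type*) [NormedAddCommGroup X] [NormedSpace ℂ X] (n : ℕ) :
    lp (fun _ : Idx N => X →L[ℂ] X) ∞ :=
  ⟨fun i => open Classical in if ∀ j, |i j| ≤ (n : ℤ) then 1 else 0, by
    refine memℓp_infty ⟨‖(1 : X →L[ℂ] X)‖, ?_⟩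
    rintro _ ⟨i, rfl⟩
    dsimp only
    split_ifs <;> simp⟩

/-- The canonical projections `P_n`, multiplication by the characteristic function of
`{-n, …, n}^N`. -/
def proj (N : ℕ) (X : Type*) [NormedAddCommGroup X] [NormedSpace ℂ X] (p : Exponent) (n : ℕ) :
    SeqSpace N X p →L[ℂ] SeqSpace N X p :=
  mulOp p (cube N X n)

open Classical in
theorem proj_apply (p : Exponent) (n : ℕ) (x : SeqSpace N X p) (i : Idx N) :
    proj N X p n x i = if ∀ j, |i j| ≤ (n : ℤ) then x i else 0 := by
  have h : proj N X p n x i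
      = (if ∀ j, |i j| ≤ (n : ℤ) then (1 : X →L[ℂ] X) else 0) (x i) := rfl
  rw [h]
  split_ifs <;> simp

theorem memlp_shift {N : ℕ} {X : Type*} [NormedAddCommGroup X] {q : ℝ≥0∞} (k : Idx N)
    {f : Idx N → X} (hf : Memℓp f q) :
    Memℓp (fun i => f (i - k)) q := by
  rcases q.trichotomy with rfl | rfl | hq
  · exact memℓp_zero ((memℓp_zero_iff.1 hf).preimage (sub_left_injective.injOn))
  · obtain ⟨C, hC⟩ := memℓp_infty_iff.1 hf
    refine memℓp_infty ⟨C, ?_⟩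
    rintro _ ⟨i, rfl⟩
    exact hC ⟨i - k, rfl⟩
  · rw [memℓp_gen_iff hq] at hf ⊢
    exact (Equiv.subRight k).summable_iff.2 hf

/-- The shift on `lp`. -/
def lpShift (q : ℝ≥0∞) [Fact (1 ≤ q)] (k : Idx N) :
    lp (fun _ : Idx N => X) q →L[ℂ] lp (fun _ : Idx N => X) q :=
  LinearMap.mkContinuous
    { toFun := fun x => ⟨fun i => x (i - k), memlp_shift k (lp.memℓp x)⟩
      map_add' := fun _ _ => rfl
      map_smul' := fun _ _ => rfl } 1 fun x => by
    rw [one_mul]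
    rcases q.dichotomy with rfl | hq
    · exact lp.norm_le_of_forall_le (norm_nonneg x)
        fun i => lp.norm_apply_le_norm ENNReal.top_ne_zero x (i - k)
    · have hq0 : 0 < q.toReal := lt_of_lt_of_le one_pos hq
      refine lp.norm_le_of_tsum_le hq0 (norm_nonneg x) ?_
      rw [lp.norm_rpow_eq_tsum hq0]
      exact ((Equiv.subRight k).tsum_eq fun i => ‖x i‖ ^ q.toReal).le

/-- The shift operator `V_k : (x_i) ↦ (x_{i-k})` on `l^p(ℤ^N, X)`. -/
def shift (p : Exponent) (k : Idx N) : SeqSpace N X p →L[ℂ] SeqSpace N X p :=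
  restrictOp p (lpShift p.normExp k)
    fun _ hx => Set.Finite.preimage (sub_left_injective.injOn) hx

theorem shift_apply (p : Exponent) (k : Idx N) (x : SeqSpace N X p) (i : Idx N) :
    shift p k x i = x (i - k) :=
  rfl

/-! ### Band-dominated operators and limit operators -/

/-- Band operators: finite sums `∑ a_α V_α` with multiplication operators `a_α`. -/
def IsBand {p : Exponent} (A : SeqSpace N X p →L[ℂ] SeqSpace N X p) : Prop :=
  ∃ (S : Finset (Idx N)) (a : Idx N → lp (fun _ : Idx N => X →L[ℂ] X) ∞),
    A = ∑ α ∈ S, mulOp p (a α) * shift p α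

/-- Band-dominated operators: the closure, in operator norm, of the set of band operators. -/
def IsBandDominated {p : Exponent} (A : SeqSpace N X p →L[ℂ] SeqSpace N X p) : Prop :=
  A ∈ closure {T : SeqSpace N X p →L[ℂ] SeqSpace N X p | IsBand T}

/-- `h = (h_n)` tends to infinity in `ℤ^N`: `|h_n| → ∞`. -/
def TendsToInfinity (h : ℕ → Idx N) : Prop :=
  Tendsto (fun n => ‖h n‖) atTop atTop

/-- `C` is the limit operator `A_h` of `A` with respect to `h`, that is, the `P`-strong limit of
`V_{-h_n} A V_{h_n}`. -/
def IsLimitOp {p : Exponent} (A : SeqSpace N X p →L[ℂ] SeqSpace N X p) (h : ℕ → Idx N)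
    (C : SeqSpace N X p →L[ℂ] SeqSpace N X p) : Prop :=
  PTendsto (proj N X p) (fun n => shift p (-h n) * A * shift p (h n)) C

/-- The operator spectrum of `A`: the set of all limit operators of `A`. -/
def opSpec {p : Exponent} (A : SeqSpace N X p →L[ℂ] SeqSpace N X p) :
    Set (SeqSpace N X p →L[ℂ] SeqSpace N X p) :=
  {C | ∃ h : ℕ → Idx N, TendsToInfinity h ∧ IsLimitOp A h C}

/-- `A` has a rich operator spectrum: every sequence tending to infinity has a subsequence with
respect to which the limit operator of `A` exists.
(Richness is considered for `A ∈ L(X, P)` only.) -/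
def IsRich {p : Exponent} (A : SeqSpace N X p →L[ℂ] SeqSpace N X p) : Prop :=
  ∀ h : ℕ → Idx N, TendsToInfinity h →
    ∃ φ : ℕ → ℕ, StrictMono φ ∧ ∃ C, IsLimitOp A (h ∘ φ) C

end Operators

end LimitOp

end

/-! The driving property is that a band-dominated operator almost commutes with multiplication by
slowly varying functions, uniformly over whole families `θ a` whose overlap and variation are
measured in the exponent of the space (`FamilyComm`). This property passes to sums, products and
inverses. If the family is normalized, then `x ↦ (θ a x)_a` is isometric, so an almost minimizer of
`‖T x‖ / ‖x‖` can be replaced by one with support of bounded diameter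
(`FamilyComm.exists_localized_le`); almost maximizers are treated in the same way.

(a) Limit operators of `P`-compact operators vanish. Hence limit operators of `B` have at most the
quotient norm `β` of `B`, and every limit operator of `A` is invertible, its inverse being the limit
operator of `B` for the same sequence (`IsLimitOp.exists_inverse`). For attainment with `β > 0`,
note `β ≤ ‖B (1 - P_n)‖` for all `n`. Images under `B` of almost maximizers of `B (1 - P_n)`, cut
off near the origin, are almost minimizers of `A` for `β⁻¹` arbitrarily far out
(`exists_far_almost_minimizer`). Localizing at all scales around a common centre `h_m`
(`FamilyComm.exists_nested`) and passing to a subsequence by richness gives one limit operator `C`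
with lower norm at most `β⁻¹`, so `‖C⁻¹‖ ≥ β`. Because all accuracies share one sequence, the
maximum is attained and is not merely a supremum.

(b) Suppose that all limit operators are invertible. Their inverses are uniformly bounded, since
otherwise the argument above with `ν = 0` yields a limit operator that is not bounded below
(`exists_bound_inverse`). Far out, shifted inverses of limit operators are local left inverses of
`A`; glued along a tiling and corrected by a Neumann series, they give a left regularizer. It is
also a right regularizer: the error `Q` satisfies `Q A ∈ K(X, P)`, and since limit operators of `A`
have right inverses, `Q` vanishes at infinity; by localization it is `P`-compact
(`exists_regularizer_of_opSpec`).

For `p = ∞` the projections do not converge strongly to the identity. Cutoffs and the formula `‖x‖ =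
sup_k ‖P_k x‖` take the place of strong convergence throughout. -/

noncomputable section

namespace LimitOp

/-! ### The `ℓ^q` norm of `[0, ∞]`-valued families -/

section EllNorm

/-- The `ℓ^q` norm of a family of extended nonnegative numbers. -/
def ellNorm (q : ℝ≥0∞) {ι : Type*} (f : ι → ℝ≥0∞) : ℝ≥0∞ :=
  if q = ∞ then ⨆ i, f i else (∑' i, f i ^ q.toReal) ^ (1 / q.toReal)

variable {q : ℝ≥0∞} {ι κ : Type*}

theorem ellNorm_top (f : ι → ℝ≥0∞) : ellNorm ∞ f = ⨆ i, f i := if_pos rfl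

theorem ellNorm_of_ne_top (hq : q ≠ ∞) (f : ι → ℝ≥0∞) :
    ellNorm q f = (∑' i, f i ^ q.toReal) ^ (1 / q.toReal) := if_neg hq

theorem one_le_toReal_of_ne_top [h1 : Fact (1 ≤ q)] (hq : q ≠ ∞) : 1 ≤ q.toReal := by
  simpa using ENNReal.toReal_mono hq h1.out

theorem ellNorm_rpow [Fact (1 ≤ q)] (hq : q ≠ ∞) (f : ι → ℝ≥0∞) :
    ellNorm q f ^ q.toReal = ∑' i, f i ^ q.toReal := by
  have := one_le_toReal_of_ne_top hq
  rw [ellNorm_of_ne_top hq, ← ENNReal.rpow_mul, one_div_mul_cancel (by positivity),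
    ENNReal.rpow_one]

theorem ellNorm_mono {f g : ι → ℝ≥0∞} (h : ∀ i, f i ≤ g i) : ellNorm q f ≤ ellNorm q g := by
  by_cases hq : q = ∞
  · subst hq
    simpa [ellNorm_top] using iSup_mono h
  · rw [ellNorm_of_ne_top hq, ellNorm_of_ne_top hq]
    gcongr with i
    exact h i

theorem ellNorm_const_mul [Fact (1 ≤ q)] (c : ℝ≥0∞) (f : ι → ℝ≥0∞) :
    ellNorm q (fun i => c * f i) = c * ellNorm q f := by
  by_cases hq : q = ∞
  · subst hq
    simp [ellNorm_top, ENNReal.mul_iSup]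
  · have := one_le_toReal_of_ne_top hq
    rw [ellNorm_of_ne_top hq, ellNorm_of_ne_top hq]
    simp_rw [ENNReal.mul_rpow_of_nonneg _ _ (show (0 : ℝ) ≤ q.toReal by positivity)]
    rw [ENNReal.tsum_mul_left, ENNReal.mul_rpow_of_nonneg _ _ (by positivity), ← ENNReal.rpow_mul,
      mul_one_div_cancel (by positivity), ENNReal.rpow_one]

theorem ellNorm_add_le [Fact (1 ≤ q)] (f g : ι → ℝ≥0∞) :
    ellNorm q (fun i => f i + g i) ≤ ellNorm q f + ellNorm q g := by
  by_cases hq : q = ∞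
  · subst hq
    simp only [ellNorm_top]
    exact iSup_le fun i => add_le_add (le_iSup f i) (le_iSup g i)
  · have h1 := one_le_toReal_of_ne_top hq
    have h0 : 0 < q.toReal := by positivity
    rw [ellNorm_of_ne_top hq, one_div, ENNReal.rpow_inv_le_iff h0, ENNReal.tsum_eq_iSup_sum]
    refine iSup_le fun s => ?_
    rw [← ENNReal.rpow_inv_le_iff h0, ← one_div]
    refine (ENNReal.Lp_add_le s f g h1).trans ?_
    rw [ellNorm_of_ne_top hq, ellNorm_of_ne_top hq]
    gcongr <;> exact ENNReal.sum_le_tsum s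

theorem ellNorm_zero [Fact (1 ≤ q)] : ellNorm q (fun _ : ι => 0) = 0 := by
  simpa using ellNorm_const_mul (q := q) 0 (fun _ : ι => 0)

theorem ellNorm_sum_le [Fact (1 ≤ q)] (s : Finset κ) (f : κ → ι → ℝ≥0∞) :
    ellNorm q (fun i => ∑ k ∈ s, f k i) ≤ ∑ k ∈ s, ellNorm q (f k) := by
  classical
  induction s using Finset.induction_on with
  | empty => simp [ellNorm_zero]
  | insert a s ha ih =>
    simp only [Finset.sum_insert ha]
    exact (ellNorm_add_le _ _).trans (by gcongr)

theorem le_ellNorm [Fact (1 ≤ q)] (f : ι → ℝ≥0∞) (i : ι) : f i ≤ ellNorm q f := by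
  by_cases hq : q = ∞
  · subst hq
    exact (le_iSup f i).trans_eq (ellNorm_top f).symm
  · have h1 := one_le_toReal_of_ne_top hq
    rw [ellNorm_of_ne_top hq, one_div, ENNReal.le_rpow_inv_iff (by positivity)]
    exact ENNReal.le_tsum i

theorem ellNorm_single [Fact (1 ≤ q)] (f : ι → ℝ≥0∞) (i : ι) (h : ∀ j, j ≠ i → f j = 0) :
    ellNorm q f = f i := by
  refine le_antisymm ?_ (le_ellNorm f i)
  by_cases hq : q = ∞
  · subst hq
    rw [ellNorm_top]
    refine iSup_le fun j => ?_
    by_cases hj : j = i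
    · rw [hj]
    · rw [h j hj]; exact zero_le
  · have h1 := one_le_toReal_of_ne_top hq
    have h0 : 0 < q.toReal := by positivity
    rw [ellNorm_of_ne_top hq, tsum_eq_single i fun j hj => by rw [h j hj, ENNReal.zero_rpow_of_pos h0],
      ← ENNReal.rpow_mul, mul_one_div_cancel h0.ne', ENNReal.rpow_one]

theorem ellNorm_le_sum [Fact (1 ≤ q)] (s : Finset ι) (f : ι → ℝ≥0∞) (h : ∀ i ∉ s, f i = 0) :
    ellNorm q f ≤ ∑ i ∈ s, f i := by
  classical
  have h2 : f = fun i => ∑ k ∈ s, if i = k then f k else 0 := by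
    ext i
    rw [Finset.sum_ite_eq]
    split_ifs with hi
    · rfl
    · exact h i hi
  conv_lhs => rw [h2]
  refine (ellNorm_sum_le s _).trans (Finset.sum_le_sum fun k _ => ?_)
  rw [ellNorm_single _ k fun j hj => if_neg hj, if_pos rfl]

theorem ellNorm_le_card_mul [Fact (1 ≤ q)] (s : Finset ι) (f : ι → ℝ≥0∞) (c : ℝ≥0∞)
    (h : ∀ i ∉ s, f i = 0) (hc : ∀ i, f i ≤ c) : ellNorm q f ≤ s.card * c := by
  refine (ellNorm_le_sum s f h).trans ((Finset.sum_le_sum fun i _ => hc i).trans ?_)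
  simp

/-- Tonelli, or interchange of suprema. Both norms carry the same exponent, so the exchange is an
equality; for this reason families of functions are measured below in the exponent of the sequence
space. -/
theorem ellNorm_comm [Fact (1 ≤ q)] (f : ι → κ → ℝ≥0∞) :
    ellNorm q (fun i => ellNorm q (f i)) = ellNorm q (fun k => ellNorm q fun i => f i k) := by
  by_cases hq : q = ∞
  · subst hq
    simp only [ellNorm_top]
    exact iSup_comm
  · rw [ellNorm_of_ne_top hq, ellNorm_of_ne_top hq]
    simp_rw [ellNorm_rpow hq]
    rw [ENNReal.tsum_comm]

theorem ellNorm_equiv (e : κ ≃ ι) (f : ι → ℝ≥0∞) :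
    ellNorm q (fun k => f (e k)) = ellNorm q f := by
  by_cases hq : q = ∞
  · subst hq
    simp only [ellNorm_top]
    exact e.iSup_comp
  · rw [ellNorm_of_ne_top hq, ellNorm_of_ne_top hq, e.tsum_eq fun i => f i ^ q.toReal]

/-- The `ℓ^q` norm is determined by the finite parts of the family. -/
theorem ellNorm_le_of_finite [Fact (1 ≤ q)] (f : ι → ℝ≥0∞) (c : ℝ≥0∞)
    (h : ∀ s : Finset ι, ∃ g : ι → ℝ≥0∞, (∀ i ∈ s, f i ≤ g i) ∧ ellNorm q g ≤ c) :
    ellNorm q f ≤ c := by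
  by_cases hq : q = ∞
  · subst hq
    rw [ellNorm_top]
    refine iSup_le fun i => ?_
    obtain ⟨g, hg, hc⟩ := h {i}
    exact (hg i (by simp)).trans ((le_ellNorm g i).trans hc)
  · have h1 := one_le_toReal_of_ne_top hq
    have h0 : 0 < q.toReal := by positivity
    rw [ellNorm_of_ne_top hq, one_div, ENNReal.rpow_inv_le_iff h0, ENNReal.tsum_eq_iSup_sum]
    refine iSup_le fun s => ?_
    obtain ⟨g, hg, hc⟩ := h s
    calc ∑ i ∈ s, f i ^ q.toReal ≤ ∑ i ∈ s, g i ^ q.toReal :=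
          Finset.sum_le_sum fun i hi => by gcongr; exact hg i hi
      _ ≤ ∑' i, g i ^ q.toReal := ENNReal.sum_le_tsum s
      _ = ellNorm q g ^ q.toReal := (ellNorm_rpow hq g).symm
      _ ≤ c ^ q.toReal := by gcongr

theorem ellNorm_enorm_lp {X : Type*} [NormedAddCommGroup X] [Fact (1 ≤ q)]
    (x : lp (fun _ : ι => X) q) : ellNorm q (fun i => ‖x i‖ₑ) = ‖x‖ₑ := by
  by_cases hq : q = ∞
  · subst hq
    rw [ellNorm_top]
    refine le_antisymm (iSup_le fun i => ?_) ?_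
    · rw [enorm_le_iff_norm_le]
      exact lp.norm_apply_le_norm ENNReal.top_ne_zero x i
    · by_cases hfin : (⨆ i, ‖x i‖ₑ) = ∞
      · rw [hfin]; exact le_top
      · rw [← ENNReal.ofReal_toReal hfin, ← ofReal_norm]
        refine ENNReal.ofReal_le_ofReal (lp.norm_le_of_forall_le ENNReal.toReal_nonneg fun i => ?_)
        rw [← toReal_enorm]
        exact ENNReal.toReal_mono hfin (le_iSup (fun i => ‖x i‖ₑ) i)
  · have h1 := one_le_toReal_of_ne_top hq
    have h0 : 0 < q.toReal := by positivity
    have hs := (lp.memℓp x).summable h0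
    rw [ellNorm_of_ne_top hq, ← ofReal_norm, lp.norm_eq_tsum_rpow h0,
      ← ENNReal.ofReal_rpow_of_nonneg (tsum_nonneg fun i => by positivity) (by positivity),
      ENNReal.ofReal_tsum_of_nonneg (fun i => by positivity) hs]
    congr 2
    ext i
    rw [← ofReal_norm, ENNReal.ofReal_rpow_of_nonneg (norm_nonneg _) h0.le]

theorem memℓp_of_ellNorm_ne_top {X : Type*} [NormedAddCommGroup X] [Fact (1 ≤ q)]
    (f : ι → X) (hf : ellNorm q (fun i => ‖f i‖ₑ) ≠ ∞) : Memℓp f q := by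
  by_cases hq : q = ∞
  · subst hq
    refine memℓp_infty ⟨(ellNorm ∞ fun i => ‖f i‖ₑ).toReal, ?_⟩
    rintro _ ⟨i, rfl⟩
    dsimp only
    rw [← toReal_enorm]
    exact ENNReal.toReal_mono hf (le_ellNorm (q := ∞) (fun i => ‖f i‖ₑ) i)
  · have h1 := one_le_toReal_of_ne_top hq
    have h0 : 0 < q.toReal := by positivity
    refine memℓp_gen ?_
    have h2 : ∑' i, ‖f i‖ₑ ^ q.toReal ≠ ∞ := by
      rw [← ellNorm_rpow hq]
      exact ENNReal.rpow_ne_top_of_nonneg h0.le hf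
    have h3 := ENNReal.summable_toReal h2
    refine h3.congr fun i => ?_
    rw [← ENNReal.toReal_rpow, toReal_enorm]

end EllNorm

/-! ### Basic facts on the sequence spaces -/

section SeqSpaceBasics

variable {N : ℕ} {X : Type*} [NormedAddCommGroup X] [NormedSpace ℂ X] {p : Exponent}

instance SeqSpace.completeSpace [CompleteSpace X] : CompleteSpace (SeqSpace N X p) := by
  have h : IsClosed (seqSubmodule N X p : Set (lp (fun _ : Idx N => X) p.normExp)) := by
    cases p with
    | zero => exact isClosed_closure
    | ofGE q hq => exact isClosed_univ
  exact h.completeSpace_coe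

/-- The `i`-th entry of a sequence, as a linear map. -/
def coord (i : Idx N) : SeqSpace N X p →ₗ[ℂ] X where
  toFun x := x i
  map_add' _ _ := rfl
  map_smul' _ _ := rfl

theorem seq_ext {x y : SeqSpace N X p} (h : ∀ i, coord i x = coord i y) : x = y :=
  SeqSpace.ext h

theorem ellNorm_enorm (x : SeqSpace N X p) :
    ellNorm p.normExp (fun i => ‖coord i x‖ₑ) = ‖x‖ₑ :=
  ellNorm_enorm_lp x.val

theorem norm_le_of_forall_coord {x y : SeqSpace N X p} (h : ∀ i, ‖coord i x‖ ≤ ‖coord i y‖) :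
    ‖x‖ ≤ ‖y‖ := by
  rw [← enorm_le_iff_norm_le, ← ellNorm_enorm, ← ellNorm_enorm]
  exact ellNorm_mono fun i => enorm_le_iff_norm_le.2 (h i)

theorem norm_coord_le (x : SeqSpace N X p) (i : Idx N) : ‖coord i x‖ ≤ ‖x‖ := by
  rw [← enorm_le_iff_norm_le, ← ellNorm_enorm]
  exact le_ellNorm (fun i => ‖coord i x‖ₑ) i

theorem exists_coord_ne_zero {x : SeqSpace N X p} (hx : x ≠ 0) : ∃ i, coord i x ≠ 0 := by
  by_contra! h
  exact hx (seq_ext fun i => by rw [h i, map_zero])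

/-- The finitely supported sequences are dense in `l^0`. -/
theorem dense_finite_support :
    Dense {x : SeqSpace N X Exponent.zero | {i | coord i x ≠ 0}.Finite} := by
  have h : Dense ((↑) ⁻¹' (finSupp N X ∞ : Set (lp (fun _ : Idx N => X) ∞)) :
      Set (closure (finSupp N X ∞ : Set (lp (fun _ : Idx N => X) ∞)))) := by
    rw [Subtype.dense_iff, Subtype.image_preimage_coe,
      Set.inter_eq_self_of_subset_right subset_closure]
  exact h

/-- A linear map given by its entries defines a bounded operator on `l^p(ℤ^N, X)`. -/
theorem exists_op_of_entries (F : SeqSpace N X p →ₗ[ℂ] (Idx N → X)) (c : ℝ)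
    (hF : ∀ x, ellNorm p.normExp (fun i => ‖F x i‖ₑ) ≤ ENNReal.ofReal c * ‖x‖ₑ)
    (hfin : ∀ x : SeqSpace N X p, {i | coord i x ≠ 0}.Finite → {i | F x i ≠ 0}.Finite) :
    ∃ T : SeqSpace N X p →L[ℂ] SeqSpace N X p, ∀ x i, coord i (T x) = F x i := by
  have hmem : ∀ x, Memℓp (F x) p.normExp := fun x =>
    memℓp_of_ellNorm_ne_top _ ((hF x).trans_lt
      (ENNReal.mul_lt_top ENNReal.ofReal_lt_top enorm_lt_top)).ne
  let G0 : SeqSpace N X p →ₗ[ℂ] lp (fun _ : Idx N => X) p.normExp :=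
    { toFun := fun x => ⟨F x, hmem x⟩
      map_add' := fun x y => lp.ext (map_add F x y)
      map_smul' := fun a x => lp.ext (map_smul F a x) }
  have hG : ∀ x, ‖G0 x‖ ≤ max c 0 * ‖x‖ := fun x => by
    rw [← ENNReal.ofReal_le_ofReal_iff (by positivity), ENNReal.ofReal_mul (le_max_right _ _),
      ofReal_norm, ofReal_norm, ← ellNorm_enorm_lp, ENNReal.ofReal_max, ENNReal.ofReal_zero,
      max_eq_left zero_le]
    exact hF x
  let G := G0.mkContinuous _ hG
  have hmem2 : ∀ x, G x ∈ seqSubmodule N X p := by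
    cases p with
    | zero =>
      intro x
      -- The condition that the image lies in the closed subspace is itself closed, and by `hfin` it
      -- holds on the dense set of finitely supported sequences.
      have hc : IsClosed {x : SeqSpace N X Exponent.zero | G x ∈ seqSubmodule N X Exponent.zero} :=
        isClosed_closure.preimage G.continuous
      have h2 : closure {x : SeqSpace N X Exponent.zero | {i | coord i x ≠ 0}.Finite} ⊆
          {x | G x ∈ seqSubmodule N X Exponent.zero} :=
        hc.closure_subset_iff.2 fun y hy => subset_closure (hfin y hy)
      rw [dense_finite_support.closure_eq] at h2
      exact h2 (Set.mem_univ x)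
    | ofGE q hq => exact fun _ => trivial
  exact ⟨G.codRestrict (seqSubmodule N X p) hmem2, fun x i => rfl⟩

/-! ### Multiplication by scalar functions, projections and shifts -/

open Classical in
/-- Multiplication by a scalar function with values in `[-1, 1]`. -/
def scalarMul (p : Exponent) (θ : Idx N → ℝ) : SeqSpace N X p →L[ℂ] SeqSpace N X p :=
  -- The junk value 0 for other `θ` keeps proofs out of the arguments of the operator.
  if h : ∀ i, |θ i| ≤ 1 then
    mulOp p ⟨fun i => (θ i : ℂ) • 1, by
      refine memℓp_infty ⟨‖(1 : X →L[ℂ] X)‖, ?_⟩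
      rintro _ ⟨i, rfl⟩
      dsimp only
      rw [norm_smul, Complex.norm_real]
      exact mul_le_of_le_one_left (norm_nonneg _) (h i)⟩
  else 0

theorem coord_scalarMul {θ : Idx N → ℝ} (h : ∀ i, |θ i| ≤ 1) (x : SeqSpace N X p) (i : Idx N) :
    coord i (scalarMul p θ x) = (θ i : ℂ) • coord i x := by
  rw [scalarMul, dif_pos h]
  rfl

theorem norm_scalarMul_apply_le {θ : Idx N → ℝ} (h : ∀ i, |θ i| ≤ 1) (x : SeqSpace N X p) :
    ‖scalarMul p θ x‖ ≤ ‖x‖ :=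
  norm_le_of_forall_coord fun i => by
    rw [coord_scalarMul h, norm_smul, Complex.norm_real]
    exact mul_le_of_le_one_left (norm_nonneg _) (h i)

theorem forall_abs_le_iff_norm_le (i : Idx N) (n : ℕ) : (∀ j, |i j| ≤ (n : ℤ)) ↔ ‖i‖ ≤ n := by
  rw [pi_norm_le_iff_of_nonneg (by positivity)]
  refine forall_congr' fun j => ?_
  rw [Int.norm_eq_abs]
  exact_mod_cast Iff.rfl

open Classical in
theorem coord_proj (n : ℕ) (x : SeqSpace N X p) (i : Idx N) :
    coord i (proj N X p n x) = if ‖i‖ ≤ n then coord i x else 0 := by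
  refine (proj_apply p n x i).trans ?_
  simp only [forall_abs_le_iff_norm_le]
  rfl

theorem coord_proj_of_le {n : ℕ} {i : Idx N} (h : ‖i‖ ≤ n) (x : SeqSpace N X p) :
    coord i (proj N X p n x) = coord i x := by
  rw [coord_proj, if_pos h]

theorem coord_proj_of_lt {n : ℕ} {i : Idx N} (h : n < ‖i‖) (x : SeqSpace N X p) :
    coord i (proj N X p n x) = 0 := by
  rw [coord_proj, if_neg h.not_ge]

theorem norm_proj_apply_le (n : ℕ) (x : SeqSpace N X p) : ‖proj N X p n x‖ ≤ ‖x‖ :=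
  norm_le_of_forall_coord fun i => by
    rw [coord_proj]
    split_ifs <;> simp

theorem norm_sub_proj_apply_le (n : ℕ) (x : SeqSpace N X p) : ‖x - proj N X p n x‖ ≤ ‖x‖ :=
  norm_le_of_forall_coord fun i => by
    rw [map_sub, coord_proj]
    split_ifs <;> simp

theorem norm_proj_le (n : ℕ) : ‖proj N X p n‖ ≤ 1 :=
  ContinuousLinearMap.opNorm_le_bound _ zero_le_one fun x => by
    simpa using norm_proj_apply_le n x

theorem norm_one_sub_proj_le (n : ℕ) : ‖1 - proj N X p n‖ ≤ 1 :=
  ContinuousLinearMap.opNorm_le_bound _ zero_le_one fun x => by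
    simpa using norm_sub_proj_apply_le n x

theorem proj_proj_apply {m n : ℕ} (h : m ≤ n) (x : SeqSpace N X p) :
    proj N X p n (proj N X p m x) = proj N X p m x :=
  seq_ext fun i => by
    have : (m : ℝ) ≤ n := by exact_mod_cast h
    rw [coord_proj, coord_proj]
    split_ifs <;> first | rfl | (exfalso; linarith)

theorem proj_proj_apply' {m n : ℕ} (h : m ≤ n) (x : SeqSpace N X p) :
    proj N X p m (proj N X p n x) = proj N X p m x :=
  seq_ext fun i => by
    have : (m : ℝ) ≤ n := by exact_mod_cast h
    rw [coord_proj, coord_proj, coord_proj]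
    split_ifs <;> first | rfl | (exfalso; linarith)

theorem proj_mul_proj {m n : ℕ} (h : m ≤ n) : proj N X p n * proj N X p m = proj N X p m :=
  ContinuousLinearMap.ext fun x => proj_proj_apply h x

theorem proj_mul_proj' {m n : ℕ} (h : m ≤ n) : proj N X p m * proj N X p n = proj N X p m :=
  ContinuousLinearMap.ext fun x => proj_proj_apply' h x

/-- The `ℓ^q` norm is determined by finite index sets, and each of these lies in a cube. This
remains true where `P_k x` fails to converge to `x`. -/
theorem norm_le_of_norm_proj_le {x : SeqSpace N X p} {c : ℝ}
    (h : ∀ k, ‖proj N X p k x‖ ≤ c) : ‖x‖ ≤ c := by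
  have hc : 0 ≤ c := (norm_nonneg _).trans (h 0)
  rw [← ENNReal.ofReal_le_ofReal_iff hc, ofReal_norm, ← ellNorm_enorm]
  refine ellNorm_le_of_finite _ _ fun s => ?_
  obtain ⟨k, hk⟩ := exists_nat_ge (∑ i ∈ s, ‖i‖)
  refine ⟨fun i => ‖coord i (proj N X p k x)‖ₑ, fun i hi => ?_, ?_⟩
  · refine (congrArg enorm (coord_proj_of_le ?_ x)).ge
    exact (Finset.single_le_sum (fun i _ => norm_nonneg i) hi).trans hk
  · rw [ellNorm_enorm, ← ofReal_norm]
    exact ENNReal.ofReal_le_ofReal (h k)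

theorem opNorm_le_of_norm_proj_mul_le {T : SeqSpace N X p →L[ℂ] SeqSpace N X p} {c : ℝ}
    (h : ∀ k, ‖proj N X p k * T‖ ≤ c) : ‖T‖ ≤ c :=
  ContinuousLinearMap.opNorm_le_bound _ ((norm_nonneg _).trans (h 0)) fun x =>
    norm_le_of_norm_proj_le fun k =>
      ((proj N X p k * T).le_opNorm x).trans (by gcongr; exact h k)

@[simp] theorem norm_shift_apply (k : Idx N) (x : SeqSpace N X p) : ‖shift p k x‖ = ‖x‖ := by
  rw [← toReal_enorm, ← toReal_enorm, ← ellNorm_enorm, ← ellNorm_enorm]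
  congr 1
  exact ellNorm_equiv (Equiv.subRight k) fun i => ‖coord i x‖ₑ

theorem coord_shift (k : Idx N) (x : SeqSpace N X p) (i : Idx N) :
    coord i (shift p k x) = coord (i - k) x := rfl

theorem shift_shift_apply (k l : Idx N) (x : SeqSpace N X p) :
    shift p k (shift p l x) = shift p (k + l) x :=
  seq_ext fun i => by
    rw [coord_shift, coord_shift, coord_shift, sub_sub]

@[simp] theorem shift_zero_apply (x : SeqSpace N X p) : shift p 0 x = x :=
  seq_ext fun i => by rw [coord_shift, sub_zero]

@[simp] theorem shift_neg_mul_shift (k : Idx N) :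
    (shift p (-k) * shift p k : SeqSpace N X p →L[ℂ] SeqSpace N X p) = 1 :=
  ContinuousLinearMap.ext fun x => by
    rw [mul_apply_eq_comp, shift_shift_apply, neg_add_cancel, shift_zero_apply]; rfl

@[simp] theorem shift_mul_shift_neg (k : Idx N) :
    (shift p k * shift p (-k) : SeqSpace N X p →L[ℂ] SeqSpace N X p) = 1 := by
  simpa using shift_neg_mul_shift (p := p) (X := X) (-k)

theorem norm_shift_le (k : Idx N) :
    ‖(shift p k : SeqSpace N X p →L[ℂ] SeqSpace N X p)‖ ≤ 1 :=
  ContinuousLinearMap.opNorm_le_bound _ zero_le_one fun x => by simp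

theorem norm_shift_mul (k : Idx N) (T : SeqSpace N X p →L[ℂ] SeqSpace N X p) :
    ‖shift p k * T‖ = ‖T‖ := by
  have h : ∀ (k : Idx N) (T : SeqSpace N X p →L[ℂ] SeqSpace N X p), ‖shift p k * T‖ ≤ ‖T‖ :=
    fun k T => (norm_mul_le _ _).trans (mul_le_of_le_one_left (norm_nonneg _) (norm_shift_le k))
  refine le_antisymm (h k T) ?_
  have h2 := h (-k) (shift p k * T)
  rwa [← mul_assoc, shift_neg_mul_shift, one_mul] at h2

theorem norm_mul_shift (k : Idx N) (T : SeqSpace N X p →L[ℂ] SeqSpace N X p) :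
    ‖T * shift p k‖ = ‖T‖ := by
  have h : ∀ (k : Idx N) (T : SeqSpace N X p →L[ℂ] SeqSpace N X p), ‖T * shift p k‖ ≤ ‖T‖ :=
    fun k T => (norm_mul_le _ _).trans (mul_le_of_le_one_right (norm_nonneg _) (norm_shift_le k))
  refine le_antisymm (h k T) ?_
  have h2 := h (-k) (T * shift p k)
  rwa [mul_assoc, shift_mul_shift_neg, mul_one] at h2

theorem norm_shift_conj (k : Idx N) (T : SeqSpace N X p →L[ℂ] SeqSpace N X p) :
    ‖shift p (-k) * T * shift p k‖ = ‖T‖ := by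
  rw [norm_mul_shift, norm_shift_mul]

theorem shift_conj_mul (k : Idx N) (S T : SeqSpace N X p →L[ℂ] SeqSpace N X p) :
    shift p (-k) * (S * T) * shift p k
      = (shift p (-k) * S * shift p k) * (shift p (-k) * T * shift p k) := by
  have h : S * T = S * (shift p k * shift p (-k)) * T := by rw [shift_mul_shift_neg, mul_one]
  rw [h]
  simp only [mul_assoc]

theorem shift_mul_scalarMul {θ : Idx N → ℝ} (h : ∀ i, |θ i| ≤ 1) (k : Idx N) :
    shift p (-k) * scalarMul p (fun i => θ (i - k)) * shift p k
      = (scalarMul p θ : SeqSpace N X p →L[ℂ] SeqSpace N X p) :=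
  ContinuousLinearMap.ext fun x => seq_ext fun i => by
    simp only [mul_apply_eq_comp, coord_shift]
    rw [coord_scalarMul fun i => h _, coord_scalarMul h, coord_shift]
    simp

end SeqSpaceBasics

/-! ### `P`-compact operators on the sequence spaces -/

section PCompact

variable {N : ℕ} {X : Type*} [NormedAddCommGroup X] [NormedSpace ℂ X] {p : Exponent}

theorem mem_pCompact_of_eventually {T : SeqSpace N X p →L[ℂ] SeqSpace N X p}
    (h : ∀ ε > 0, ∃ k, ∀ n ≥ k, ‖(1 - proj N X p n) * T‖ ≤ ε ∧ ‖T * (1 - proj N X p n)‖ ≤ ε) :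
    T ∈ pCompact (proj N X p) := by
  rw [mem_pCompact, Metric.tendsto_atTop]
  intro ε hε
  obtain ⟨k, hk⟩ := h (ε / 3) (by positivity)
  refine ⟨k, fun n hn => ?_⟩
  rw [Real.dist_0_eq_abs, abs_of_nonneg (by positivity)]
  linarith [(hk n hn).1, (hk n hn).2]

theorem eventually_of_mem_pCompact {T : SeqSpace N X p →L[ℂ] SeqSpace N X p}
    (h : T ∈ pCompact (proj N X p)) {ε : ℝ} (hε : 0 < ε) :
    ∃ k, ∀ n ≥ k, ‖(1 - proj N X p n) * T‖ ≤ ε ∧ ‖T * (1 - proj N X p n)‖ ≤ ε := by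
  rw [mem_pCompact, Metric.tendsto_atTop] at h
  obtain ⟨k, hk⟩ := h ε hε
  refine ⟨k, fun n hn => ?_⟩
  have h1 := hk n hn
  rw [Real.dist_0_eq_abs, abs_of_nonneg (by positivity)] at h1
  exact ⟨by linarith [norm_nonneg (T * (1 - proj N X p n))],
    by linarith [norm_nonneg ((1 - proj N X p n) * T)]⟩

theorem mem_pCompact_of_approx {T : SeqSpace N X p →L[ℂ] SeqSpace N X p}
    (h : ∀ ε > 0, ∃ K ∈ pCompact (proj N X p), ‖T - K‖ ≤ ε) : T ∈ pCompact (proj N X p) := by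
  refine mem_pCompact_of_eventually fun ε hε => ?_
  obtain ⟨K, hK, hTK⟩ := h (ε / 2) (by positivity)
  obtain ⟨k, hk⟩ := eventually_of_mem_pCompact hK (half_pos hε)
  refine ⟨k, fun n hn => ⟨?_, ?_⟩⟩
  · have h1 : (1 - proj N X p n) * T = (1 - proj N X p n) * (T - K) + (1 - proj N X p n) * K := by
      rw [mul_sub]; abel
    rw [h1]
    refine (norm_add_le _ _).trans ?_
    have h2 := (norm_mul_le (1 - proj N X p n) (T - K)).trans
      (mul_le_of_le_one_left (norm_nonneg _) (norm_one_sub_proj_le n))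
    linarith [(hk n hn).1]
  · have h1 : T * (1 - proj N X p n) = (T - K) * (1 - proj N X p n) + K * (1 - proj N X p n) := by
      rw [sub_mul]; abel
    rw [h1]
    refine (norm_add_le _ _).trans ?_
    have h2 := (norm_mul_le (T - K) (1 - proj N X p n)).trans
      (mul_le_of_le_one_right (norm_nonneg _) (norm_one_sub_proj_le n))
    linarith [(hk n hn).2]

theorem mem_pCompact_of_proj_mul {T : SeqSpace N X p →L[ℂ] SeqSpace N X p} {k : ℕ}
    (h1 : proj N X p k * T = T) (h2 : T * proj N X p k = T) : T ∈ pCompact (proj N X p) := by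
  refine mem_pCompact_of_eventually fun ε hε => ⟨k, fun n hn => ⟨?_, ?_⟩⟩
  · rw [← h1, ← mul_assoc, sub_mul, proj_mul_proj hn, one_mul, sub_self, zero_mul, norm_zero]
    exact hε.le
  · rw [← h2, mul_assoc, mul_sub, proj_mul_proj' hn, mul_one, sub_self, mul_zero, norm_zero]
    exact hε.le

theorem proj_mem_pCompact (k : ℕ) : proj N X p k ∈ pCompact (proj N X p) :=
  mem_pCompact_of_proj_mul (proj_mul_proj le_rfl) (proj_mul_proj le_rfl)

/-- `K` is a norm limit of `P_k K` and of `K P_k`, and `(T P_k) K`, `K (P_k T)` are products of two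
`P`-compact operators. Membership in `L(X, P)` can therefore be tested on the projections. -/
theorem mem_pAlg_of_proj {T : SeqSpace N X p →L[ℂ] SeqSpace N X p}
    (h1 : ∀ m, T * proj N X p m ∈ pCompact (proj N X p))
    (h2 : ∀ m, proj N X p m * T ∈ pCompact (proj N X p)) : T ∈ pAlg (proj N X p) := by
  intro K hK
  constructor
  · refine mem_pCompact_of_approx fun ε hε => ?_
    obtain ⟨k, hk⟩ := eventually_of_mem_pCompact hK (show 0 < ε / (‖T‖ + 1) by positivity)
    refine ⟨T * proj N X p k * K, mul_mem_pCompact (h1 k) hK, ?_⟩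
    have h3 : T * K - T * proj N X p k * K = T * ((1 - proj N X p k) * K) := by
      rw [sub_mul, one_mul, mul_sub, mul_assoc]
    rw [h3]
    refine (norm_mul_le _ _).trans ?_
    calc ‖T‖ * ‖(1 - proj N X p k) * K‖ ≤ (‖T‖ + 1) * (ε / (‖T‖ + 1)) := by
          gcongr
          · linarith
          · exact (hk k le_rfl).1
      _ = ε := by field_simp
  · refine mem_pCompact_of_approx fun ε hε => ?_
    obtain ⟨k, hk⟩ := eventually_of_mem_pCompact hK (show 0 < ε / (‖T‖ + 1) by positivity)
    refine ⟨K * (proj N X p k * T), mul_mem_pCompact hK (h2 k), ?_⟩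
    have h3 : K * T - K * (proj N X p k * T) = (K * (1 - proj N X p k)) * T := by
      rw [mul_sub, mul_one, sub_mul, mul_assoc]
    rw [h3]
    refine (norm_mul_le _ _).trans ?_
    calc ‖K * (1 - proj N X p k)‖ * ‖T‖ ≤ (ε / (‖T‖ + 1)) * (‖T‖ + 1) := by
          gcongr
          · exact (hk k le_rfl).2
          · linarith
      _ = ε := by field_simp

theorem mul_mem_pCompact_left {P : ℕ → SeqSpace N X p →L[ℂ] SeqSpace N X p}
    {T K : SeqSpace N X p →L[ℂ] SeqSpace N X p} (hT : T ∈ pAlg P) (hK : K ∈ pCompact P) :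
    T * K ∈ pCompact P := (hT K hK).1

theorem mul_mem_pCompact_right {P : ℕ → SeqSpace N X p →L[ℂ] SeqSpace N X p}
    {T K : SeqSpace N X p →L[ℂ] SeqSpace N X p} (hT : T ∈ pAlg P) (hK : K ∈ pCompact P) :
    K * T ∈ pCompact P := (hT K hK).2

/-- A cutoff: a finitely supported `lam`-Lipschitz function with values in `[0, 1]`. -/
structure IsCutoff (lam : ℝ) (φ : Idx N → ℝ) : Prop where
  nonneg : ∀ i, 0 ≤ φ i
  le_one : ∀ i, φ i ≤ 1
  lipschitz : ∀ i j, |φ i - φ j| ≤ lam * ‖i - j‖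
  finite : ∃ k : ℕ, ∀ i, k < ‖i‖ → φ i = 0

theorem IsCutoff.abs_le {lam : ℝ} {φ : Idx N → ℝ} (h : IsCutoff lam φ) (i : Idx N) : |φ i| ≤ 1 :=
  _root_.abs_le.2 ⟨by linarith [h.nonneg i], h.le_one i⟩

theorem IsCutoff.exists_proj_mul {lam : ℝ} {φ : Idx N → ℝ} (h : IsCutoff lam φ) :
    ∃ k : ℕ, proj N X p k * scalarMul p φ = scalarMul p φ ∧
      scalarMul p φ * proj N X p k = scalarMul p φ := by
  obtain ⟨k, hk⟩ := h.finite
  refine ⟨k, ?_, ?_⟩ <;>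
  · refine ContinuousLinearMap.ext fun x => seq_ext fun i => ?_
    simp only [mul_apply_eq_comp, coord_proj, coord_scalarMul h.abs_le]
    split_ifs with hi
    · rfl
    · rw [hk i (not_le.1 hi)]; simp

theorem IsCutoff.mem_pCompact {lam : ℝ} {φ : Idx N → ℝ} (h : IsCutoff lam φ) :
    (scalarMul p φ : SeqSpace N X p →L[ℂ] SeqSpace N X p) ∈ pCompact (proj N X p) := by
  obtain ⟨k, h1, h2⟩ := h.exists_proj_mul (X := X) (p := p)
  exact mem_pCompact_of_proj_mul h1 h2

theorem exists_isCutoff {lam : ℝ} (hlam : 0 < lam) (m : ℕ) :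
    ∃ φ : Idx N → ℝ, IsCutoff lam φ ∧ ∀ i, ‖i‖ ≤ m → φ i = 1 := by
  -- Equal to 1 on the ball of radius `m`, then decreasing with slope `lam` until it vanishes at
  -- radius `m + 1 / lam`.
  refine ⟨fun i => max 0 (min 1 (1 + lam * (m - ‖i‖))), ⟨fun i => le_max_left _ _,
    fun i => max_le zero_le_one (min_le_left _ _), fun i j => ?_, ?_⟩, fun i hi => ?_⟩
  · refine (abs_max_sub_max_le_max _ _ _ _).trans ?_
    rw [sub_self, abs_zero, max_eq_right (abs_nonneg _)]
    refine (abs_min_sub_min_le_max _ _ _ _).trans ?_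
    rw [sub_self, abs_zero, max_eq_right (abs_nonneg _)]
    have h1 : 1 + lam * (m - ‖i‖) - (1 + lam * (m - ‖j‖)) = lam * (‖j‖ - ‖i‖) := by ring
    rw [h1, abs_mul, abs_of_pos hlam, norm_sub_rev]
    gcongr
    exact abs_norm_sub_norm_le j i
  · obtain ⟨k, hk⟩ := exists_nat_ge (m + 1 / lam)
    refine ⟨k, fun i hi => max_eq_left ((min_le_right _ _).trans ?_)⟩
    have h1 : 1 / lam < ‖i‖ - m := by linarith
    rw [div_lt_iff₀ hlam] at h1
    nlinarith
  · have h1 : 0 ≤ lam * (m - ‖i‖) := mul_nonneg hlam.le (by linarith)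
    dsimp only
    rw [min_eq_left (by linarith)]
    exact max_eq_right zero_le_one

/-- Operators that almost commute with slowly varying cutoffs. -/
def SlowComm (T : SeqSpace N X p →L[ℂ] SeqSpace N X p) : Prop :=
  ∀ ε > 0, ∃ lam > 0, ∀ φ : Idx N → ℝ, IsCutoff lam φ →
    ‖scalarMul p φ * T - T * scalarMul p φ‖ ≤ ε

theorem scalarMul_mul_proj {φ : Idx N → ℝ} (hφ : ∀ i, |φ i| ≤ 1) {m : ℕ}
    (h : ∀ i, ‖i‖ ≤ m → φ i = 1) : scalarMul p φ * proj N X p m = proj N X p m := by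
  refine ContinuousLinearMap.ext fun x => seq_ext fun i => ?_
  simp only [mul_apply_eq_comp, coord_proj, coord_scalarMul hφ]
  split_ifs with hi
  · rw [h i hi]; simp
  · simp

theorem proj_mul_scalarMul {φ : Idx N → ℝ} (hφ : ∀ i, |φ i| ≤ 1) {m : ℕ}
    (h : ∀ i, ‖i‖ ≤ m → φ i = 1) : proj N X p m * scalarMul p φ = proj N X p m := by
  refine ContinuousLinearMap.ext fun x => seq_ext fun i => ?_
  simp only [mul_apply_eq_comp, coord_proj, coord_scalarMul hφ]
  split_ifs with hi
  · rw [h i hi]; simp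
  · simp

/-- For a cutoff `φ` equal to 1 on the cube `m`, the operator `T P_m = T φ P_m` is close to `φ T
P_m`, which is confined to a finite cube on both sides; `P_m T` is treated likewise. -/
theorem SlowComm.mem_pAlg {T : SeqSpace N X p →L[ℂ] SeqSpace N X p} (hT : SlowComm T) :
    T ∈ pAlg (proj N X p) := by
  refine mem_pAlg_of_proj (fun m => ?_) fun m => ?_
  · refine mem_pCompact_of_approx fun ε hε => ?_
    obtain ⟨lam, hlam, h⟩ := hT ε hε
    obtain ⟨φ, hφ, hφ1⟩ := exists_isCutoff (N := N) hlam m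
    obtain ⟨k, hk, -⟩ := hφ.exists_proj_mul (X := X) (p := p)
    refine ⟨scalarMul p φ * T * proj N X p m,
      mem_pCompact_of_proj_mul (k := max k m) ?_ ?_, ?_⟩
    · rw [← hk]
      simp only [← mul_assoc]
      rw [proj_mul_proj (le_max_left k m)]
    · rw [mul_assoc, proj_mul_proj' (le_max_right k m)]
    · have h1 : T * proj N X p m - scalarMul p φ * T * proj N X p m
          = -((scalarMul p φ * T - T * scalarMul p φ) * proj N X p m) := by
        rw [sub_mul, mul_assoc T, scalarMul_mul_proj hφ.abs_le hφ1, neg_sub]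
      rw [h1, norm_neg]
      exact (norm_mul_le _ _).trans
        ((mul_le_of_le_one_right (norm_nonneg _) (norm_proj_le m)).trans (h φ hφ))
  · refine mem_pCompact_of_approx fun ε hε => ?_
    obtain ⟨lam, hlam, h⟩ := hT ε hε
    obtain ⟨φ, hφ, hφ1⟩ := exists_isCutoff (N := N) hlam m
    obtain ⟨k, -, hk⟩ := hφ.exists_proj_mul (X := X) (p := p)
    refine ⟨proj N X p m * (T * scalarMul p φ),
      mem_pCompact_of_proj_mul (k := max k m) ?_ ?_, ?_⟩
    · rw [← mul_assoc, proj_mul_proj (le_max_right k m)]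
    · rw [← hk]
      simp only [mul_assoc]
      rw [proj_mul_proj' (le_max_left k m)]
    · have h1 : proj N X p m * T - proj N X p m * (T * scalarMul p φ)
          = proj N X p m * (scalarMul p φ * T - T * scalarMul p φ) := by
        rw [mul_sub, ← mul_assoc _ (scalarMul p φ), proj_mul_scalarMul hφ.abs_le hφ1]
      rw [h1]
      exact (norm_mul_le _ _).trans
        ((mul_le_of_le_one_left (norm_nonneg _) (norm_proj_le m)).trans (h φ hφ))

/-- This identity makes almost-commutation pass to inverses, at the price of a factor `‖S‖ ^ 2`. -/
theorem commutator_inverse {S T φ : SeqSpace N X p →L[ℂ] SeqSpace N X p} (h1 : S * T = 1)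
    (h2 : T * S = 1) : φ * S - S * φ = -(S * (φ * T - T * φ) * S) := by
  rw [mul_sub, sub_mul, neg_sub]
  simp only [mul_assoc]
  rw [h2, mul_one]
  simp only [← mul_assoc]
  rw [h1, one_mul]

theorem SlowComm.inverse {S T : SeqSpace N X p →L[ℂ] SeqSpace N X p} (hT : SlowComm T)
    (h1 : S * T = 1) (h2 : T * S = 1) : SlowComm S := by
  intro ε hε
  obtain ⟨lam, hlam, h⟩ := hT (ε / ((‖S‖ + 1) * (‖S‖ + 1))) (by positivity)
  refine ⟨lam, hlam, fun φ hφ => ?_⟩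
  rw [commutator_inverse h1 h2, norm_neg]
  calc _ ≤ ‖S‖ * ‖scalarMul p φ * T - T * scalarMul p φ‖ * ‖S‖ :=
        (norm_mul_le _ _).trans (by gcongr; exact norm_mul_le _ _)
    _ ≤ (‖S‖ + 1) * (ε / ((‖S‖ + 1) * (‖S‖ + 1))) * (‖S‖ + 1) := by
        gcongr
        · linarith
        · exact h φ hφ
        · linarith
    _ = ε := by field_simp

/-- A lower bound on finitely supported sequences extends to the whole space. -/
theorem SlowComm.lower_bound {T : SeqSpace N X p →L[ℂ] SeqSpace N X p} (hT : SlowComm T) {c : ℝ}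
    (hc : 0 ≤ c) (h : ∀ k x, c * ‖proj N X p k x‖ ≤ ‖T (proj N X p k x)‖) (x : SeqSpace N X p) :
    c * ‖x‖ ≤ ‖T x‖ := by
  rcases hc.eq_or_lt with rfl | hc
  · simp
  -- For a slow cutoff `φ` equal to 1 on the cube `m`, the hypothesis applies to `φ x`, which
  -- dominates `P_m x`, while `T (φ x)` is `φ (T x)` up to `ε ‖x‖`. Taking all `m` recovers `‖x‖`.
  have key : ∀ ε > 0, ‖x‖ ≤ (‖T x‖ + ε * ‖x‖) / c := by
    intro ε hε
    obtain ⟨lam, hlam, hl⟩ := hT ε hε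
    refine norm_le_of_norm_proj_le fun m => ?_
    obtain ⟨φ, hφ, hφ1⟩ := exists_isCutoff (N := N) hlam m
    obtain ⟨k, hk, -⟩ := hφ.exists_proj_mul (X := X) (p := p)
    rw [le_div_iff₀ hc, mul_comm]
    have e1 : proj N X p k (scalarMul p φ x) = scalarMul p φ x := DFunLike.congr_fun hk x
    have e2 : proj N X p m (scalarMul p φ x) = proj N X p m x :=
      DFunLike.congr_fun (proj_mul_scalarMul hφ.abs_le hφ1) x
    have e3 : T (scalarMul p φ x)
        = scalarMul p φ (T x) -
          (scalarMul p φ * T - T * scalarMul p φ : SeqSpace N X p →L[ℂ] SeqSpace N X p) x := by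
      simp
    calc c * ‖proj N X p m x‖ ≤ c * ‖scalarMul p φ x‖ := by
          gcongr; rw [← e2]; exact norm_proj_apply_le m _
      _ ≤ ‖T (scalarMul p φ x)‖ := by
          have := h k (scalarMul p φ x); rwa [e1] at this
      _ ≤ ‖T x‖ + ε * ‖x‖ := by
          rw [e3]
          refine (norm_sub_le _ _).trans (add_le_add (norm_scalarMul_apply_le hφ.abs_le _) ?_)
          exact (ContinuousLinearMap.le_opNorm _ _).trans (by gcongr; exact hl φ hφ)
  refine le_of_forall_pos_le_add fun ε hε => ?_
  have h1 := key (ε / (‖x‖ + 1)) (by positivity)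
  rw [le_div_iff₀ hc] at h1
  have h2 : ε / (‖x‖ + 1) * ‖x‖ ≤ ε := by
    rw [div_mul_eq_mul_div, div_le_iff₀ (by positivity)]
    nlinarith [norm_nonneg x]
  linarith

end PCompact

/-! ### Slowly varying families -/

section Families

open scoped NNReal

variable {N : ℕ} {X : Type*} [NormedAddCommGroup X] [NormedSpace ℂ X] {p : Exponent}

/-- A family of functions with values in `[0, 1]` that has overlap at most `c` and is slowly
varying, both measured in the `ℓ^q` norm over the family. -/
structure SlowFamily (q : ℝ≥0∞) (c lam : ℝ≥0) {J : Type} (θ : J → Idx N → ℝ) : Prop where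
  nonneg : ∀ a i, 0 ≤ θ a i
  le_one : ∀ a i, θ a i ≤ 1
  bound : ∀ i, ellNorm q (fun a => ‖θ a i‖ₑ) ≤ c
  slow : ∀ i j, ellNorm q (fun a => ‖θ a i - θ a j‖ₑ) ≤ lam * ‖i - j‖ₑ

theorem SlowFamily.abs_le {q : ℝ≥0∞} {c lam : ℝ≥0} {J : Type} {θ : J → Idx N → ℝ}
    (h : SlowFamily q c lam θ) (a : J) (i : Idx N) : |θ a i| ≤ 1 :=
  _root_.abs_le.2 ⟨by linarith [h.nonneg a i], h.le_one a i⟩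

theorem SlowFamily.mono {q : ℝ≥0∞} {c lam lam' : ℝ≥0} {J : Type} {θ : J → Idx N → ℝ}
    (h : SlowFamily q c lam θ) (hl : lam ≤ lam') : SlowFamily q c lam' θ :=
  ⟨h.nonneg, h.le_one, h.bound, fun i j => (h.slow i j).trans (by gcongr)⟩

/-- Summation over a family of entrywise estimates. -/
theorem ellNorm_family_le {J : Type*} (y : J → SeqSpace N X p) (x : SeqSpace N X p)
    (ρ : J → Idx N → ℝ≥0∞) (c : ℝ≥0∞) (h : ∀ a i, ‖coord i (y a)‖ₑ ≤ ρ a i * ‖coord i x‖ₑ)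
    (hρ : ∀ i, ellNorm p.normExp (fun a => ρ a i) ≤ c) :
    ellNorm p.normExp (fun a => ‖y a‖ₑ) ≤ c * ‖x‖ₑ := by
  simp_rw [← ellNorm_enorm]
  rw [ellNorm_comm, ← ellNorm_const_mul]
  refine ellNorm_mono fun i => ?_
  calc ellNorm p.normExp (fun a => ‖coord i (y a)‖ₑ)
      ≤ ellNorm p.normExp (fun a => ‖coord i x‖ₑ * ρ a i) :=
        ellNorm_mono fun a => (h a i).trans_eq (mul_comm _ _)
    _ = ‖coord i x‖ₑ * ellNorm p.normExp (fun a => ρ a i) := ellNorm_const_mul _ _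
    _ ≤ c * ‖coord i x‖ₑ := by rw [mul_comm]; gcongr; exact hρ i

theorem enorm_coord_scalarMul {θ : Idx N → ℝ} (h : ∀ i, |θ i| ≤ 1) (x : SeqSpace N X p)
    (i : Idx N) : ‖coord i (scalarMul p θ x)‖ₑ = ‖θ i‖ₑ * ‖coord i x‖ₑ := by
  rw [coord_scalarMul h, enorm_smul]
  congr 1
  rw [← ofReal_norm, ← ofReal_norm, Complex.norm_real]

theorem SlowFamily.ellNorm_scalarMul_le {c lam : ℝ≥0} {J : Type} {θ : J → Idx N → ℝ}
    (h : SlowFamily p.normExp c lam θ) (x : SeqSpace N X p) :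
    ellNorm p.normExp (fun a => ‖scalarMul p (θ a) x‖ₑ) ≤ c * ‖x‖ₑ :=
  ellNorm_family_le _ _ _ _ (fun a i => (enorm_coord_scalarMul (h.abs_le a) x i).le) h.bound

theorem enorm_op_apply_le (T : SeqSpace N X p →L[ℂ] SeqSpace N X p) (x : SeqSpace N X p) :
    ‖T x‖ₑ ≤ ‖T‖ₑ * ‖x‖ₑ := T.le_opENorm x

theorem ellNorm_op_apply_le {J : Type*} (T : SeqSpace N X p →L[ℂ] SeqSpace N X p)
    (y : J → SeqSpace N X p) :
    ellNorm p.normExp (fun a => ‖T (y a)‖ₑ) ≤ ‖T‖ₑ * ellNorm p.normExp (fun a => ‖y a‖ₑ) := by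
  rw [← ellNorm_const_mul]
  exact ellNorm_mono fun a => enorm_op_apply_le T _

theorem ellNorm_add_apply_le {J : Type*} (y z w : J → SeqSpace N X p)
    (h : ∀ a, y a = z a + w a) :
    ellNorm p.normExp (fun a => ‖y a‖ₑ) ≤
      ellNorm p.normExp (fun a => ‖z a‖ₑ) + ellNorm p.normExp (fun a => ‖w a‖ₑ) :=
  (ellNorm_mono fun a => by rw [h a]; exact enorm_add_le _ _).trans (ellNorm_add_le _ _)

/-- Operators that almost commute with slowly varying families. -/
def FamilyComm (T : SeqSpace N X p →L[ℂ] SeqSpace N X p) : Prop :=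
  ∀ c ε : ℝ≥0, 0 < ε → ∃ lam : ℝ≥0, 0 < lam ∧ ∀ (J : Type) (θ : J → Idx N → ℝ),
    SlowFamily p.normExp c lam θ → ∀ x,
      ellNorm p.normExp (fun a => ‖scalarMul p (θ a) (T x) - T (scalarMul p (θ a) x)‖ₑ)
        ≤ ε * ‖x‖ₑ

theorem FamilyComm.add {S T : SeqSpace N X p →L[ℂ] SeqSpace N X p} (hS : FamilyComm S)
    (hT : FamilyComm T) : FamilyComm (S + T) := by
  intro c ε hε
  obtain ⟨l1, h1, hS⟩ := hS c (ε / 2) (half_pos hε)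
  obtain ⟨l2, h2, hT⟩ := hT c (ε / 2) (half_pos hε)
  refine ⟨min l1 l2, lt_min h1 h2, fun J θ hθ x => ?_⟩
  refine (ellNorm_add_apply_le _ (fun a => scalarMul p (θ a) (S x) - S (scalarMul p (θ a) x))
    (fun a => scalarMul p (θ a) (T x) - T (scalarMul p (θ a) x)) fun a => ?_).trans ?_
  · simp only [add_apply, map_add]; abel
  · refine (add_le_add (hS J θ (hθ.mono (min_le_left _ _)) x)
      (hT J θ (hθ.mono (min_le_right _ _)) x)).trans_eq ?_
    rw [← add_mul, ← ENNReal.coe_add, add_halves]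

theorem FamilyComm.neg {T : SeqSpace N X p →L[ℂ] SeqSpace N X p} (hT : FamilyComm T) :
    FamilyComm (-T) := by
  intro c ε hε
  obtain ⟨l, h, hT⟩ := hT c ε hε
  refine ⟨l, h, fun J θ hθ x => (ellNorm_mono fun a => ?_).trans (hT J θ hθ x)⟩
  rw [← enorm_neg]
  simp only [neg_apply, map_neg]
  rw [neg_sub, neg_sub_neg, ← enorm_neg, neg_sub]

theorem FamilyComm.sub {S T : SeqSpace N X p →L[ℂ] SeqSpace N X p} (hS : FamilyComm S)
    (hT : FamilyComm T) : FamilyComm (S - T) := sub_eq_add_neg S T ▸ hS.add hT.neg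

theorem familyComm_of_commute {T : SeqSpace N X p →L[ℂ] SeqSpace N X p}
    (h : ∀ θ : Idx N → ℝ, (∀ i, |θ i| ≤ 1) → ∀ x, scalarMul p θ (T x) = T (scalarMul p θ x)) :
    FamilyComm T := by
  intro c ε _
  refine ⟨1, zero_lt_one, fun J θ hθ x => ?_⟩
  have h0 : ∀ a, ‖scalarMul p (θ a) (T x) - T (scalarMul p (θ a) x)‖ₑ = 0 := fun a => by
    rw [h _ (hθ.abs_le a), sub_self, enorm_zero]
  simp_rw [h0]
  rw [ellNorm_zero]
  exact zero_le

theorem familyComm_zero : FamilyComm (0 : SeqSpace N X p →L[ℂ] SeqSpace N X p) :=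
  familyComm_of_commute fun θ _ x => by simp

theorem familyComm_one : FamilyComm (1 : SeqSpace N X p →L[ℂ] SeqSpace N X p) :=
  familyComm_of_commute fun θ _ x => by simp

theorem familyComm_proj (n : ℕ) : FamilyComm (proj N X p n) :=
  familyComm_of_commute fun θ hθ x => seq_ext fun i => by
    rw [coord_scalarMul hθ, coord_proj, coord_proj, coord_scalarMul hθ]
    split_ifs <;> simp

theorem FamilyComm.mul {S T : SeqSpace N X p →L[ℂ] SeqSpace N X p} (hS : FamilyComm S)
    (hT : FamilyComm T) : FamilyComm (S * T) := by
  intro c ε hε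
  obtain ⟨l1, h1, hS⟩ := hS c (ε / 2 / (‖T‖₊ + 1)) (by positivity)
  obtain ⟨l2, h2, hT⟩ := hT c (ε / 2 / (‖S‖₊ + 1)) (by positivity)
  refine ⟨min l1 l2, lt_min h1 h2, fun J θ hθ x => ?_⟩
  refine (ellNorm_add_apply_le _
    (fun a => scalarMul p (θ a) (S (T x)) - S (scalarMul p (θ a) (T x)))
    (fun a => S (scalarMul p (θ a) (T x) - T (scalarMul p (θ a) x))) fun a => ?_).trans ?_
  · simp only [mul_apply_eq_comp, map_sub]; abel
  · refine (add_le_add (hS J θ (hθ.mono (min_le_left _ _)) (T x))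
      ((ellNorm_op_apply_le S _).trans
        (mul_le_mul_right (hT J θ (hθ.mono (min_le_right _ _)) x) _))).trans ?_
    have e1 : ε / 2 / (‖T‖₊ + 1) * ‖T‖₊ ≤ ε / 2 := by
      rw [div_mul_eq_mul_div, div_le_iff₀ (by positivity)]; gcongr; simp
    have e2 : ‖S‖₊ * (ε / 2 / (‖S‖₊ + 1)) ≤ ε / 2 := by
      rw [mul_comm, div_mul_eq_mul_div, div_le_iff₀ (by positivity)]; gcongr; simp
    calc _ ≤ ((ε / 2 / (‖T‖₊ + 1) : ℝ≥0) : ℝ≥0∞) * (‖T‖ₑ * ‖x‖ₑ)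
          + ‖S‖ₑ * (((ε / 2 / (‖S‖₊ + 1) : ℝ≥0) : ℝ≥0∞) * ‖x‖ₑ) := by
            gcongr; exact enorm_op_apply_le T x
      _ = ((ε / 2 / (‖T‖₊ + 1) * ‖T‖₊ : ℝ≥0) : ℝ≥0∞) * ‖x‖ₑ
          + ((‖S‖₊ * (ε / 2 / (‖S‖₊ + 1)) : ℝ≥0) : ℝ≥0∞) * ‖x‖ₑ := by
            rw [ENNReal.coe_mul, ENNReal.coe_mul, mul_assoc, mul_assoc]; rfl
      _ ≤ ((ε / 2 : ℝ≥0) : ℝ≥0∞) * ‖x‖ₑ + ((ε / 2 : ℝ≥0) : ℝ≥0∞) * ‖x‖ₑ := by gcongr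
      _ = ε * ‖x‖ₑ := by rw [← add_mul, ← ENNReal.coe_add, add_halves]

theorem FamilyComm.inverse {S T : SeqSpace N X p →L[ℂ] SeqSpace N X p} (hT : FamilyComm T)
    (h1 : S * T = 1) (h2 : T * S = 1) : FamilyComm S := by
  intro c ε hε
  obtain ⟨l, hl, hT⟩ := hT c (ε / ((‖S‖₊ + 1) * (‖S‖₊ + 1))) (by positivity)
  refine ⟨l, hl, fun J θ hθ x => ?_⟩
  have e : ∀ a, scalarMul p (θ a) (S x) - S (scalarMul p (θ a) x)
      = (-S) (scalarMul p (θ a) (T (S x)) - T (scalarMul p (θ a) (S x))) := fun a => by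
    have := DFunLike.congr_fun (commutator_inverse (φ := scalarMul p (θ a)) h1 h2) x
    simpa using this
  simp_rw [e]
  refine (ellNorm_op_apply_le (-S) _).trans
    ((mul_le_mul_right (hT J θ hθ (S x)) _).trans ?_)
  rw [enorm_neg]
  calc _ ≤ ‖S‖ₑ * (((ε / ((‖S‖₊ + 1) * (‖S‖₊ + 1)) : ℝ≥0) : ℝ≥0∞) * (‖S‖ₑ * ‖x‖ₑ)) := by
        gcongr; exact enorm_op_apply_le S x
    _ = ((‖S‖₊ * (ε / ((‖S‖₊ + 1) * (‖S‖₊ + 1))) * ‖S‖₊ : ℝ≥0) : ℝ≥0∞) * ‖x‖ₑ := by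
        rw [ENNReal.coe_mul, ENNReal.coe_mul]; simp only [mul_assoc]; rfl
    _ ≤ ε * ‖x‖ₑ := by
        gcongr
        calc ‖S‖₊ * (ε / ((‖S‖₊ + 1) * (‖S‖₊ + 1))) * ‖S‖₊
            ≤ (‖S‖₊ + 1) * (ε / ((‖S‖₊ + 1) * (‖S‖₊ + 1))) * (‖S‖₊ + 1) := by gcongr <;> simp
          _ = ε := by field_simp

/-- Entry `i` of the commutator applied to `x` is `(θ i - θ (i - β)) a_i x_{i-β}`, so slowness of
the family at distance `‖β‖` is all that is needed. -/
theorem familyComm_mulOp_mul_shift (a : lp (fun _ : Idx N => X →L[ℂ] X) ∞) (β : Idx N) :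
    FamilyComm (mulOp p a * shift p β) := by
  intro c ε hε
  refine ⟨ε / (‖a‖₊ * ‖β‖₊ + 1), by positivity, fun J θ hθ x => ?_⟩
  refine (ellNorm_family_le _ (shift p β x) (fun b i => ‖θ b i - θ b (i - β)‖ₑ * ‖a‖ₑ) ε
    (fun b i => ?_) fun i => ?_).trans_eq ?_
  · have h1 : coord i (scalarMul p (θ b) ((mulOp p a * shift p β : SeqSpace N X p →L[ℂ] SeqSpace N X p) x)
        - (mulOp p a * shift p β : SeqSpace N X p →L[ℂ] SeqSpace N X p) (scalarMul p (θ b) x))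
        = ((θ b i - θ b (i - β) : ℝ) : ℂ) • (a i) (coord (i - β) x) := by
      rw [map_sub, coord_scalarMul (hθ.abs_le b)]
      have h2 : coord i ((mulOp p a * shift p β : SeqSpace N X p →L[ℂ] SeqSpace N X p) (scalarMul p (θ b) x))
          = a i (coord (i - β) (scalarMul p (θ b) x)) := rfl
      rw [h2, coord_scalarMul (hθ.abs_le b), map_smul, Complex.ofReal_sub, sub_smul]
      rfl
    rw [h1, enorm_smul, coord_shift, mul_assoc]
    have h3 : ‖((θ b i - θ b (i - β) : ℝ) : ℂ)‖ₑ = ‖θ b i - θ b (i - β)‖ₑ := by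
      rw [← ofReal_norm, ← ofReal_norm, Complex.norm_real]
    rw [h3]
    gcongr
    refine ((a i).le_opENorm _).trans ?_
    gcongr
    rw [enorm_le_iff_norm_le]
    exact lp.norm_apply_le_norm ENNReal.top_ne_zero a i
  · simp_rw [mul_comm _ ‖a‖ₑ]
    rw [ellNorm_const_mul]
    refine (mul_le_mul_right (hθ.slow i (i - β)) _).trans ?_
    rw [sub_sub_cancel]
    have e1 : ‖a‖₊ * (ε / (‖a‖₊ * ‖β‖₊ + 1) * ‖β‖₊) ≤ ε := by
      have h4 : ‖a‖₊ * (ε / (‖a‖₊ * ‖β‖₊ + 1) * ‖β‖₊) = ε * (‖a‖₊ * ‖β‖₊) / (‖a‖₊ * ‖β‖₊ + 1) := by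
        ring
      rw [h4, div_le_iff₀ (by positivity)]
      gcongr
      simp
    calc _ = ((‖a‖₊ * (ε / (‖a‖₊ * ‖β‖₊ + 1) * ‖β‖₊) : ℝ≥0) : ℝ≥0∞) := by
          rw [ENNReal.coe_mul, ENNReal.coe_mul]; rfl
      _ ≤ ε := by exact_mod_cast e1
  · rw [← ofReal_norm, ← ofReal_norm, norm_shift_apply]

theorem IsBand.familyComm {T : SeqSpace N X p →L[ℂ] SeqSpace N X p} (hT : IsBand T) :
    FamilyComm T := by
  classical
  obtain ⟨S, a, rfl⟩ := hT
  induction S using Finset.induction_on with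
  | empty => simpa using familyComm_zero
  | insert b S hb ih =>
    rw [Finset.sum_insert hb]
    exact (familyComm_mulOp_mul_shift _ _).add ih

theorem IsBandDominated.familyComm {T : SeqSpace N X p →L[ℂ] SeqSpace N X p}
    (hT : IsBandDominated T) : FamilyComm T := by
  intro c ε hε
  -- Replacing `T` by the band operator `T'` costs two terms of size `c ‖T - T'‖ ≤ ε / 4`, where `c`
  -- bounds the overlap of the family; `ε / 2` is left for the commutator of `T'`.
  obtain ⟨T', hT', hd⟩ := Metric.mem_closure_iff.1 hT (ε / (4 * (c + 1))) (by positivity)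
  rw [dist_eq_norm] at hd
  have hd' : ‖T - T'‖₊ ≤ ε / (4 * (c + 1)) := by
    rw [← NNReal.coe_le_coe]; push_cast; exact hd.le
  obtain ⟨l, hl, h⟩ := IsBand.familyComm hT' c (ε / 2) (half_pos hε)
  refine ⟨l, hl, fun J θ hθ x => ?_⟩
  refine (ellNorm_add_apply_le _ (fun a => scalarMul p (θ a) (T' x) - T' (scalarMul p (θ a) x))
    (fun a => scalarMul p (θ a) ((T - T') x) + (T' - T) (scalarMul p (θ a) x)) fun a => ?_).trans ?_
  · simp only [sub_apply, map_sub]; abel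
  · have e2 : ‖T' - T‖ₑ = ‖T - T'‖ₑ := by rw [← ofReal_norm, ← ofReal_norm, norm_sub_rev]
    have e1 : c * (ε / (4 * (c + 1))) ≤ ε / 4 := by
      rw [mul_div_assoc', div_le_div_iff₀ (by positivity) (by positivity)]
      calc c * ε * 4 ≤ (c + 1) * ε * 4 := by gcongr; simp
        _ = ε * (4 * (c + 1)) := by ring
    have e3 : (c : ℝ≥0∞) * (‖T - T'‖ₑ * ‖x‖ₑ) ≤ ((ε / 4 : ℝ≥0) : ℝ≥0∞) * ‖x‖ₑ := by
      rw [← mul_assoc]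
      gcongr
      calc (c : ℝ≥0∞) * ‖T - T'‖ₑ = ((c * ‖T - T'‖₊ : ℝ≥0) : ℝ≥0∞) := by
            rw [ENNReal.coe_mul]; rfl
        _ ≤ ((ε / 4 : ℝ≥0) : ℝ≥0∞) := by
            refine ENNReal.coe_le_coe.2 (le_trans ?_ e1)
            gcongr
    calc _ ≤ ((ε / 2 : ℝ≥0) : ℝ≥0∞) * ‖x‖ₑ +
          (c * (‖T - T'‖ₑ * ‖x‖ₑ) + ‖T - T'‖ₑ * (c * ‖x‖ₑ)) := by
          refine add_le_add (h J θ hθ x)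
            ((ellNorm_add_apply_le _ _ _ fun a => rfl).trans (add_le_add ?_ ?_))
          · refine (hθ.ellNorm_scalarMul_le _).trans ?_
            gcongr
            exact enorm_op_apply_le _ _
          · refine (ellNorm_op_apply_le _ _).trans ?_
            rw [e2]
            gcongr
            exact hθ.ellNorm_scalarMul_le _
      _ ≤ ((ε / 2 : ℝ≥0) : ℝ≥0∞) * ‖x‖ₑ +
          (((ε / 4 : ℝ≥0) : ℝ≥0∞) * ‖x‖ₑ + ((ε / 4 : ℝ≥0) : ℝ≥0∞) * ‖x‖ₑ) := by
          rw [mul_left_comm ‖T - T'‖ₑ]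
          gcongr
      _ = ε * ‖x‖ₑ := by
          rw [← add_mul, ← add_mul, ← ENNReal.coe_add, ← ENNReal.coe_add]
          congr 2
          rw [← NNReal.coe_inj]; push_cast; ring

/-- Uniform version of `SlowComm` for all shifts of an operator. -/
theorem FamilyComm.shift_conj {T : SeqSpace N X p →L[ℂ] SeqSpace N X p} (hT : FamilyComm T)
    {ε : ℝ} (hε : 0 < ε) : ∃ lam > 0, ∀ φ : Idx N → ℝ, IsCutoff lam φ → ∀ k,
      ‖scalarMul p φ * (shift p (-k) * T * shift p k)
        - (shift p (-k) * T * shift p k) * scalarMul p φ‖ ≤ ε := by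
  lift ε to ℝ≥0 using hε.le
  obtain ⟨lam, hlam, h⟩ := hT 1 ε (by exact_mod_cast hε)
  refine ⟨lam, by exact_mod_cast hlam, fun φ hφ k => ?_⟩
  have hφk : ∀ i, |φ (i - k)| ≤ 1 := fun i => hφ.abs_le _
  -- The commutator with the shifted operator is the shift of the commutator of `T` with a translate
  -- of `φ`. Translates are equally slow, so `lam` does not depend on `k`; the translate is used as
  -- a family with one member.
  rw [← shift_mul_scalarMul hφ.abs_le k, ← shift_conj_mul, ← shift_conj_mul, ← sub_mul, ← mul_sub,
    norm_shift_conj]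
  refine ContinuousLinearMap.opNorm_le_bound _ ε.coe_nonneg fun x => ?_
  have h1 := h Unit (fun _ i => φ (i - k)) ⟨fun _ i => hφ.nonneg _, fun _ i => hφ.le_one _,
    fun i => ?_, fun i j => ?_⟩ x
  · rw [ellNorm_single _ () fun j hj => absurd rfl hj] at h1
    rw [← ENNReal.ofReal_le_ofReal_iff (by positivity), ofReal_norm, ENNReal.ofReal_mul ε.coe_nonneg,
      ofReal_norm, ENNReal.ofReal_coe_nnreal]
    exact h1
  · rw [ellNorm_single _ () fun j hj => absurd rfl hj]
    rw [← ofReal_norm, ENNReal.coe_one, ENNReal.ofReal_le_one]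
    exact hφk i
  · rw [ellNorm_single _ () fun j hj => absurd rfl hj]
    rw [← ofReal_norm, ← ofReal_norm, ← ENNReal.ofReal_coe_nnreal, ← ENNReal.ofReal_mul lam.coe_nonneg]
    refine ENNReal.ofReal_le_ofReal ((hφ.lipschitz _ _).trans_eq ?_)
    rw [sub_sub_sub_cancel_right]

theorem FamilyComm.slowComm {T : SeqSpace N X p →L[ℂ] SeqSpace N X p} (hT : FamilyComm T) :
    SlowComm T := by
  intro ε hε
  obtain ⟨lam, hlam, h⟩ := hT.shift_conj hε
  refine ⟨lam, hlam, fun φ hφ => ?_⟩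
  have h0 : (shift p (-0) * T * shift p 0 : SeqSpace N X p →L[ℂ] SeqSpace N X p) = T :=
    ContinuousLinearMap.ext fun x => by simp
  have := h φ hφ 0
  rwa [h0] at this

end Families

/-! ### Two slowly varying families, and localization -/

section Localization

open scoped NNReal

variable {N : ℕ} {X : Type*} [NormedAddCommGroup X] [NormedSpace ℂ X] {p : Exponent}

theorem norm_idx_lt_iff {r : ℝ} (hr : 0 < r) (i : Idx N) : ‖i‖ < r ↔ ∀ k, |(i k : ℝ)| < r := by
  rw [pi_norm_lt_iff hr]
  simp only [Int.norm_eq_abs]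

theorem norm_idx_le_iff {r : ℝ} (hr : 0 ≤ r) (i : Idx N) : ‖i‖ ≤ r ↔ ∀ k, |(i k : ℝ)| ≤ r := by
  rw [pi_norm_le_iff_of_nonneg hr]
  simp only [Int.norm_eq_abs]

/-- The lower corner of the cube of side length `L` that contains `i`. -/
def tileCorner (L : ℕ) (i : Idx N) : Idx N := fun k => i k / L

theorem norm_sub_tileCorner_le {L : ℕ} (hL : 0 < L) (i : Idx N) :
    ‖i - (L : ℤ) • tileCorner L i‖ ≤ L := by
  rw [norm_idx_le_iff (by positivity)]
  intro k
  have h0 : (0 : ℤ) < L := by exact_mod_cast hL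
  have h1 := Int.emod_nonneg (i k) h0.ne'
  have h2 := Int.emod_lt_of_pos (i k) h0
  have h3 := Int.mul_ediv_add_emod (i k) L
  have h4 : (i - (L : ℤ) • tileCorner L i) k = i k % L := by
    simp only [Pi.sub_apply, Pi.smul_apply, smul_eq_mul, tileCorner]
    linarith
  rw [h4]
  norm_cast
  rw [abs_of_nonneg h1]
  exact_mod_cast h2.le

/-- The tent function of radius `2 r`. -/
def tent (r : ℕ) (j : Idx N) : ℝ := max 0 (1 - ‖j‖ / (2 * r))

theorem tent_nonneg (r : ℕ) (j : Idx N) : 0 ≤ tent r j := le_max_left _ _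

theorem tent_le_one (r : ℕ) (j : Idx N) : tent r j ≤ 1 :=
  max_le zero_le_one (sub_le_self _ (by positivity))

theorem tent_zero (r : ℕ) : tent r (0 : Idx N) = 1 := by simp [tent]

theorem half_le_tent {r : ℕ} (hr : 0 < r) {j : Idx N} (hj : ‖j‖ ≤ r) : 1 / 2 ≤ tent r j := by
  refine le_max_of_le_right ?_
  have hr' : (0 : ℝ) < r := by exact_mod_cast hr
  have : ‖j‖ / (2 * r) ≤ 1 / 2 := by
    rw [div_le_div_iff₀ (by positivity) (by positivity)]; linarith
  linarith

theorem tent_eq_zero {r : ℕ} (hr : 0 < r) {j : Idx N} (hj : 2 * r ≤ ‖j‖) : tent r j = 0 := by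
  refine max_eq_left ?_
  have hr' : (0 : ℝ) < r := by exact_mod_cast hr
  rw [sub_nonpos, one_le_div (by positivity)]
  exact hj

theorem abs_tent_sub_tent_le {r : ℕ} (i j : Idx N) :
    |tent r i - tent r j| ≤ ‖i - j‖ / (2 * r) := by
  refine (abs_max_sub_max_le_max _ _ _ _).trans ?_
  rw [sub_self, abs_zero, max_eq_right (abs_nonneg _), sub_sub_sub_cancel_left, ← sub_div, abs_div,
    abs_of_nonneg (show (0 : ℝ) ≤ 2 * r by positivity), norm_sub_rev]
  gcongr
  exact abs_norm_sub_norm_le j i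

theorem finite_norm_sub_le (j : Idx N) (r : ℝ) : {i : Idx N | ‖i - j‖ ≤ r}.Finite := by
  have h := (isCompact_closedBall j r).finite_of_discrete
  refine h.subset fun i hi => ?_
  rw [Metric.mem_closedBall, dist_eq_norm]
  exact hi

theorem ellNorm_tent_ne_top (q : ℝ≥0∞) [Fact (1 ≤ q)] {r : ℕ} (hr : 0 < r) :
    ellNorm q (fun j : Idx N => ‖tent r j‖ₑ) ≠ ∞ := by
  refine ((ellNorm_le_sum (finite_norm_sub_le (0 : Idx N) (2 * r)).toFinset _ fun i hi => ?_).trans_lt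
    (ENNReal.sum_lt_top.2 fun i _ => enorm_lt_top)).ne
  simp only [Set.Finite.mem_toFinset, Set.mem_ofPred_eq, sub_zero, not_le] at hi
  rw [tent_eq_zero hr hi.le, enorm_zero]

theorem one_le_ellNorm_tent (q : ℝ≥0∞) [Fact (1 ≤ q)] (r : ℕ) :
    1 ≤ ellNorm q (fun j : Idx N => ‖tent r j‖ₑ) := by
  refine le_trans ?_ (le_ellNorm _ 0)
  rw [tent_zero, enorm_one]

theorem ellNorm_sub_left (q : ℝ≥0∞) (f : Idx N → ℝ≥0∞) (i : Idx N) :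
    ellNorm q (fun a => f (i - a)) = ellNorm q f := ellNorm_equiv (Equiv.subLeft i) f

theorem ellNorm_sub_right (q : ℝ≥0∞) (f : Idx N → ℝ≥0∞) (i : Idx N) :
    ellNorm q (fun a => f (a - i)) = ellNorm q f := ellNorm_equiv (Equiv.subRight i) f

open Classical in
/-- A large ball is covered by boundedly many balls on which a tent function is large. -/
theorem ellNorm_ball_le (q : ℝ≥0∞) [Fact (1 ≤ q)] {r : ℕ} (hr : 0 < r) :
    ellNorm q (fun j : Idx N => if ‖j‖ < 3 * r then (1 : ℝ≥0∞) else 0)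
      ≤ 7 ^ N * (2 * ellNorm q (fun j : Idx N => ‖tent r j‖ₑ)) := by
  -- If `‖j‖ < 3 r`, then `j` lies in the tile of side `r` with index `⌊j / r⌋`, whose entries are
  -- in `[-3, 2]`. On that tile the tent centred at the corner is at least `1 / 2`, whence the
  -- factor 2; the `7 ^ N` indices leave some slack.
  let D : Finset (Idx N) := Fintype.piFinset fun _ => Finset.Icc (-3 : ℤ) 3
  have hr' : (0 : ℝ) < r := by exact_mod_cast hr
  have hr0 : (0 : ℤ) < r := by exact_mod_cast hr
  have hD : D.card = 7 ^ N := by simp [D]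
  have h1 : ∀ j : Idx N, (if ‖j‖ < 3 * r then (1 : ℝ≥0∞) else 0)
      ≤ ∑ d ∈ D, 2 * ‖tent r (j - (r : ℤ) • d)‖ₑ := by
    intro j
    split_ifs with hj
    · have hd : tileCorner r j ∈ D := by
        rw [norm_idx_lt_iff (by positivity)] at hj
        simp only [D, Fintype.mem_piFinset, Finset.mem_Icc, tileCorner]
        intro k
        have := abs_lt.1 (hj k)
        have e1 : -3 * (r : ℤ) ≤ j k := by
          have : (-3 * r : ℝ) < j k := by linarith
          exact_mod_cast this.le
        have e2 : j k < 3 * (r : ℤ) := by exact_mod_cast this.2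
        exact ⟨(Int.le_ediv_iff_mul_le hr0).2 e1, (Int.ediv_lt_of_lt_mul hr0 e2).le⟩
      refine le_trans ?_ (Finset.single_le_sum (fun _ _ => zero_le) hd)
      have h2 := half_le_tent hr (norm_sub_tileCorner_le hr j)
      rw [← ofReal_norm, Real.norm_of_nonneg (tent_nonneg _ _), ← ENNReal.ofReal_ofNat 2,
        ← ENNReal.ofReal_mul (by norm_num), ← ENNReal.ofReal_one]
      exact ENNReal.ofReal_le_ofReal (by linarith)
    · exact zero_le
  refine (ellNorm_mono h1).trans ((ellNorm_sum_le D _).trans ?_)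
  have h3 : ∀ d ∈ D, ellNorm q (fun j : Idx N => 2 * ‖tent r (j - (r : ℤ) • d)‖ₑ)
      = 2 * ellNorm q (fun j : Idx N => ‖tent r j‖ₑ) := fun d _ => by
    rw [ellNorm_const_mul]
    congr 1
    exact ellNorm_sub_right q (fun j => ‖tent r j‖ₑ) _
  rw [Finset.sum_congr rfl h3, Finset.sum_const, hD, nsmul_eq_mul]
  push_cast
  rfl

/-- Normalized translates of a wide tent function. -/
theorem exists_localizing_family (q : ℝ≥0∞) [Fact (1 ≤ q)] {lam : ℝ≥0} (hlam : 0 < lam) :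
    ∃ (D : ℕ) (θ : Idx N → Idx N → ℝ), SlowFamily q 1 lam θ ∧
      (∀ i, ellNorm q (fun a => ‖θ a i‖ₑ) = 1) ∧ ∀ a i, θ a i ≠ 0 → ‖i - a‖ ≤ D := by
  classical
  -- For near points the variation is at most `‖i - j‖ / (2 r C)` times the norm `7 ^ N * 2 C` of a
  -- ball, that is `7 ^ N ‖i - j‖ / r`: the normalizing constant `C` cancels. The extra factor 2
  -- serves the trivial bound for far points.
  obtain ⟨r, hr⟩ := exists_nat_ge (2 * 7 ^ N / (lam : ℝ))
  have hlam' : (0 : ℝ) < lam := by exact_mod_cast hlam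
  have hr' : (0 : ℝ) < r := lt_of_lt_of_le (by positivity) hr
  have hr0 : 0 < r := by exact_mod_cast hr'
  have hlr : 2 * 7 ^ N / r ≤ (lam : ℝ) := by
    rw [div_le_iff₀ hlam'] at hr
    rw [div_le_iff₀ hr']
    linarith
  set C := ellNorm q (fun j : Idx N => ‖tent r j‖ₑ) with hC
  have hCtop : C ≠ ∞ := ellNorm_tent_ne_top q hr0
  have hC1 : 1 ≤ C := one_le_ellNorm_tent q r
  have hc1 : 1 ≤ C.toReal := by simpa using ENNReal.toReal_mono hCtop hC1
  have hc0 : 0 < C.toReal := by linarith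
  have hCof : ENNReal.ofReal C.toReal = C := ENNReal.ofReal_toReal hCtop
  have hsum : ∀ i : Idx N, ellNorm q (fun a => ‖tent r (i - a) / C.toReal‖ₑ) = 1 := by
    intro i
    have h1 : ∀ a, ‖tent r (i - a) / C.toReal‖ₑ
        = ENNReal.ofReal (C.toReal)⁻¹ * ‖tent r (i - a)‖ₑ := fun a => by
      rw [div_eq_inv_mul, enorm_mul, ← ofReal_norm, Real.norm_of_nonneg (by positivity)]
    simp_rw [h1]
    rw [ellNorm_const_mul, ellNorm_sub_left q (fun j => ‖tent r j‖ₑ), ← hC,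
      ENNReal.ofReal_inv_of_pos hc0, hCof,
      ENNReal.inv_mul_cancel (zero_lt_one.trans_le hC1).ne' hCtop]
  refine ⟨2 * r, fun a i => tent r (i - a) / C.toReal, ⟨fun a i => ?_, fun a i => ?_, fun i => ?_,
    fun i j => ?_⟩, hsum, fun a i h => ?_⟩
  · have := tent_nonneg r (i - a)
    positivity
  · exact (div_le_one hc0).2 ((tent_le_one r _).trans hc1)
  · rw [hsum i]; simp
  · have hN : (1 : ℝ) ≤ 7 ^ N := one_le_pow₀ (by norm_num)
    have hgoal : (lam : ℝ≥0∞) * ‖i - j‖ₑ = ENNReal.ofReal (lam * ‖i - j‖) := by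
      rw [ENNReal.ofReal_mul lam.coe_nonneg, ENNReal.ofReal_coe_nnreal, ofReal_norm]
    rw [hgoal]
    -- At distance at least `r` the normalization bounds the variation by 2. At smaller distance
    -- both tents vanish once `‖i - a‖ ≥ 3 r`.
    by_cases hij : r ≤ ‖i - j‖
    · have h1 : ellNorm q (fun a => ‖tent r (i - a) / C.toReal - tent r (j - a) / C.toReal‖ₑ)
          ≤ 1 + 1 := by
        refine le_trans (ellNorm_mono fun a => enorm_sub_le) ?_
        refine (ellNorm_add_le _ _).trans ?_
        rw [hsum i, hsum j]
      refine h1.trans ?_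
      rw [one_add_one_eq_two, ← ENNReal.ofReal_ofNat 2]
      refine ENNReal.ofReal_le_ofReal ?_
      calc (2 : ℝ) ≤ 2 * 7 ^ N := by linarith
        _ = 2 * 7 ^ N / r * r := by field_simp
        _ ≤ lam * ‖i - j‖ := by gcongr
    · rw [not_le] at hij
      have h1 : ∀ a, ‖tent r (i - a) / C.toReal - tent r (j - a) / C.toReal‖ₑ
          ≤ ENNReal.ofReal (‖i - j‖ / (2 * r) / C.toReal) *
            (fun b : Idx N => if ‖b‖ < 3 * r then (1 : ℝ≥0∞) else 0) (i - a) := by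
        intro a
        dsimp only
        split_ifs with ha
        · rw [mul_one, ← sub_div, ← ofReal_norm, Real.norm_eq_abs, abs_div, abs_of_pos hc0]
          refine ENNReal.ofReal_le_ofReal ?_
          gcongr
          refine (abs_tent_sub_tent_le _ _).trans_eq ?_
          rw [sub_sub_sub_cancel_right]
        · rw [not_lt] at ha
          have h2 : ‖i - a‖ ≤ ‖j - a‖ + ‖i - j‖ := by
            have := norm_add_le (j - a) (i - j)
            rwa [show j - a + (i - j) = i - a by abel] at this
          rw [tent_eq_zero hr0 (by linarith), tent_eq_zero hr0 (by linarith)]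
          simp
      refine (ellNorm_mono h1).trans ?_
      rw [ellNorm_const_mul,
        ellNorm_sub_left q (fun b : Idx N => if ‖b‖ < 3 * r then (1 : ℝ≥0∞) else 0)]
      refine (mul_le_mul_right (ellNorm_ball_le q hr0) _).trans ?_
      rw [← hC, ← hCof, ← ENNReal.ofReal_ofNat 2, ← ENNReal.ofReal_ofNat 7,
        ← ENNReal.ofReal_pow (by norm_num), ← ENNReal.ofReal_mul (by norm_num),
        ← ENNReal.ofReal_mul (by positivity), ← ENNReal.ofReal_mul (by positivity)]
      refine ENNReal.ofReal_le_ofReal ?_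
      rw [ENNReal.toReal_ofReal hc0.le]
      calc ‖i - j‖ / (2 * r) / C.toReal * (7 ^ N * (2 * C.toReal)) = 7 ^ N / r * ‖i - j‖ := by
            field_simp
        _ ≤ 2 * 7 ^ N / r * ‖i - j‖ := by gcongr; linarith
        _ ≤ lam * ‖i - j‖ := by gcongr
  · by_contra! hcon
    push_cast at hcon
    exact h (by dsimp only; rw [tent_eq_zero hr0 hcon.le, zero_div])

/-- A slowly varying family of bounded overlap that is subordinate to a tiling by cubes;
`t i` is the index of the cube containing `i`, and `z a` the corner of the cube with index `a`. -/
theorem exists_tile_family (q : ℝ≥0∞) [Fact (1 ≤ q)] {lam : ℝ≥0} (hlam : 0 < lam) :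
    ∃ (D : ℕ) (t z : Idx N → Idx N) (θ : Idx N → Idx N → ℝ), SlowFamily q (5 ^ N) lam θ ∧
      (∀ i, θ (t i) i = 1) ∧ (∀ i, ‖i - z (t i)‖ ≤ D) ∧ ∀ a i, θ a i ≠ 0 → ‖i - z a‖ ≤ D := by
  classical
  obtain ⟨L, hL⟩ := exists_nat_ge (2 * 5 ^ N / (lam : ℝ))
  have hlam' : (0 : ℝ) < lam := by exact_mod_cast hlam
  have hL' : (0 : ℝ) < L := lt_of_lt_of_le (by positivity) hL
  have hL0 : 0 < L := by exact_mod_cast hL'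
  have hlL : 2 * 5 ^ N / L ≤ (lam : ℝ) := by
    rw [div_le_iff₀ hlam'] at hL
    rw [div_le_iff₀ hL']
    linarith
  -- Equal to 1 within distance `L` of the corner `L a`, hence on the whole tile, and zero from
  -- distance `2 L` on; the slope is `1 / L`.
  let θ : Idx N → Idx N → ℝ := fun a i => max 0 (min 1 (2 - ‖i - (L : ℤ) • a‖ / L))
  -- The tiles whose function can be nonzero at `i`: their indices differ from `⌊i / L⌋` by at most
  -- 2 in each direction. This is the source of the overlap `5 ^ N`.
  let S : Idx N → Finset (Idx N) := fun i =>
    Fintype.piFinset fun k => Finset.Icc (i k / L - 2) (i k / L + 2)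
  have hS : ∀ i, (S i).card = 5 ^ N := fun i => by
    simp only [S, Fintype.card_piFinset, Int.card_Icc]
    rw [Finset.prod_congr rfl fun k _ => show ((i k / L + 2 + 1 - (i k / L - 2)).toNat) = 5 by
      rw [show i k / (L : ℤ) + 2 + 1 - (i k / L - 2) = 5 by ring]; rfl]
    simp
  have h0 : ∀ a i, 0 ≤ θ a i := fun a i => le_max_left _ _
  have h1 : ∀ a i, θ a i ≤ 1 := fun a i => max_le zero_le_one (min_le_left _ _)
  have hsupp : ∀ a i, 2 * L ≤ ‖i - (L : ℤ) • a‖ → θ a i = 0 := fun a i h => by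
    refine max_eq_left ((min_le_right _ _).trans ?_)
    rw [sub_nonpos, le_div_iff₀ hL']
    exact h
  have hmem : ∀ a i, a ∉ S i → θ a i = 0 := by
    intro a i ha
    refine hsupp a i ?_
    by_contra! hlt
    rw [norm_idx_lt_iff (by positivity)] at hlt
    refine ha ?_
    simp only [S, Fintype.mem_piFinset, Finset.mem_Icc]
    intro k
    have h2 := abs_lt.1 (hlt k)
    have hLz : (0 : ℤ) < L := by exact_mod_cast hL0
    have e1 : -(2 * (L : ℤ)) < i k - L * a k := by
      have := h2.1
      simp only [Pi.sub_apply, Pi.smul_apply, smul_eq_mul] at this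
      exact_mod_cast this
    have e2 : i k - L * a k < 2 * (L : ℤ) := by
      have := h2.2
      simp only [Pi.sub_apply, Pi.smul_apply, smul_eq_mul] at this
      exact_mod_cast this
    have e3 : i k / L < a k + 2 := Int.ediv_lt_of_lt_mul hLz (by linarith)
    have e4 : a k - 2 ≤ i k / L := (Int.le_ediv_iff_mul_le hLz).2 (by linarith)
    constructor <;> linarith
  refine ⟨2 * L, tileCorner L, fun a => (L : ℤ) • a, θ, ⟨h0, h1, fun i => ?_, fun i j => ?_⟩,
    fun i => ?_, fun i => ?_, fun a i h => ?_⟩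
  · refine (ellNorm_le_card_mul (S i) _ 1 (fun a ha => ?_) fun a => ?_).trans_eq ?_
    · rw [hmem a i ha, enorm_zero]
    · rw [← ofReal_norm, Real.norm_of_nonneg (h0 a i), ENNReal.ofReal_le_one]
      exact h1 a i
    · rw [hS, mul_one]
      push_cast
      rfl
  · have hlip : ∀ a, |θ a i - θ a j| ≤ ‖i - j‖ / L := fun a => by
      refine (abs_max_sub_max_le_max _ _ _ _).trans ?_
      rw [sub_self, abs_zero, max_eq_right (abs_nonneg _)]
      refine (abs_min_sub_min_le_max _ _ _ _).trans ?_
      rw [sub_self, abs_zero, max_eq_right (abs_nonneg _), sub_sub_sub_cancel_left, ← sub_div,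
        abs_div, abs_of_pos hL', abs_sub_comm]
      gcongr
      refine (abs_norm_sub_norm_le _ _).trans_eq ?_
      rw [sub_sub_sub_cancel_right]
    refine (ellNorm_le_card_mul (S i ∪ S j) _ (ENNReal.ofReal (‖i - j‖ / L)) (fun a ha => ?_)
      fun a => ?_).trans ?_
    · rw [Finset.mem_union, not_or] at ha
      rw [hmem a i ha.1, hmem a j ha.2, sub_self, enorm_zero]
    · rw [← ofReal_norm]
      exact ENNReal.ofReal_le_ofReal (hlip a)
    · have hcard : ((S i ∪ S j).card : ℝ) ≤ 2 * 5 ^ N := by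
        have := Finset.card_union_le (S i) (S j)
        rw [hS, hS, ← two_mul] at this
        exact_mod_cast this
      rw [← ENNReal.ofReal_natCast, ← ENNReal.ofReal_mul (by positivity), ← ofReal_norm,
        ← ENNReal.ofReal_coe_nnreal, ← ENNReal.ofReal_mul lam.coe_nonneg]
      refine ENNReal.ofReal_le_ofReal ?_
      calc ((S i ∪ S j).card : ℝ) * (‖i - j‖ / L) ≤ 2 * 5 ^ N * (‖i - j‖ / L) := by gcongr
        _ = 2 * 5 ^ N / L * ‖i - j‖ := by ring
        _ ≤ lam * ‖i - j‖ := by gcongr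
  · have h2 := norm_sub_tileCorner_le hL0 i
    have h3 : ‖i - (L : ℤ) • tileCorner L i‖ / L ≤ 1 := (div_le_one hL').2 h2
    simp only [θ]
    rw [min_eq_left (by linarith)]
    exact max_eq_right zero_le_one
  · have := norm_sub_tileCorner_le hL0 i
    push_cast
    linarith
  · by_contra! hcon
    push_cast at hcon
    exact h (hsupp a i hcon.le)

/-- Exchanging the two norms reduces the claim to the normalization at each entry. A normalized
family thus decomposes `x` isometrically, so localization loses only the commutator error. -/
theorem ellNorm_scalarMul_eq {θ : Idx N → Idx N → ℝ} (hθ : ∀ a i, |θ a i| ≤ 1)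
    (h : ∀ i, ellNorm p.normExp (fun a => ‖θ a i‖ₑ) = 1) (x : SeqSpace N X p) :
    ellNorm p.normExp (fun a => ‖scalarMul p (θ a) x‖ₑ) = ‖x‖ₑ := by
  conv_lhs => enter [2, a]; rw [← ellNorm_enorm]
  rw [ellNorm_comm]
  conv_lhs =>
    enter [2, i, 2, a]
    rw [enorm_coord_scalarMul (hθ a), mul_comm]
  conv_lhs =>
    enter [2, i]
    rw [ellNorm_const_mul, h, mul_one]
  exact ellNorm_enorm x

theorem enorm_le_mul_iff {E F : Type*} [NormedAddCommGroup E] [NormedAddCommGroup F] {x : E} {y : F}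
    {c : ℝ} (hc : 0 ≤ c) : ‖x‖ₑ ≤ ENNReal.ofReal c * ‖y‖ₑ ↔ ‖x‖ ≤ c * ‖y‖ := by
  rw [← ofReal_norm, ← ofReal_norm, ← ENNReal.ofReal_mul hc,
    ENNReal.ofReal_le_ofReal_iff (by positivity)]

theorem mul_enorm_le_iff {E F : Type*} [NormedAddCommGroup E] [NormedAddCommGroup F] {x : E} {y : F}
    {c : ℝ} (hc : 0 ≤ c) : ENNReal.ofReal c * ‖y‖ₑ ≤ ‖x‖ₑ ↔ c * ‖y‖ ≤ ‖x‖ := by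
  rw [← ofReal_norm, ← ofReal_norm, ← ENNReal.ofReal_mul hc,
    ENNReal.ofReal_le_ofReal_iff (by positivity)]

theorem coord_scalarMul_ne_zero {θ : Idx N → ℝ} (hθ : ∀ i, |θ i| ≤ 1) {x : SeqSpace N X p}
    {i : Idx N} (h : coord i (scalarMul p θ x) ≠ 0) : θ i ≠ 0 ∧ coord i x ≠ 0 := by
  rw [coord_scalarMul hθ] at h
  have := smul_ne_zero_iff.1 h
  exact ⟨by exact_mod_cast this.1, this.2⟩

/-- Localization of the lower norm. -/
theorem FamilyComm.exists_localized_le {T : SeqSpace N X p →L[ℂ] SeqSpace N X p}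
    (hT : FamilyComm T) {δ : ℝ} (hδ : 0 < δ) :
    ∃ D : ℕ, ∀ (ν : ℝ) (x : SeqSpace N X p), 0 ≤ ν → x ≠ 0 → ‖T x‖ ≤ ν * ‖x‖ →
      ∃ y : SeqSpace N X p, y ≠ 0 ∧ (∀ i, coord i y ≠ 0 → coord i x ≠ 0) ∧
        (∀ i j, coord i y ≠ 0 → coord j y ≠ 0 → ‖i - j‖ ≤ D) ∧ ‖T y‖ ≤ (ν + δ) * ‖y‖ := by
  lift δ to ℝ≥0 using hδ.le
  have hδ' : 0 < δ := by exact_mod_cast hδ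
  obtain ⟨lam, hlam, h⟩ := hT 1 (δ / 2) (half_pos hδ')
  obtain ⟨D, θ, hθ, hθ1, hθD⟩ := exists_localizing_family (N := N) p.normExp hlam
  refine ⟨2 * D, fun ν x hν hx hTx => ?_⟩
  -- If every nonzero piece `θ a x` violated the estimate, taking `ℓ^q` norms over `a` would give
  -- `(ν + δ) ‖x‖ ≤ ‖T x‖ + (δ / 2) ‖x‖ ≤ (ν + δ / 2) ‖x‖`. The diameter depends on `δ` only, not on
  -- `ν` or `x`.
  by_contra! hcon
  have key : ∀ a, ENNReal.ofReal (ν + δ) * ‖scalarMul p (θ a) x‖ₑ ≤ ‖T (scalarMul p (θ a) x)‖ₑ := by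
    intro a
    rw [mul_enorm_le_iff (by positivity)]
    by_cases h0 : scalarMul p (θ a) x = 0
    · rw [h0]; simp
    · refine (hcon _ h0 (fun i hi => (coord_scalarMul_ne_zero (hθ.abs_le a) hi).2)
        fun i j hi hj => ?_).le
      have h1 := hθD a i (coord_scalarMul_ne_zero (hθ.abs_le a) hi).1
      have h2 := hθD a j (coord_scalarMul_ne_zero (hθ.abs_le a) hj).1
      have h3 := norm_sub_le (i - a) (j - a)
      rw [sub_sub_sub_cancel_right] at h3
      push_cast
      linarith
  have h2 : ENNReal.ofReal (ν + δ) * ‖x‖ₑ ≤ ENNReal.ofReal (ν + δ / 2) * ‖x‖ₑ := by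
    calc ENNReal.ofReal (ν + δ) * ‖x‖ₑ
        = ellNorm p.normExp (fun a => ENNReal.ofReal (ν + δ) * ‖scalarMul p (θ a) x‖ₑ) := by
          rw [ellNorm_const_mul, ellNorm_scalarMul_eq hθ.abs_le hθ1]
      _ ≤ ellNorm p.normExp (fun a => ‖T (scalarMul p (θ a) x)‖ₑ) := ellNorm_mono key
      _ ≤ ellNorm p.normExp (fun a => ‖scalarMul p (θ a) (T x)‖ₑ) + ellNorm p.normExp
            (fun a => ‖scalarMul p (θ a) (T x) - T (scalarMul p (θ a) x)‖ₑ) := by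
          refine (ellNorm_mono fun a => ?_).trans (ellNorm_add_le _ _)
          have := enorm_sub_le (a := scalarMul p (θ a) (T x))
            (b := scalarMul p (θ a) (T x) - T (scalarMul p (θ a) x))
          rwa [sub_sub_cancel] at this
      _ ≤ ENNReal.ofReal ν * ‖x‖ₑ + ((δ / 2 : ℝ≥0) : ℝ≥0∞) * ‖x‖ₑ := by
          refine add_le_add ?_ (h _ θ hθ x)
          rw [ellNorm_scalarMul_eq hθ.abs_le hθ1, enorm_le_mul_iff hν]
          exact hTx
      _ = ENNReal.ofReal (ν + δ / 2) * ‖x‖ₑ := by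
          rw [ENNReal.ofReal_add hν (by positivity), add_mul, ← ENNReal.ofReal_coe_nnreal]
          push_cast
          rfl
  rw [ENNReal.mul_le_mul_iff_left (by simpa using hx) enorm_ne_top,
    ENNReal.ofReal_le_ofReal_iff (by positivity)] at h2
  linarith

/-- Localization of the norm. -/
theorem FamilyComm.exists_localized_ge {T : SeqSpace N X p →L[ℂ] SeqSpace N X p}
    (hT : FamilyComm T) {δ : ℝ} (hδ : 0 < δ) :
    ∃ D : ℕ, ∀ (η : ℝ) (x : SeqSpace N X p), 0 ≤ η → x ≠ 0 → (η + δ) * ‖x‖ ≤ ‖T x‖ →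
      ∃ y : SeqSpace N X p, y ≠ 0 ∧ (∀ i, coord i y ≠ 0 → coord i x ≠ 0) ∧
        (∀ i j, coord i y ≠ 0 → coord j y ≠ 0 → ‖i - j‖ ≤ D) ∧ η * ‖y‖ ≤ ‖T y‖ := by
  lift δ to ℝ≥0 using hδ.le
  have hδ' : 0 < δ := by exact_mod_cast hδ
  obtain ⟨lam, hlam, h⟩ := hT 1 (δ / 2) (half_pos hδ')
  obtain ⟨D, θ, hθ, hθ1, hθD⟩ := exists_localizing_family (N := N) p.normExp hlam
  refine ⟨2 * D, fun η x hη hx hTx => ?_⟩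
  by_contra! hcon
  have key : ∀ a, ‖T (scalarMul p (θ a) x)‖ₑ ≤ ENNReal.ofReal η * ‖scalarMul p (θ a) x‖ₑ := by
    intro a
    rw [enorm_le_mul_iff hη]
    by_cases h0 : scalarMul p (θ a) x = 0
    · rw [h0]; simp
    · refine (hcon _ h0 (fun i hi => (coord_scalarMul_ne_zero (hθ.abs_le a) hi).2)
        fun i j hi hj => ?_).le
      have h1 := hθD a i (coord_scalarMul_ne_zero (hθ.abs_le a) hi).1
      have h2 := hθD a j (coord_scalarMul_ne_zero (hθ.abs_le a) hj).1
      have h3 := norm_sub_le (i - a) (j - a)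
      rw [sub_sub_sub_cancel_right] at h3
      push_cast
      linarith
  have h2 : ENNReal.ofReal (η + δ) * ‖x‖ₑ ≤ ENNReal.ofReal (η + δ / 2) * ‖x‖ₑ := by
    calc ENNReal.ofReal (η + δ) * ‖x‖ₑ ≤ ‖T x‖ₑ := by rwa [mul_enorm_le_iff (by positivity)]
      _ = ellNorm p.normExp (fun a => ‖scalarMul p (θ a) (T x)‖ₑ) := by
          rw [ellNorm_scalarMul_eq hθ.abs_le hθ1]
      _ ≤ ellNorm p.normExp (fun a => ‖T (scalarMul p (θ a) x)‖ₑ) + ellNorm p.normExp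
            (fun a => ‖scalarMul p (θ a) (T x) - T (scalarMul p (θ a) x)‖ₑ) :=
          ellNorm_add_apply_le _ _ _ fun a => by abel
      _ ≤ ENNReal.ofReal η * ‖x‖ₑ + ((δ / 2 : ℝ≥0) : ℝ≥0∞) * ‖x‖ₑ := by
          refine add_le_add ((ellNorm_mono key).trans_eq ?_) (h _ θ hθ x)
          rw [ellNorm_const_mul, ellNorm_scalarMul_eq hθ.abs_le hθ1]
      _ = ENNReal.ofReal (η + δ / 2) * ‖x‖ₑ := by
          rw [ENNReal.ofReal_add hη (by positivity), add_mul, ← ENNReal.ofReal_coe_nnreal]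
          push_cast
          rfl
  rw [ENNReal.mul_le_mul_iff_left (by simpa using hx) enorm_ne_top,
    ENNReal.ofReal_le_ofReal_iff (by positivity)] at h2
  linarith

end Localization

/-! ### Limit operators -/

section LimitOperators

variable {N : ℕ} {X : Type*} [NormedAddCommGroup X] [NormedSpace ℂ X] {p : Exponent}

/-- The shifted operator `V_{-k} T V_k`. -/
def shiftConj (T : SeqSpace N X p →L[ℂ] SeqSpace N X p) (k : Idx N) :
    SeqSpace N X p →L[ℂ] SeqSpace N X p := shift p (-k) * T * shift p k

theorem norm_shiftConj (T : SeqSpace N X p →L[ℂ] SeqSpace N X p) (k : Idx N) :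
    ‖shiftConj T k‖ = ‖T‖ := norm_shift_conj k T

theorem shiftConj_mul (S T : SeqSpace N X p →L[ℂ] SeqSpace N X p) (k : Idx N) :
    shiftConj (S * T) k = shiftConj S k * shiftConj T k := shift_conj_mul k S T

theorem shiftConj_add (S T : SeqSpace N X p →L[ℂ] SeqSpace N X p) (k : Idx N) :
    shiftConj (S + T) k = shiftConj S k + shiftConj T k := by
  rw [shiftConj, mul_add, add_mul]; rfl

theorem shiftConj_one (k : Idx N) :
    shiftConj (1 : SeqSpace N X p →L[ℂ] SeqSpace N X p) k = 1 := by
  rw [shiftConj, mul_one, shift_neg_mul_shift]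

theorem isLimitOp_iff {A C : SeqSpace N X p →L[ℂ] SeqSpace N X p} {h : ℕ → Idx N} :
    IsLimitOp A h C ↔ ∀ K ∈ pCompact (proj N X p),
      Tendsto (fun n => K * shiftConj A (h n)) atTop (𝓝 (K * C)) ∧
      Tendsto (fun n => shiftConj A (h n) * K) atTop (𝓝 (C * K)) := by
  refine forall₂_congr fun K hK => ⟨fun H => ⟨?_, ?_⟩, fun H => ?_⟩
  · rw [tendsto_iff_norm_sub_tendsto_zero]
    refine squeeze_zero (fun n => norm_nonneg _) (fun n => ?_) H
    rw [← mul_sub]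
    exact le_add_of_nonneg_right (norm_nonneg _)
  · rw [tendsto_iff_norm_sub_tendsto_zero]
    refine squeeze_zero (fun n => norm_nonneg _) (fun n => ?_) H
    rw [← sub_mul]
    exact le_add_of_nonneg_left (norm_nonneg _)
  · have h1 := (tendsto_iff_norm_sub_tendsto_zero.1 H.1).add
      (tendsto_iff_norm_sub_tendsto_zero.1 H.2)
    rw [add_zero] at h1
    refine h1.congr fun n => ?_
    rw [mul_sub, sub_mul]
    rfl

theorem IsLimitOp.comp {A C : SeqSpace N X p →L[ℂ] SeqSpace N X p} {h : ℕ → Idx N}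
    (H : IsLimitOp A h C) {φ : ℕ → ℕ} (hφ : StrictMono φ) : IsLimitOp A (h ∘ φ) C :=
  fun K hK => (H K hK).comp hφ.tendsto_atTop

theorem TendsToInfinity.comp {h : ℕ → Idx N} (H : TendsToInfinity h) {φ : ℕ → ℕ}
    (hφ : StrictMono φ) : TendsToInfinity (h ∘ φ) :=
  Tendsto.comp (f := φ) (g := fun n => ‖h n‖) H hφ.tendsto_atTop

theorem tendsToInfinity_of_le {h : ℕ → Idx N} (H : ∀ n : ℕ, (n : ℝ) ≤ ‖h n‖) :
    TendsToInfinity h :=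
  tendsto_atTop_mono H tendsto_natCast_atTop_atTop

theorem IsLimitOp.norm_le {A C : SeqSpace N X p →L[ℂ] SeqSpace N X p} {h : ℕ → Idx N}
    (H : IsLimitOp A h C) : ‖C‖ ≤ ‖A‖ := by
  refine opNorm_le_of_norm_proj_mul_le fun k => ?_
  refine le_of_tendsto (isLimitOp_iff.1 H _ (proj_mem_pCompact k)).1.norm
    (Eventually.of_forall fun n => ?_)
  refine (norm_mul_le _ _).trans ?_
  rw [norm_shiftConj]
  exact mul_le_of_le_one_left (norm_nonneg _) (norm_proj_le k)

theorem IsLimitOp.add {A A' C C' : SeqSpace N X p →L[ℂ] SeqSpace N X p} {h : ℕ → Idx N}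
    (H : IsLimitOp A h C) (H' : IsLimitOp A' h C') : IsLimitOp (A + A') h (C + C') := by
  rw [isLimitOp_iff] at *
  intro K hK
  simp only [shiftConj_add, mul_add, add_mul]
  exact ⟨(H K hK).1.add (H' K hK).1, (H K hK).2.add (H' K hK).2⟩

/-- A cube of radius `k` translated by more than `k + m` misses the cube of radius `m`. -/
theorem proj_mul_shiftConj_proj {k m : ℕ} {h : Idx N} (hh : (k + m : ℝ) < ‖h‖) :
    proj N X p k * shift p (-h) * proj N X p m = 0 ∧
      proj N X p m * (shift p h * proj N X p k) = 0 := by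
  constructor
  · refine ContinuousLinearMap.ext fun x => seq_ext fun i => ?_
    rw [mul_assoc]
    simp only [mul_apply_eq_comp, coord_proj, coord_shift, zero_apply, map_zero]
    split_ifs with h1 h2
    · have := norm_sub_le (i - -h) i
      rw [sub_neg_eq_add, add_sub_cancel_left] at this
      rw [sub_neg_eq_add] at h2
      linarith
    · rfl
    · rfl
  · refine ContinuousLinearMap.ext fun x => seq_ext fun i => ?_
    simp only [mul_apply_eq_comp, coord_proj, coord_shift, zero_apply, map_zero]
    split_ifs with h1 h2
    · have := norm_sub_le i (i - h)
      rw [sub_sub_cancel] at this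
      linarith
    · rfl
    · rfl

/-- The limit operators of `P`-compact operators vanish. -/
theorem isLimitOp_zero_of_mem_pCompact {K : SeqSpace N X p →L[ℂ] SeqSpace N X p}
    (hK : K ∈ pCompact (proj N X p)) {h : ℕ → Idx N} (hh : TendsToInfinity h) :
    IsLimitOp K h 0 := by
  rw [isLimitOp_iff]
  intro L hL
  have key : ∀ ε > 0, ∃ n0, ∀ n ≥ n0,
      ‖L * shiftConj K (h n)‖ < ε ∧ ‖shiftConj K (h n) * L‖ < ε := by
    intro ε hε
    have hδ : 0 < ε / (2 * (‖K‖ + ‖L‖ + 1)) := by positivity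
    obtain ⟨m, hm⟩ := eventually_of_mem_pCompact hK hδ
    obtain ⟨k, hk⟩ := eventually_of_mem_pCompact hL hδ
    obtain ⟨hm1, hm2⟩ := hm m le_rfl
    obtain ⟨hk1, hk2⟩ := hk k le_rfl
    obtain ⟨n0, hn0⟩ := (tendsto_atTop.1 hh (k + m + 1 : ℝ)).exists_forall_of_atTop
    have hε2 : ε / (2 * (‖K‖ + ‖L‖ + 1)) * ‖K‖ + ε / (2 * (‖K‖ + ‖L‖ + 1)) * ‖L‖ < ε := by
      rw [← mul_add, div_mul_eq_mul_div, div_lt_iff₀ (by positivity)]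
      nlinarith [norm_nonneg K, norm_nonneg L, mul_nonneg hε.le (norm_nonneg K),
        mul_nonneg hε.le (norm_nonneg L)]
    refine ⟨n0, fun n hn => ?_⟩
    obtain ⟨e1, e2⟩ := proj_mul_shiftConj_proj (X := X) (p := p) (k := k) (m := m)
      (show (k + m : ℝ) < ‖h n‖ by linarith [hn0 n hn])
    constructor
    -- Insert `1 = (1 - P_k) + P_k` after `L` and `1 = (1 - P_m) + P_m` before `K`. The only term
    -- without a small factor contains `P_k V_{-h} P_m = 0`.
    · have e : L * shiftConj K (h n) = L * (1 - proj N X p k) * shiftConj K (h n)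
          + L * proj N X p k * shift p (-h n) * ((1 - proj N X p m) * K) * shift p (h n) := by
        have : L * proj N X p k * shift p (-h n) * (proj N X p m * K) * shift p (h n) = 0 := by
          have e3 : L * proj N X p k * shift p (-h n) * (proj N X p m * K) * shift p (h n)
              = L * (proj N X p k * shift p (-h n) * proj N X p m) * K * shift p (h n) := by
            simp only [mul_assoc]
          rw [e3, e1, mul_zero, zero_mul, zero_mul]
        rw [sub_mul, one_mul, mul_sub (L * proj N X p k * shift p (-h n)), sub_mul _ _ (shift p (h n)),
          this, sub_zero, mul_sub, mul_one, sub_mul, shiftConj]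
        simp only [mul_assoc]
        abel
      rw [e]
      refine (norm_add_le _ _).trans_lt (lt_of_le_of_lt (add_le_add ?_ ?_) hε2)
      · refine (norm_mul_le _ _).trans ?_
        rw [norm_shiftConj]
        gcongr
      · rw [norm_mul_shift]
        refine (norm_mul_le _ _).trans ?_
        rw [norm_mul_shift, mul_comm]
        gcongr
        exact (norm_mul_le _ _).trans (mul_le_of_le_one_right (norm_nonneg _) (norm_proj_le k))
    · have e : shiftConj K (h n) * L = shiftConj K (h n) * ((1 - proj N X p k) * L)
          + shift p (-h n) * (K * (1 - proj N X p m)) * (shift p (h n) * (proj N X p k * L)) := by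
        have : shift p (-h n) * (K * proj N X p m) * (shift p (h n) * (proj N X p k * L)) = 0 := by
          have e3 : shift p (-h n) * (K * proj N X p m) * (shift p (h n) * (proj N X p k * L))
              = shift p (-h n) * K * (proj N X p m * (shift p (h n) * proj N X p k)) * L := by
            simp only [mul_assoc]
          rw [e3, e2, mul_zero, zero_mul]
        rw [mul_sub K, mul_one, mul_sub (shift p (-h n)), sub_mul (shift p (-h n) * K), this,
          sub_zero, sub_mul, one_mul, mul_sub, shiftConj]
        simp only [mul_assoc]
        abel
      rw [e]
      refine (norm_add_le _ _).trans_lt (lt_of_le_of_lt (add_le_add ?_ ?_) hε2)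
      · refine (norm_mul_le _ _).trans ?_
        rw [norm_shiftConj, mul_comm]
        gcongr
      · refine (norm_mul_le _ _).trans ?_
        rw [norm_shift_mul, norm_shift_mul]
        gcongr
        exact (norm_mul_le _ _).trans (mul_le_of_le_one_left (norm_nonneg _) (norm_proj_le k))
  rw [mul_zero, zero_mul]
  constructor <;>
  · rw [Metric.tendsto_atTop]
    intro ε hε
    obtain ⟨n0, h0⟩ := key ε hε
    refine ⟨n0, fun n hn => ?_⟩
    rw [dist_zero_right]
    first | exact (h0 n hn).1 | exact (h0 n hn).2

/-- The commutator bound is uniform over all shifts of `A`, and it survives the limit because the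
cutoff is itself `P`-compact. -/
theorem IsLimitOp.slowComm {A C : SeqSpace N X p →L[ℂ] SeqSpace N X p} (hA : FamilyComm A)
    {h : ℕ → Idx N} (H : IsLimitOp A h C) : SlowComm C := by
  intro ε hε
  obtain ⟨lam, hlam, hl⟩ := hA.shift_conj hε
  refine ⟨lam, hlam, fun φ hφ => ?_⟩
  have h1 := isLimitOp_iff.1 H _ (hφ.mem_pCompact (X := X) (p := p))
  exact le_of_tendsto (h1.1.sub h1.2).norm (Eventually.of_forall fun n => hl φ hφ (h n))

/-- Localize repeatedly with tolerances `2^{-m}, 2^{-(m-1)}, …, 1`. The supports are nested, so any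
point `h` of the last one is a common centre. The vector of level `k` has accumulated the error
`2^{-m} + … + 2^{-k} = 2 · 2^{-k} - 2^{-m}`, and its radius `D k` does not depend on `m`. -/
theorem FamilyComm.exists_nested {T : SeqSpace N X p →L[ℂ] SeqSpace N X p} (hT : FamilyComm T) :
    ∃ D : ℕ → ℕ, ∀ (m : ℕ) (ν : ℝ) (x : SeqSpace N X p), 0 ≤ ν → x ≠ 0 → ‖T x‖ ≤ ν * ‖x‖ →
      ∃ h, coord h x ≠ 0 ∧ ∀ k ≤ m, ∃ y : SeqSpace N X p, y ≠ 0 ∧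
        (∀ i, coord i y ≠ 0 → ‖i - h‖ ≤ D k) ∧
        ‖T y‖ ≤ (ν + 2 * (1 / 2) ^ k - (1 / 2) ^ m) * ‖y‖ := by
  choose D hD using fun k : ℕ => hT.exists_localized_le (show (0 : ℝ) < (1 / 2) ^ k by positivity)
  refine ⟨D, fun m => ?_⟩
  induction m with
  | zero =>
    intro ν x hν hx hTx
    obtain ⟨y, hy, hyx, hyD, hTy⟩ := hD 0 ν x hν hx hTx
    obtain ⟨h, hh⟩ := exists_coord_ne_zero hy
    refine ⟨h, hyx h hh, fun k hk => ⟨y, hy, fun i hi => ?_, ?_⟩⟩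
    · rw [Nat.le_zero.1 hk]; exact hyD i h hi hh
    · rw [Nat.le_zero.1 hk]
      refine hTy.trans_eq ?_
      norm_num
      left; ring
  | succ m ih =>
    intro ν x hν hx hTx
    obtain ⟨y, hy, hyx, hyD, hTy⟩ := hD (m + 1) ν x hν hx hTx
    obtain ⟨h, hh, H⟩ := ih (ν + (1 / 2) ^ (m + 1)) y (by positivity) hy hTy
    refine ⟨h, hyx h hh, fun k hk => ?_⟩
    rcases Nat.lt_or_eq_of_le hk with hk | rfl
    · obtain ⟨z, hz, hzD, hTz⟩ := H k (Nat.lt_succ_iff.1 hk)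
      refine ⟨z, hz, hzD, hTz.trans_eq ?_⟩
      rw [pow_succ]
      ring
    · refine ⟨y, hy, fun i hi => hyD i h hi hh, hTy.trans_eq ?_⟩
      ring

/-- If `A` has almost minimizers for `ν` arbitrarily far out, then the lower norm of some limit
operator of `A` is at most `ν`. -/
theorem exists_opSpec_lower {A : SeqSpace N X p →L[ℂ] SeqSpace N X p} (hA : FamilyComm A)
    (hrich : IsRich A) {ν : ℝ} (hν : 0 ≤ ν)
    (H : ∀ m : ℕ, ∀ ε > 0, ∃ x, x ≠ 0 ∧ proj N X p m x = 0 ∧ ‖A x‖ ≤ (ν + ε) * ‖x‖) :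
    ∃ C ∈ opSpec A, ∀ ε > 0, ∃ x, x ≠ 0 ∧ ‖C x‖ ≤ (ν + ε) * ‖x‖ := by
  obtain ⟨D, hD⟩ := hA.exists_nested
  -- `x m` lives outside the cube `m`, and so does the centre `h m`, which belongs to its support.
  -- The tolerance `2^{-m}` cancels the last term of the nested error.
  choose x hx0 hxP hxA using fun m : ℕ => H m ((1 / 2) ^ m) (by positivity)
  choose h hh y hy hyD hyA using
    fun m : ℕ => hD m (ν + (1 / 2) ^ m) (x m) (by positivity) (hx0 m) (hxA m)
  have hinf : TendsToInfinity h := tendsToInfinity_of_le fun n => by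
    by_contra! hlt
    refine hh n ?_
    rw [← coord_proj_of_le hlt.le, hxP, map_zero]
  obtain ⟨φ, hφ, C, hC⟩ := hrich h hinf
  refine ⟨C, ⟨h ∘ φ, hinf.comp hφ, hC⟩, fun ε hε => ?_⟩
  -- The level `k` is fixed by `ε`, so the window `D k` stays fixed along the sequence and
  -- convergence after multiplication by `P_{D k}` suffices. The total error is `3 · 2^{-k}`: two
  -- parts from the almost minimizer, one from replacing the shift of `A` by `C`.
  obtain ⟨k, hk⟩ := exists_pow_lt_of_lt_one (show 0 < ε / 3 by positivity)
    (show (1 / 2 : ℝ) < 1 by norm_num)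
  have h1 := (isLimitOp_iff.1 hC _ (proj_mem_pCompact (D k))).2
  obtain ⟨n0, hn0⟩ := Metric.tendsto_atTop.1 h1 ((1 / 2) ^ k) (by positivity)
  have h2 := hn0 (max n0 k) (le_max_left _ _)
  have hkn : k ≤ φ (max n0 k) := (le_max_right n0 k).trans (hφ.id_le _)
  set n := max n0 k
  rw [dist_comm, dist_eq_norm, ← sub_mul] at h2
  have hu : proj N X p (D k) (shift p (-h (φ n)) (y (φ n) k hkn))
      = shift p (-h (φ n)) (y (φ n) k hkn) := seq_ext fun i => by
    rw [coord_proj, coord_shift, sub_neg_eq_add]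
    split_ifs with hi
    · rfl
    · by_contra hne
      have := hyD (φ n) k hkn _ (Ne.symm hne)
      rw [add_sub_cancel_right] at this
      exact hi this
  refine ⟨shift p (-h (φ n)) (y (φ n) k hkn), ?_, ?_⟩
  · intro h0
    rw [← norm_eq_zero, norm_shift_apply, norm_eq_zero] at h0
    exact hy _ _ _ h0
  · have e1 : C (shift p (-h (φ n)) (y (φ n) k hkn))
        = shift p (-h (φ n)) (A (y (φ n) k hkn)) +
          ((C - shiftConj A ((h ∘ φ) n)) * proj N X p (D k) :
            SeqSpace N X p →L[ℂ] SeqSpace N X p) (shift p (-h (φ n)) (y (φ n) k hkn)) := by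
      rw [mul_apply_eq_comp, hu, sub_apply, shiftConj]
      simp only [mul_apply_eq_comp, Function.comp_apply]
      rw [shift_shift_apply, add_neg_cancel, shift_zero_apply]
      abel
    rw [e1]
    refine (norm_add_le _ _).trans ?_
    have e2 := ((C - shiftConj A ((h ∘ φ) n)) * proj N X p (D k) :
      SeqSpace N X p →L[ℂ] SeqSpace N X p).le_opNorm (shift p (-h (φ n)) (y (φ n) k hkn))
    rw [norm_shift_apply] at e2 ⊢
    have e3 := hyA (φ n) k hkn
    have e5 : (ν + (1 / 2) ^ φ n + 2 * (1 / 2) ^ k - (1 / 2) ^ φ n) * ‖y (φ n) k hkn‖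
        = (ν + 2 * (1 / 2) ^ k) * ‖y (φ n) k hkn‖ := by ring
    rw [e5] at e3
    rw [norm_shift_apply]
    calc _ ≤ (ν + 2 * (1 / 2) ^ k) * ‖y (φ n) k hkn‖ + (1 / 2) ^ k * ‖y (φ n) k hkn‖ :=
          add_le_add e3 (e2.trans (by gcongr))
      _ = (ν + 3 * (1 / 2) ^ k) * ‖y (φ n) k hkn‖ := by ring
      _ ≤ (ν + ε) * ‖y (φ n) k hkn‖ := by gcongr; linarith

end LimitOperators

/-! ### Limit operators of `P`-Fredholm operators are invertible -/

section Invertibility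

variable {N : ℕ} {X : Type*} [NormedAddCommGroup X] [NormedSpace ℂ X] {p : Exponent}

theorem tendsto_mul_zero_of_bounded {R : Type*} [NormedRing R] {b z : ℕ → R} {M : ℝ}
    (hb : ∀ n, ‖b n‖ ≤ M) (hz : Tendsto z atTop (𝓝 0)) :
    Tendsto (fun n => b n * z n) atTop (𝓝 0) := by
  have h := (hz.norm).const_mul M
  rw [norm_zero, mul_zero] at h
  exact squeeze_zero_norm (fun n => (norm_mul_le _ _).trans (by gcongr; exact hb n)) h

theorem tendsto_zero_mul_of_bounded {R : Type*} [NormedRing R] {b z : ℕ → R} {M : ℝ}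
    (hb : ∀ n, ‖b n‖ ≤ M) (hz : Tendsto z atTop (𝓝 0)) :
    Tendsto (fun n => z n * b n) atTop (𝓝 0) := by
  have h := (hz.norm).mul_const M
  rw [norm_zero, zero_mul] at h
  exact squeeze_zero_norm (fun n => (norm_mul_le _ _).trans (by gcongr; exact hb n)) h

theorem tendsto_op_apply {T : ℕ → SeqSpace N X p →L[ℂ] SeqSpace N X p}
    {S : SeqSpace N X p →L[ℂ] SeqSpace N X p} (h : Tendsto T atTop (𝓝 S)) (x : SeqSpace N X p) :
    Tendsto (fun n => T n x) atTop (𝓝 (S x)) :=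
  ((ContinuousLinearMap.apply ℂ (SeqSpace N X p) x).continuous.tendsto S).comp h

/-- Bounded `P`-Cauchy sequences converge, if `p ≥ 1`. -/
theorem exists_proj_tendsto [CompleteSpace X] {q : ℝ≥0∞} (hq : 1 ≤ q)
    (u : ℕ → SeqSpace N X (.ofGE q hq)) {M : ℝ} (hM : ∀ n, ‖u n‖ ≤ M)
    (hu : ∀ j, CauchySeq fun n => proj N X (.ofGE q hq) j (u n)) :
    ∃ x, ∀ j, Tendsto (fun n => proj N X (.ofGE q hq) j (u n)) atTop
      (𝓝 (proj N X (.ofGE q hq) j x)) := by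
  choose w hw using fun j => cauchySeq_tendsto_of_complete (hu j)
  have hcoord : ∀ i : Idx N, Continuous (coord i : SeqSpace N X (.ofGE q hq) →ₗ[ℂ] X) := fun i =>
    ((coord i : SeqSpace N X (.ofGE q hq) →ₗ[ℂ] X).mkContinuous 1 fun x => by
      rw [one_mul]; exact norm_coord_le x i).continuous
  have hlim : ∀ i, ∃ v : X, Tendsto (fun n => coord i (u n)) atTop (𝓝 v) ∧
      ∀ j : ℕ, ‖i‖ ≤ j → coord i (w j) = v := by
    intro i
    obtain ⟨j0, hj0⟩ := exists_nat_ge ‖i‖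
    have h1 : ∀ j : ℕ, ‖i‖ ≤ j → Tendsto (fun n => coord i (u n)) atTop (𝓝 (coord i (w j))) := by
      intro j hj
      refine (((hcoord i).tendsto (w j)).comp (hw j)).congr fun n => ?_
      simp only [Function.comp_apply]
      rw [coord_proj_of_le hj]
    exact ⟨_, h1 j0 hj0, fun j hj => tendsto_nhds_unique (h1 j hj) (h1 j0 hj0)⟩
  choose v hv hvw using hlim
  -- An entrywise limit of a bounded sequence stays in `l^q` by a Fatou argument. In `l^0` it need
  -- not stay in the space, hence the restriction to `p ≥ 1`.
  have hmem : Memℓp v q := by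
    have : Fact (1 ≤ q) := ⟨hq⟩
    refine lp.memℓp_of_tendsto (F := fun n => (u n).val) (l := atTop) ?_ (tendsto_pi_nhds.2 hv)
    rw [Metric.isBounded_iff_subset_closedBall 0]
    refine ⟨M, ?_⟩
    rintro _ ⟨n, rfl⟩
    rw [mem_closedBall_zero_iff]
    exact hM n
  obtain ⟨x, hx⟩ : ∃ x : SeqSpace N X (.ofGE q hq), ∀ i, coord i x = v i :=
    ⟨(⟨⟨v, hmem⟩, trivial⟩ : seqSubmodule N X (.ofGE q hq)), fun _ => rfl⟩
  refine ⟨x, fun j => ?_⟩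
  convert hw j using 2
  refine seq_ext fun i => ?_
  by_cases hi : ‖i‖ ≤ j
  · rw [coord_proj_of_le hi, hvw i j hi, hx]
  · rw [not_le] at hi
    rw [coord_proj_of_lt hi]
    refine (tendsto_nhds_unique (((hcoord i).tendsto (w j)).comp (hw j)) ?_).symm
    refine tendsto_const_nhds.congr fun n => ?_
    simp only [Function.comp_apply]
    rw [coord_proj_of_lt hi]

/-- In `l^0` the projections converge strongly to the identity. -/
theorem tendsto_proj_zero (x : SeqSpace N X Exponent.zero) :
    Tendsto (fun n => proj N X Exponent.zero n x) atTop (𝓝 x) := by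
  rw [Metric.tendsto_atTop]
  intro ε hε
  obtain ⟨y, hy, hxy⟩ := Metric.dense_iff.1 (dense_finite_support (N := N) (X := X)) x (ε / 2)
    (half_pos hε)
  obtain ⟨k, hk⟩ := exists_nat_ge (∑ i ∈ hxy.toFinset, ‖i‖)
  refine ⟨k, fun n hn => ?_⟩
  have hyn : proj N X Exponent.zero n y = y := seq_ext fun i => by
    by_cases hi : coord i y = 0
    · rw [coord_proj, hi, ite_self]
    · refine coord_proj_of_le ?_ y
      have h1 := Finset.single_le_sum (fun i _ => norm_nonneg i)
        (show i ∈ hxy.toFinset by simpa using hi)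
      have h2 : (k : ℝ) ≤ n := by exact_mod_cast hn
      linarith
  rw [Metric.mem_ball, dist_eq_norm] at hy
  rw [dist_eq_norm]
  have e : proj N X Exponent.zero n x - x = (y - x) - proj N X Exponent.zero n (y - x) := by
    rw [map_sub, hyn]; abel
  rw [e]
  exact (norm_sub_proj_apply_le n _).trans_lt (by linarith)

/-- An operator that almost commutes with cutoffs, is bounded below, and has all finitely
supported sequences in its range is surjective. -/
theorem SlowComm.surjective [CompleteSpace X] {T : SeqSpace N X p →L[ℂ] SeqSpace N X p}
    (hT : SlowComm T) {c : ℝ} (hc : 0 < c) (hlow : ∀ x, c * ‖x‖ ≤ ‖T x‖)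
    (hran : ∀ m y, ∃ x, T x = proj N X p m y) : Function.Surjective T := by
  intro y
  choose u hu using fun m => hran m y
  have hub : ∀ m, ‖u m‖ ≤ ‖y‖ / c := fun m => by
    rw [le_div_iff₀ hc, mul_comm]
    exact (hlow _).trans (by rw [hu]; exact norm_proj_apply_le m y)
  have hpos : 0 ≤ ‖y‖ / c := by positivity
  cases p with
  | zero =>
    -- In `l^0` the data `P_m y` converge in norm, and the lower bound transfers the Cauchy property
    -- to the preimages.
    have hcau : CauchySeq u := by
      rw [Metric.cauchySeq_iff]
      intro ε hε
      obtain ⟨n0, h0⟩ := Metric.cauchySeq_iff.1 (tendsto_proj_zero y).cauchySeq (c * ε)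
        (by positivity)
      refine ⟨n0, fun m hm n hn => ?_⟩
      have h1 := h0 m hm n hn
      rw [dist_eq_norm, ← hu, ← hu, ← map_sub] at h1
      rw [dist_eq_norm]
      exact lt_of_mul_lt_mul_left ((hlow _).trans_lt h1) hc.le
    obtain ⟨x, hx⟩ := cauchySeq_tendsto_of_complete hcau
    refine ⟨x, tendsto_nhds_unique ((T.continuous.tendsto x).comp hx) ?_⟩
    refine (tendsto_proj_zero y).congr fun n => (hu n).symm
  | ofGE q hq =>
    obtain ⟨x, hx⟩ := exists_proj_tendsto hq u hub fun j => by
      rw [Metric.cauchySeq_iff]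
      intro ε hε
      have hδ : 0 < c * ε / (2 * (2 * (‖y‖ / c) + 1)) := by positivity
      obtain ⟨lam, hlam, hl⟩ := hT _ hδ
      obtain ⟨φ, hφ, hφ1⟩ := exists_isCutoff (N := N) hlam j
      obtain ⟨k, -, hk⟩ := hφ.exists_proj_mul (X := X) (p := .ofGE q hq)
      refine ⟨k, fun m hm n hn => ?_⟩
      -- Once `P_m` covers the support of `φ`, `φ T u_m` no longer depends on `m`. Thus `T (φ (u_m -
      -- u_n))` is a pure commutator term, and the lower bound makes `u` a Cauchy sequence on each
      -- cube.
      have e0 : ∀ m ≥ k, scalarMul (.ofGE q hq) φ (T (u m)) = scalarMul (.ofGE q hq) φ y := by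
        intro m hm
        rw [hu, ← hk, mul_apply_eq_comp, mul_apply_eq_comp, proj_proj_apply' hm]
      have e1 : T (scalarMul (.ofGE q hq) φ (u m - u n))
          = -(scalarMul (.ofGE q hq) φ * T - T * scalarMul (.ofGE q hq) φ :
            SeqSpace N X (.ofGE q hq) →L[ℂ] SeqSpace N X (.ofGE q hq)) (u m - u n) := by
        rw [sub_apply, mul_apply_eq_comp, mul_apply_eq_comp, map_sub T (u m), map_sub _ (T (u m)),
          e0 m hm, e0 n hn, sub_self, zero_sub, neg_neg]
      have e2 : proj N X (.ofGE q hq) j (scalarMul (.ofGE q hq) φ (u m - u n))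
          = proj N X (.ofGE q hq) j (u m - u n) :=
        DFunLike.congr_fun (proj_mul_scalarMul hφ.abs_le hφ1) (u m - u n)
      rw [dist_eq_norm, ← map_sub, ← e2]
      refine lt_of_mul_lt_mul_left ?_ hc.le
      calc c * ‖proj N X (.ofGE q hq) j (scalarMul (.ofGE q hq) φ (u m - u n))‖
          ≤ c * ‖scalarMul (.ofGE q hq) φ (u m - u n)‖ := by
            gcongr; exact norm_proj_apply_le _ _
        _ ≤ ‖T (scalarMul (.ofGE q hq) φ (u m - u n))‖ := hlow _
        _ ≤ c * ε / (2 * (2 * (‖y‖ / c) + 1)) * ‖u m - u n‖ := by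
            rw [e1, norm_neg]
            exact (ContinuousLinearMap.le_opNorm _ _).trans (by gcongr; exact hl φ hφ)
        _ ≤ c * ε / (2 * (2 * (‖y‖ / c) + 1)) * (2 * (‖y‖ / c) + 1) := by
            gcongr
            linarith [norm_sub_le (u m) (u n), hub m, hub n]
        _ = c * ε / 2 := by field_simp
        _ < c * ε := by
            have := mul_pos hc hε
            linarith
    refine ⟨x, ?_⟩
    -- `P_k T` is `P`-compact, so up to a small error it only sees a finite cube, and it maps the
    -- bounded sequence `u`, which converges on every cube, to a convergent one.
    have hTx : ∀ k, proj N X (.ofGE q hq) k (T x) = proj N X (.ofGE q hq) k y := by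
      intro k
      have hK := mul_mem_pCompact_right hT.mem_pAlg (proj_mem_pCompact k)
      have h1 : Tendsto (fun n => (proj N X (.ofGE q hq) k * T) (u n)) atTop
          (𝓝 ((proj N X (.ofGE q hq) k * T) x)) := by
        generalize proj N X (.ofGE q hq) k * T = K at hK ⊢
        rw [Metric.tendsto_atTop]
        intro ε hε
        obtain ⟨j, hj⟩ := eventually_of_mem_pCompact hK
          (show 0 < ε / (2 * (‖y‖ / c + ‖x‖ + 1)) by positivity)
        have hj := (hj j le_rfl).2
        obtain ⟨n0, hn0⟩ := Metric.tendsto_atTop.1 (hx j) (ε / (2 * (‖K‖ + 1))) (by positivity)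
        refine ⟨n0, fun n hn => ?_⟩
        have h3 := hn0 n hn
        rw [dist_eq_norm, ← map_sub] at h3 ⊢
        have e : K (u n - x) = (K * (1 - proj N X (.ofGE q hq) j)) (u n - x)
            + K (proj N X (.ofGE q hq) j (u n - x)) := by
          rw [mul_apply_eq_comp, ← map_add]
          congr 1
          simp
        rw [e]
        have b1 : ‖(K * (1 - proj N X (.ofGE q hq) j)) (u n - x)‖ ≤ ε / 2 * ((‖y‖ / c + ‖x‖) /
            (‖y‖ / c + ‖x‖ + 1)) := by
          refine (ContinuousLinearMap.le_opNorm _ _).trans ?_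
          calc _ ≤ ε / (2 * (‖y‖ / c + ‖x‖ + 1)) * (‖y‖ / c + ‖x‖) := by
                gcongr
                exact (norm_sub_le _ _).trans (by gcongr; exact hub n)
            _ = _ := by field_simp
        have b3 : (‖y‖ / c + ‖x‖) / (‖y‖ / c + ‖x‖ + 1) ≤ 1 := by
          rw [div_le_one (by positivity)]; linarith
        have b2 : ‖K (proj N X (.ofGE q hq) j (u n - x))‖ < ε / 2 := by
          refine (K.le_opNorm _).trans_lt ?_
          calc ‖K‖ * ‖proj N X (.ofGE q hq) j (u n - x)‖
              ≤ (‖K‖ + 1) * ‖proj N X (.ofGE q hq) j (u n - x)‖ := by gcongr; linarith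
            _ < (‖K‖ + 1) * (ε / (2 * (‖K‖ + 1))) := by gcongr
            _ = ε / 2 := by field_simp
        have b4 : ε / 2 * ((‖y‖ / c + ‖x‖) / (‖y‖ / c + ‖x‖ + 1)) ≤ ε / 2 :=
          mul_le_of_le_one_right (by positivity) b3
        linarith [norm_add_le ((K * (1 - proj N X (.ofGE q hq) j)) (u n - x))
          (K (proj N X (.ofGE q hq) j (u n - x)))]
      refine tendsto_nhds_unique h1 ?_
      refine tendsto_const_nhds.congr' ?_
      filter_upwards [eventually_ge_atTop k] with n hn
      rw [mul_apply_eq_comp, hu, proj_proj_apply' hn]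
    refine sub_eq_zero.1 (norm_le_zero_iff.1 (norm_le_of_norm_proj_le fun k => ?_))
    rw [map_sub, hTx, sub_self, norm_zero]

theorem exists_inverse_of_bijective [CompleteSpace X]
    {T : SeqSpace N X p →L[ℂ] SeqSpace N X p} {c : ℝ} (hc : 0 < c)
    (hlow : ∀ x, c * ‖x‖ ≤ ‖T x‖) (hsurj : Function.Surjective T) :
    ∃ S, S * T = 1 ∧ T * S = 1 := by
  have hinj : Function.Injective T := (injective_iff_map_eq_zero T).2 fun x hx => by
    have h := hlow x
    rw [hx, norm_zero] at h
    exact norm_le_zero_iff.1 (by nlinarith [norm_nonneg x])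
  let e := ContinuousLinearEquiv.ofBijective T (LinearMap.ker_eq_bot.2 hinj)
    (LinearMap.range_eq_top.2 hsurj)
  refine ⟨e.symm, ContinuousLinearMap.ext fun x => ?_, ContinuousLinearMap.ext fun x => ?_⟩
  · exact e.symm_apply_apply x
  · exact e.apply_symm_apply x

/-- If `B` inverts `A` modulo `P`-compact operators, then the limit operators of `A` are
invertible, and their inverses are the limit operators of `B`. -/
theorem IsLimitOp.exists_inverse [CompleteSpace X] {A B C : SeqSpace N X p →L[ℂ] SeqSpace N X p}
    (hA : FamilyComm A) (hAB : A * B - 1 ∈ pCompact (proj N X p))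
    (hBA : B * A - 1 ∈ pCompact (proj N X p)) {h : ℕ → Idx N} (hh : TendsToInfinity h)
    (hC : IsLimitOp A h C) : ∃ S, S * C = 1 ∧ C * S = 1 ∧ IsLimitOp B h S := by
  have hSC : SlowComm C := hC.slowComm hA
  have hC' := isLimitOp_iff.1 hC
  have hbd : ∀ n, ‖shiftConj B (h n)‖ ≤ ‖B‖ := fun n => (norm_shiftConj _ _).le
  -- `A B` and `B A` are `P`-compact perturbations of the identity, so their limit operators exist
  -- along `h` and equal 1.
  have hid : ∀ T : SeqSpace N X p →L[ℂ] SeqSpace N X p, T - 1 ∈ pCompact (proj N X p) →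
      IsLimitOp T h 1 := fun T hT => by
    have h1 : IsLimitOp (1 : SeqSpace N X p →L[ℂ] SeqSpace N X p) h 1 := by
      rw [isLimitOp_iff]
      intro K _
      simp only [shiftConj_one]
      exact ⟨tendsto_const_nhds, tendsto_const_nhds⟩
    simpa using (isLimitOp_zero_of_mem_pCompact hT hh).add h1
  have hAB' := isLimitOp_iff.1 (hid _ hAB)
  have hBA' := isLimitOp_iff.1 (hid _ hBA)
  simp only [shiftConj_mul, one_mul, mul_one] at hAB' hBA'
  -- In the limit, `‖P_k x‖ ≤ ‖B‖ ‖C P_k x‖`, and `SlowComm.lower_bound` removes the projection. The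
  -- constant `‖B‖ + 1` avoids division by zero.
  have hlow : ∀ x, (‖B‖ + 1)⁻¹ * ‖x‖ ≤ ‖C x‖ := by
    refine hSC.lower_bound (by positivity) fun k x => ?_
    rw [inv_mul_le_iff₀ (by positivity)]
    have h1 := (tendsto_op_apply (hBA' _ (proj_mem_pCompact k)).2 x).norm
    have h2 := (tendsto_op_apply (hC' _ (proj_mem_pCompact k)).2 x).norm.const_mul ‖B‖
    refine (le_of_tendsto_of_tendsto' h1 h2 fun n => ?_).trans ?_
    · rw [mul_assoc, mul_apply_eq_comp (shiftConj B (h n))]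
      exact (ContinuousLinearMap.le_opNorm _ _).trans (by gcongr; exact hbd n)
    · rw [mul_apply_eq_comp]
      gcongr
      linarith
  have hc : 0 < (‖B‖ + 1)⁻¹ := by positivity
  -- The shifts of `B` are not yet known to converge. Far along the sequence, `φ V_{-h} B V_h P_m`
  -- is an approximate right inverse on the cube: `C` is moved past `φ`, then `φ C` is replaced by
  -- `φ` times the shift of `A`.
  have happrox : ∀ m, ∀ ε > 0, ∃ L, ‖C * L - proj N X p m‖ ≤ ε := by
    intro m ε hε
    obtain ⟨lam, hlam, hl⟩ := hSC (ε / (2 * (‖B‖ + 1))) (by positivity)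
    obtain ⟨φ, hφ, hφ1⟩ := exists_isCutoff (N := N) hlam m
    have hφm := hφ.mem_pCompact (X := X) (p := p)
    have hz : Tendsto (fun n => (scalarMul p φ * C - scalarMul p φ * shiftConj A (h n)) *
        (shiftConj B (h n) * proj N X p m)) atTop (𝓝 0) := by
      refine tendsto_zero_mul_of_bounded (M := ‖B‖) (fun n => ?_) ?_
      · exact (norm_mul_le _ _).trans ((mul_le_of_le_one_right (norm_nonneg _)
          (norm_proj_le m)).trans (hbd n))
      · have := (tendsto_const_nhds (x := scalarMul p φ * C)).sub (hC' _ hφm).1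
        rwa [sub_self] at this
    have h1 := ((hAB' _ (proj_mem_pCompact m)).2).const_mul (scalarMul p φ)
    have h2 := hz.add h1
    rw [scalarMul_mul_proj hφ.abs_le hφ1, zero_add] at h2
    obtain ⟨n, hn⟩ := Metric.tendsto_atTop.1 h2 (ε / 2) (by positivity)
    have hn := (hn n le_rfl).le
    rw [dist_eq_norm] at hn
    refine ⟨scalarMul p φ * (shiftConj B (h n) * proj N X p m), ?_⟩
    have e : C * (scalarMul p φ * (shiftConj B (h n) * proj N X p m)) - proj N X p m
        = -((scalarMul p φ * C - C * scalarMul p φ) * (shiftConj B (h n) * proj N X p m))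
          + ((scalarMul p φ * C - scalarMul p φ * shiftConj A (h n)) *
            (shiftConj B (h n) * proj N X p m)
          + scalarMul p φ * (shiftConj A (h n) * shiftConj B (h n) * proj N X p m)
            - proj N X p m) := by
      noncomm_ring
    rw [e]
    refine (norm_add_le _ _).trans ?_
    have b1 : ‖-((scalarMul p φ * C - C * scalarMul p φ) * (shiftConj B (h n) * proj N X p m))‖
        ≤ ε / 2 := by
      rw [norm_neg]
      calc _ ≤ ‖scalarMul p φ * C - C * scalarMul p φ‖ * ‖shiftConj B (h n) * proj N X p m‖ :=
            norm_mul_le _ _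
        _ ≤ ε / (2 * (‖B‖ + 1)) * (‖B‖ + 1) := by
            gcongr
            · exact hl φ hφ
            · exact (norm_mul_le _ _).trans ((mul_le_of_le_one_right (norm_nonneg _)
                (norm_proj_le m)).trans ((hbd n).trans (by linarith)))
        _ = ε / 2 := by field_simp
    linarith
  have hclosed : IsClosed (Set.range C) := by
    refine AntilipschitzWith.isClosed_range (K := ⟨‖B‖ + 1, by positivity⟩)
      (C.antilipschitz_of_bound fun x => ?_) C.uniformContinuous
    have := hlow x
    rwa [inv_mul_le_iff₀ (by positivity)] at this
  have hran : ∀ m y, ∃ x, C x = proj N X p m y := by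
    intro m y
    have : proj N X p m y ∈ closure (Set.range C) := by
      rw [Metric.mem_closure_iff]
      intro ε hε
      obtain ⟨L, hL⟩ := happrox m (ε / (2 * (‖y‖ + 1))) (by positivity)
      refine ⟨C (L y), ⟨L y, rfl⟩, ?_⟩
      rw [dist_comm, dist_eq_norm]
      calc ‖C (L y) - proj N X p m y‖ = ‖(C * L - proj N X p m) y‖ := rfl
        _ ≤ ε / (2 * (‖y‖ + 1)) * (‖y‖ + 1) :=
          (ContinuousLinearMap.le_opNorm _ _).trans (by gcongr; linarith)
        _ = ε / 2 := by field_simp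
        _ < ε := by linarith
    rwa [hclosed.closure_eq] at this
  obtain ⟨S, hSC1, hCS1⟩ := exists_inverse_of_bijective hc hlow (hSC.surjective hc hlow hran)
  refine ⟨S, hSC1, hCS1, isLimitOp_iff.2 fun K hK => ⟨?_, ?_⟩⟩
  · have hKS := mul_mem_pCompact_right (hSC.inverse hSC1 hCS1).mem_pAlg hK
    -- Write `K B_n = K S (C - A_n) B_n + K S (A_n B_n)` for the shifted operators. As `K S` is
    -- `P`-compact, the first term tends to 0 and the second to `K S`.
    have h1 : Tendsto (fun n => (K * S * C - K * S * shiftConj A (h n)) * shiftConj B (h n)) atTop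
        (𝓝 0) := by
      refine tendsto_zero_mul_of_bounded hbd ?_
      have := (tendsto_const_nhds (x := K * S * C)).sub (hC' _ hKS).1
      rwa [sub_self] at this
    have h2 := h1.add (hAB' _ hKS).1
    rw [zero_add] at h2
    refine h2.congr fun n => ?_
    rw [sub_mul, mul_assoc K S C, hSC1, mul_one]
    simp only [mul_assoc]
    abel
  · have hKS := mul_mem_pCompact_left (hSC.inverse hSC1 hCS1).mem_pAlg hK
    have h1 : Tendsto (fun n => shiftConj B (h n) * (C * (S * K) - shiftConj A (h n) * (S * K)))
        atTop (𝓝 0) := by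
      refine tendsto_mul_zero_of_bounded hbd ?_
      have := (tendsto_const_nhds (x := C * (S * K))).sub (hC' _ hKS).2
      rwa [sub_self] at this
    have h2 := h1.add (hBA' _ hKS).2
    rw [zero_add] at h2
    refine h2.congr fun n => ?_
    rw [mul_sub, ← mul_assoc C S K, hCS1, one_mul]
    simp only [mul_assoc]
    abel

end Invertibility

/-! ### Regularizers and the quotient norm -/

section Regularizers

variable {N : ℕ} {X : Type*} [NormedAddCommGroup X] [NormedSpace ℂ X] {p : Exponent}

/-- The outer factors alone control the two tails, so the middle operator may be any bounded one,
for instance a regularizer not yet known to lie in `L(X, P)`. -/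
theorem mul_mul_mem_pCompact {K L : SeqSpace N X p →L[ℂ] SeqSpace N X p}
    (hK : K ∈ pCompact (proj N X p)) (hL : L ∈ pCompact (proj N X p))
    (T : SeqSpace N X p →L[ℂ] SeqSpace N X p) : K * T * L ∈ pCompact (proj N X p) := by
  rw [mem_pCompact] at hK hL ⊢
  have h := (hK.mul_const (‖T‖ * ‖L‖)).add (hL.const_mul (‖K‖ * ‖T‖))
  rw [zero_mul, mul_zero, add_zero] at h
  refine squeeze_zero (fun n => by positivity) (fun n => ?_) h
  have h1 : ‖(1 - proj N X p n) * (K * T * L)‖ ≤ ‖(1 - proj N X p n) * K‖ * (‖T‖ * ‖L‖) := by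
    rw [mul_assoc K, ← mul_assoc]
    exact (norm_mul_le _ _).trans (by gcongr; exact norm_mul_le _ _)
  have h2 : ‖K * T * L * (1 - proj N X p n)‖ ≤ ‖K‖ * ‖T‖ * ‖L * (1 - proj N X p n)‖ := by
    rw [mul_assoc (K * T)]
    exact (norm_mul_le _ _).trans (by gcongr; exact norm_mul_le _ _)
  have h3 : 0 ≤ ‖K * (1 - proj N X p n)‖ * (‖T‖ * ‖L‖) := by positivity
  have h4 : 0 ≤ ‖K‖ * ‖T‖ * ‖(1 - proj N X p n) * L‖ := by positivity
  rw [add_mul, mul_add]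
  linarith

theorem coset_eq_iff {P : ℕ → SeqSpace N X p →L[ℂ] SeqSpace N X p} {A B : pAlg P} :
    coset P A = coset P B ↔ A.1 - B.1 ∈ pCompact P := Ideal.Quotient.eq

theorem coset_mul_eq_one_iff {P : ℕ → SeqSpace N X p →L[ℂ] SeqSpace N X p} {A B : pAlg P} :
    coset P A * coset P B = 1 ↔ A.1 * B.1 - 1 ∈ pCompact P :=
  coset_eq_iff (A := A * B) (B := 1)

theorem IsPFredholm.exists_regularizer {P : ℕ → SeqSpace N X p →L[ℂ] SeqSpace N X p} {A : pAlg P}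
    (hA : IsPFredholm P A) : ∃ C : pAlg P, IsPRegularizer P A.1 C.1 := by
  obtain ⟨u, hu⟩ := hA
  obtain ⟨C, hC⟩ := Ideal.Quotient.mk_surjective (↑u⁻¹ : pAlg P ⧸ pIdeal P)
  have hC' : coset P C = (↑u⁻¹ : pAlg P ⧸ pIdeal P) := hC
  exact ⟨C, coset_mul_eq_one_iff.1 (by rw [hC', ← hu, Units.mul_inv]),
    coset_mul_eq_one_iff.1 (by rw [hC', ← hu, Units.inv_mul])⟩

/-- Regularizers of `P`-Fredholm operators belong to `L(X, P)`. -/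
theorem IsPRegularizer.mem_pAlg {A : pAlg (proj N X p)} (hA : IsPFredholm (proj N X p) A)
    {B : SeqSpace N X p →L[ℂ] SeqSpace N X p} (hB : IsPRegularizer (proj N X p) A.1 B) :
    B ∈ pAlg (proj N X p) := by
  obtain ⟨C, hAC, hCA⟩ := hA.exists_regularizer
  obtain ⟨hAB, hBA⟩ := hB
  intro K hK
  constructor
  -- `C` is a regularizer taken from `L(X, P)`. In each term either `B` occurs only inside `A B -
  -- 1`, or it is enclosed between two `P`-compact operators.
  · have e : B * K = C.1 * K + C.1 * ((A.1 * B - 1) * K) - (C.1 * A.1 - 1) * B * K := by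
      noncomm_ring
    rw [e]
    exact sub_mem (add_mem (C.2 K hK).1 (C.2 _ (mul_mem_pCompact hAB hK)).1)
      (mul_mul_mem_pCompact hCA hK B)
  · have e : K * B = K * C.1 + K * (B * A.1 - 1) * C.1 - K * B * (A.1 * C.1 - 1) := by
      noncomm_ring
    rw [e]
    exact sub_mem (add_mem (C.2 K hK).2 (C.2 _ (mul_mem_pCompact hK hBA)).2)
      (mul_mul_mem_pCompact hK hAC B)

theorem norm_coset_le {P : ℕ → SeqSpace N X p →L[ℂ] SeqSpace N X p} (B C : pAlg P)
    (h : C.1 - B.1 ∈ pCompact P) : ‖coset P B‖ ≤ ‖C.1‖ := by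
  rw [← coset_eq_iff.2 h]
  exact Submodule.Quotient.norm_mk_le (pIdeal P) C

theorem exists_norm_lt_coset_add {P : ℕ → SeqSpace N X p →L[ℂ] SeqSpace N X p} (B : pAlg P)
    {ε : ℝ} (hε : 0 < ε) :
    ∃ C : pAlg P, C.1 - B.1 ∈ pCompact P ∧ ‖C.1‖ < ‖coset P B‖ + ε := by
  obtain ⟨C, hC, hlt⟩ := Submodule.Quotient.norm_mk_lt (S := pIdeal P) (coset P B) hε
  exact ⟨C, coset_eq_iff.1 hC, hlt⟩

/-- Limit operators are bounded by the quotient norm. -/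
theorem norm_le_norm_coset {B : pAlg (proj N X p)} {S : SeqSpace N X p →L[ℂ] SeqSpace N X p}
    (hS : S ∈ opSpec B.1) : ‖S‖ ≤ ‖coset (proj N X p) B‖ := by
  obtain ⟨h, hh, hS⟩ := hS
  refine le_of_forall_pos_le_add fun ε hε => ?_
  obtain ⟨C, hC, hlt⟩ := exists_norm_lt_coset_add B hε
  have h1 := hS.add (isLimitOp_zero_of_mem_pCompact hC hh)
  rw [add_zero, add_sub_cancel] at h1
  exact h1.norm_le.trans hlt.le

/-- `B P_n` is `P`-compact, so `B (1 - P_n)` represents the same coset as `B`. -/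
theorem norm_coset_le_norm_mul_one_sub_proj (B : pAlg (proj N X p)) (n : ℕ) :
    ‖coset (proj N X p) B‖ ≤ ‖B.1 * (1 - proj N X p n)‖ := by
  have hK : B.1 * proj N X p n ∈ pCompact (proj N X p) := (B.2 _ (proj_mem_pCompact n)).1
  have h2 : B.1 * proj N X p n ∈ pAlg (proj N X p) :=
    fun L hL => ⟨mul_mem_pCompact hK hL, mul_mem_pCompact hL hK⟩
  have h1 := norm_coset_le B (B - ⟨_, h2⟩) (by
    change B.1 - B.1 * proj N X p n - B.1 ∈ _
    rw [sub_sub_cancel_left]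
    exact neg_mem hK)
  rwa [mul_sub, mul_one]

/-- If `A B - I` is `P`-compact and `β` is at most the quotient norm of `B`, then `A` has almost
minimizers for `β⁻¹` arbitrarily far out. -/
theorem exists_far_almost_minimizer {A B : SeqSpace N X p →L[ℂ] SeqSpace N X p}
    (hB : B ∈ pAlg (proj N X p)) (hAB : A * B - 1 ∈ pCompact (proj N X p)) {β : ℝ} (hβ : 0 < β)
    (hBβ : ∀ n, β ≤ ‖B * (1 - proj N X p n)‖) (m : ℕ) {ε : ℝ} (hε : 0 < ε) :
    ∃ x, x ≠ 0 ∧ proj N X p m x = 0 ∧ ‖A x‖ ≤ (β⁻¹ + ε) * ‖x‖ := by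
  -- With this `s`, the bound `δ s ≤ ε β` says exactly that `1 + δ (1 + ‖A‖) ≤ (β⁻¹ + ε) (β - 2 δ)`,
  -- the comparison made in the last estimate.
  set s : ℝ := 1 + ‖A‖ + 2 * (β⁻¹ + ε) with hs
  have hs0 : 0 < s := by positivity
  obtain ⟨δ, hδ, hδβ, hδs⟩ : ∃ δ > 0, 2 * δ < β ∧ δ * s ≤ ε * β := by
    refine ⟨min (β / 4) (ε * β / s), by positivity, ?_, ?_⟩
    · linarith [min_le_left (β / 4) (ε * β / s)]
    · rw [← le_div_iff₀ hs0]; exact min_le_right _ _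
  have hPB : proj N X p m * B ∈ pCompact (proj N X p) := (hB _ (proj_mem_pCompact m)).2
  obtain ⟨n1, hn1⟩ := eventually_of_mem_pCompact hPB hδ
  obtain ⟨n2, hn2⟩ := eventually_of_mem_pCompact hAB hδ
  set n := max n1 n2
  have h1 := (hn1 n (le_max_left _ _)).2
  have h2 := (hn2 n (le_max_right _ _)).2
  -- The far part `w` of an almost maximizer satisfies `‖B w‖ ≥ (β - δ) ‖w‖` and `A B w ≈ w`.
  -- Removing the small near part `P_m B w` turns `B w` into the required vector.
  obtain ⟨u, hu⟩ : ∃ u, (β - δ) * ‖u‖ < ‖(B * (1 - proj N X p n)) u‖ := by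
    by_contra! hcon
    have := (hBβ n).trans (ContinuousLinearMap.opNorm_le_bound _ (by linarith) hcon)
    linarith
  set w := (1 - proj N X p n) u with hw
  have hwu : ‖w‖ ≤ ‖u‖ := norm_sub_proj_apply_le n u
  have hww : (1 - proj N X p n) w = w := by
    rw [hw]
    simp only [sub_apply, one_apply_eq_self, map_sub]
    rw [proj_proj_apply le_rfl]
    abel
  have hBw : (β - δ) * ‖w‖ < ‖B w‖ := lt_of_le_of_lt (by gcongr; linarith) hu
  have hw0 : 0 < ‖w‖ := by
    rcases (norm_nonneg w).eq_or_lt with h0 | h0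
    · have : w = 0 := norm_eq_zero.1 h0.symm
      rw [this] at hBw
      simp at hBw
    · exact h0
  have hPBw : ‖proj N X p m (B w)‖ ≤ δ * ‖w‖ := by
    have := (proj N X p m * B * (1 - proj N X p n)).le_opNorm w
    rw [mul_apply_eq_comp, hww, mul_apply_eq_comp] at this
    exact this.trans (by gcongr)
  have hABw : ‖A (B w)‖ ≤ (1 + δ) * ‖w‖ := by
    have := ((A * B - 1) * (1 - proj N X p n)).le_opNorm w
    rw [mul_apply_eq_comp, hww, sub_apply, mul_apply_eq_comp, one_apply_eq_self] at this
    have h3 := norm_sub_norm_le (A (B w)) w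
    have h4 := this.trans (mul_le_mul_of_nonneg_right h2 (norm_nonneg w))
    linarith
  have hxlow : (β - 2 * δ) * ‖w‖ < ‖B w - proj N X p m (B w)‖ := by
    have := norm_sub_norm_le (B w) (proj N X p m (B w))
    nlinarith
  refine ⟨B w - proj N X p m (B w), ?_, ?_, ?_⟩
  · intro h0
    rw [h0, norm_zero] at hxlow
    have : 0 < (β - 2 * δ) * ‖w‖ := mul_pos (by linarith) hw0
    linarith
  · rw [map_sub, proj_proj_apply le_rfl, sub_self]
  · calc ‖A (B w - proj N X p m (B w))‖ ≤ ‖A (B w)‖ + ‖A‖ * ‖proj N X p m (B w)‖ := by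
          rw [map_sub]
          exact (norm_sub_le _ _).trans (by gcongr; exact A.le_opNorm _)
      _ ≤ (1 + δ) * ‖w‖ + ‖A‖ * (δ * ‖w‖) := by gcongr
      _ = (1 + δ * (1 + ‖A‖)) * ‖w‖ := by ring
      _ ≤ ((β⁻¹ + ε) * (β - 2 * δ)) * ‖w‖ := by
          gcongr
          have e1 : (β⁻¹ + ε) * (β - 2 * δ) = 1 + ε * β - δ * (2 * (β⁻¹ + ε)) := by
            field_simp
          rw [e1, hs] at *
          linarith
      _ = (β⁻¹ + ε) * ((β - 2 * δ) * ‖w‖) := by ring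
      _ ≤ (β⁻¹ + ε) * ‖B w - proj N X p m (B w)‖ := by gcongr

theorem exists_tendsToInfinity (hN : 1 ≤ N) : ∃ h : ℕ → Idx N, TendsToInfinity h := by
  refine ⟨fun n _ => n, tendsToInfinity_of_le fun n => ?_⟩
  refine le_trans ?_ (norm_le_pi_norm (fun _ : Fin N => (n : ℤ)) ⟨0, hN⟩)
  simp

/-- The quotient norm of a regularizer is attained as the norm of the inverse of a limit
operator. -/
theorem exists_limitOp_norm_eq [CompleteSpace X] (hN : 1 ≤ N) {A B : pAlg (proj N X p)}
    (hA : FamilyComm A.1) (hrich : IsRich A.1) (hAB : IsPRegularizer (proj N X p) A.1 B.1) :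
    ∃ C ∈ opSpec A.1, ∃ S ∈ opSpec B.1, S * C = 1 ∧ C * S = 1 ∧
      ‖S‖ = ‖coset (proj N X p) B‖ := by
  have hnn : 0 ≤ ‖coset (proj N X p) B‖ := le_of_forall_pos_le_add fun ε hε => by
    obtain ⟨C, -, hC⟩ := exists_norm_lt_coset_add B hε
    exact (norm_nonneg C.1).trans hC.le
  -- If the quotient norm is 0, then `β⁻¹` is meaningless but every limit operator attains the
  -- bound; only the existence of one is needed, which uses `1 ≤ N`.
  rcases hnn.eq_or_lt with h0 | hpos
  · obtain ⟨h, hh⟩ := exists_tendsToInfinity hN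
    obtain ⟨φ, hφ, C, hC⟩ := hrich h hh
    obtain ⟨S, hSC, hCS, hS⟩ := hC.exists_inverse hA hAB.1 hAB.2 (hh.comp hφ)
    have hSmem : S ∈ opSpec B.1 := ⟨_, hh.comp hφ, hS⟩
    refine ⟨C, ⟨_, hh.comp hφ, hC⟩, S, hSmem, hSC, hCS,
      le_antisymm (norm_le_norm_coset hSmem) ?_⟩
    rw [← h0]
    exact norm_nonneg S
  · obtain ⟨C, ⟨h, hh, hC⟩, hlow⟩ := exists_opSpec_lower hA hrich (inv_nonneg.2 hnn)
      fun m ε hε => exists_far_almost_minimizer B.2 hAB.1 hpos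
        (norm_coset_le_norm_mul_one_sub_proj B) m hε
    obtain ⟨S, hSC, hCS, hS⟩ := hC.exists_inverse hA hAB.1 hAB.2 hh
    have hSmem : S ∈ opSpec B.1 := ⟨_, hh, hS⟩
    refine ⟨C, ⟨h, hh, hC⟩, S, hSmem, hSC, hCS, le_antisymm (norm_le_norm_coset hSmem) ?_⟩
    set β := ‖coset (proj N X p) B‖
    -- Almost minimizers of `C` at level `β⁻¹` bound the norm of its inverse from below by `β`.
    have key : ∀ ε > 0, 1 ≤ ‖S‖ * (β⁻¹ + ε) := fun ε hε => by
      obtain ⟨x, hx, hCx⟩ := hlow ε hε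
      have hx' : 0 < ‖x‖ := norm_pos_iff.2 hx
      have h1 : ‖x‖ ≤ ‖S‖ * ((β⁻¹ + ε) * ‖x‖) := by
        have h2 : S (C x) = x := DFunLike.congr_fun hSC x
        calc ‖x‖ = ‖S (C x)‖ := by rw [h2]
          _ ≤ ‖S‖ * ‖C x‖ := S.le_opNorm _
          _ ≤ ‖S‖ * ((β⁻¹ + ε) * ‖x‖) := by gcongr
      rw [← mul_assoc] at h1
      by_contra! hlt
      nlinarith
    have h1 : 1 ≤ ‖S‖ * β⁻¹ := by
      refine le_of_forall_pos_le_add fun ε hε => ?_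
      have h2 := key (ε / (‖S‖ + 1)) (by positivity)
      have h3 : ‖S‖ * (ε / (‖S‖ + 1)) ≤ ε := by
        rw [mul_div_assoc', div_le_iff₀ (by positivity)]
        nlinarith [norm_nonneg S]
      linarith
    rwa [← div_eq_mul_inv, one_le_div hpos] at h1

theorem invNorm_of_mul_eq_one {R : Type*} [MonoidWithZero R] [Norm R] {a b : R} (h1 : a * b = 1)
    (h2 : b * a = 1) : invNorm a = ENNReal.ofReal ‖b‖ := by
  have hu : IsUnit a := ⟨⟨a, b, h1, h2⟩, rfl⟩
  rw [invNorm, if_pos hu]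
  congr 2
  exact Ring.inverse_unit (⟨a, b, h1, h2⟩ : Rˣ)

end Regularizers

/-! ### Gluing local inverses -/

section Gluing

open scoped NNReal

variable {N : ℕ} {X : Type*} [NormedAddCommGroup X] [NormedSpace ℂ X] {p : Exponent}

/-- Each entry is taken from the one family member assigned to it, and is at most the `ℓ^q` norm
over all members. This controls operators glued along a tiling. -/
theorem ellNorm_diag_le {J : Type*} (t : Idx N → J) (y : J → SeqSpace N X p) :
    ellNorm p.normExp (fun i => ‖coord i (y (t i))‖ₑ) ≤ ellNorm p.normExp (fun a => ‖y a‖ₑ) := by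
  calc _ ≤ ellNorm p.normExp (fun i => ellNorm p.normExp fun a => ‖coord i (y a)‖ₑ) :=
        ellNorm_mono fun i => le_ellNorm (fun a => ‖coord i (y a)‖ₑ) (t i)
    _ = ellNorm p.normExp (fun a => ‖y a‖ₑ) := by
        rw [ellNorm_comm]
        simp_rw [ellNorm_enorm]

theorem ellNorm_op_family_le {J : Type*} (B : J → SeqSpace N X p →L[ℂ] SeqSpace N X p) {M : ℝ≥0}
    (hB : ∀ a, ‖B a‖ ≤ M) (y : J → SeqSpace N X p) :
    ellNorm p.normExp (fun a => ‖B a (y a)‖ₑ) ≤ M * ellNorm p.normExp (fun a => ‖y a‖ₑ) := by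
  rw [← ellNorm_const_mul]
  refine ellNorm_mono fun a => ?_
  rw [← ENNReal.ofReal_coe_nnreal, enorm_le_mul_iff M.coe_nonneg]
  exact (B a).le_of_opNorm_le (hB a) _

/-- Local operators `B a` can be glued along a tiling. -/
theorem exists_glued {c lam : ℝ≥0} {D : ℕ} {t z : Idx N → Idx N} {θ : Idx N → Idx N → ℝ}
    (hθ : SlowFamily p.normExp c lam θ) (htD : ∀ i, ‖i - z (t i)‖ ≤ D)
    (hθD : ∀ a i, θ a i ≠ 0 → ‖i - z a‖ ≤ D) (B : Idx N → SeqSpace N X p →L[ℂ] SeqSpace N X p)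
    {M : ℝ≥0} (hB : ∀ a, ‖B a‖ ≤ M) :
    ∃ R : SeqSpace N X p →L[ℂ] SeqSpace N X p,
      ∀ x i, coord i (R x) = coord i (B (t i) (scalarMul p (θ (t i)) x)) := by
  refine exists_op_of_entries (LinearMap.pi fun i =>
    (coord i).comp ((B (t i) * scalarMul p (θ (t i)) : SeqSpace N X p →L[ℂ] SeqSpace N X p) :
      SeqSpace N X p →ₗ[ℂ] SeqSpace N X p)) (M * c) (fun x => ?_) fun x hx => ?_
  · refine (ellNorm_diag_le t fun a => B a (scalarMul p (θ a) x)).trans ?_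
    refine (ellNorm_op_family_le B hB _).trans ?_
    rw [ENNReal.ofReal_mul M.coe_nonneg, ENNReal.ofReal_coe_nnreal, ENNReal.ofReal_coe_nnreal,
      mul_assoc]
    gcongr
    exact hθ.ellNorm_scalarMul_le x
  -- A nonzero entry `i` of the image forces a nonzero entry of `x` within distance `2 D`.
  -- Preservation of finite support is what the case `p = 0` requires.
  · refine (hx.biUnion fun j _ => finite_norm_sub_le j (2 * D)).subset fun i hi => ?_
    have h1 : coord i (B (t i) (scalarMul p (θ (t i)) x)) ≠ 0 := hi
    obtain ⟨j, hj⟩ : ∃ j, coord j (scalarMul p (θ (t i)) x) ≠ 0 := by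
      by_contra! h
      have h0 : scalarMul p (θ (t i)) x = 0 := seq_ext fun j => by rw [h j, map_zero]
      exact h1 (by rw [h0, map_zero, map_zero])
    obtain ⟨hj1, hj2⟩ := coord_scalarMul_ne_zero (hθ.abs_le _) hj
    refine Set.mem_biUnion (x := j) hj2 ?_
    have h2 := htD i
    have h3 := hθD _ _ hj1
    have h4 := norm_sub_le (i - z (t i)) (j - z (t i))
    rw [sub_sub_sub_cancel_right] at h4
    change ‖i - j‖ ≤ 2 * D
    linarith

/-- Glued operators almost commute with slowly varying families. -/
theorem familyComm_of_glued {c lam : ℝ≥0} {D : ℕ} {t z : Idx N → Idx N}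
    {θ : Idx N → Idx N → ℝ} (hθ : SlowFamily p.normExp c lam θ) (htD : ∀ i, ‖i - z (t i)‖ ≤ D)
    (hθD : ∀ a i, θ a i ≠ 0 → ‖i - z a‖ ≤ D) (B : Idx N → SeqSpace N X p →L[ℂ] SeqSpace N X p)
    {M : ℝ≥0} (hB : ∀ a, ‖B a‖ ≤ M) {R : SeqSpace N X p →L[ℂ] SeqSpace N X p}
    (hR : ∀ x i, coord i (R x) = coord i (B (t i) (scalarMul p (θ (t i)) x))) :
    FamilyComm R := by
  intro c' ε hε
  set s : ℝ≥0 := D * (‖R‖₊ + M * c) with hs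
  refine ⟨ε / (s + 1), by positivity, fun J ψ hψ x => ?_⟩
  set l : ℝ≥0 := ε / (s + 1) with hl
  have hslow : ∀ i j : Idx N, ‖i - j‖ ≤ D →
      ellNorm p.normExp (fun b => ‖ψ b i - ψ b j‖ₑ) ≤ ((l * D : ℝ≥0) : ℝ≥0∞) := by
    intro i j hij
    refine (hψ.slow i j).trans ?_
    rw [ENNReal.coe_mul]
    gcongr
    rw [← ofReal_norm, ← ENNReal.ofReal_coe_nnreal]
    exact ENNReal.ofReal_le_ofReal (by simpa using hij)
  -- On the support of `θ a` the slow function `ψ b` is nearly its value at `z a`, and this constant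
  -- commutes with `B a`. Hence no commutation property of the local operators is needed; `v` is the
  -- error of the replacement.
  let v : J → Idx N → SeqSpace N X p := fun b a =>
    ((ψ b (z a) : ℝ) : ℂ) • scalarMul p (θ a) x - scalarMul p (θ a) (scalarMul p (ψ b) x)
  have hv : ∀ a, ellNorm p.normExp (fun b => ‖v b a‖ₑ)
      ≤ ((l * D : ℝ≥0) : ℝ≥0∞) * ‖scalarMul p (θ a) x‖ₑ := by
    intro a
    classical
    refine ellNorm_family_le _ _ (fun b j => if θ a j ≠ 0 then ‖ψ b (z a) - ψ b j‖ₑ else 0) _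
      (fun b j => ?_) fun j => ?_
    · have e : coord j (v b a) = ((ψ b (z a) - ψ b j : ℝ) : ℂ) • coord j (scalarMul p (θ a) x) := by
        simp only [v]
        rw [map_sub, map_smul, coord_scalarMul (hθ.abs_le a), coord_scalarMul (hθ.abs_le a),
          coord_scalarMul (hψ.abs_le b), Complex.ofReal_sub, sub_smul, smul_comm (θ a j : ℂ)]
      rw [e, enorm_smul]
      split_ifs with h0
      · gcongr
        rw [← ofReal_norm, ← ofReal_norm, Complex.norm_real]
      · rw [not_not] at h0
        rw [coord_scalarMul (hθ.abs_le a), h0]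
        simp
    · split_ifs with h0
      · refine hslow _ _ ?_
        rw [norm_sub_rev]
        exact hθD a j h0
      · rw [ellNorm_zero]
        exact zero_le
  have hcomm : ∀ b i, ‖coord i (scalarMul p (ψ b) (R x) - R (scalarMul p (ψ b) x))‖ₑ
      ≤ ‖ψ b i - ψ b (z (t i))‖ₑ * ‖coord i (R x)‖ₑ + ‖coord i (B (t i) (v b (t i)))‖ₑ := by
    intro b i
    have e : coord i (scalarMul p (ψ b) (R x) - R (scalarMul p (ψ b) x))
        = ((ψ b i - ψ b (z (t i)) : ℝ) : ℂ) • coord i (R x) + coord i (B (t i) (v b (t i))) := by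
      simp only [v]
      rw [map_sub, coord_scalarMul (hψ.abs_le b), hR, hR, map_sub, map_sub, map_smul, map_smul,
        Complex.ofReal_sub, sub_smul]
      abel
    rw [e]
    refine (enorm_add_le _ _).trans ?_
    rw [enorm_smul]
    gcongr
    rw [← ofReal_norm, ← ofReal_norm, Complex.norm_real]
  have hfirst : ellNorm p.normExp (fun b => ellNorm p.normExp fun i =>
      ‖ψ b i - ψ b (z (t i))‖ₑ * ‖coord i (R x)‖ₑ) ≤ ((l * D : ℝ≥0) : ℝ≥0∞) * ‖R x‖ₑ := by
    rw [ellNorm_comm, ← ellNorm_enorm, ← ellNorm_const_mul]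
    refine ellNorm_mono fun i => ?_
    simp_rw [mul_comm _ ‖coord i (R x)‖ₑ]
    rw [ellNorm_const_mul]
    gcongr
    exact hslow _ _ (htD i)
  have hsecond : ellNorm p.normExp (fun b => ellNorm p.normExp fun a => ‖B a (v b a)‖ₑ)
      ≤ M * (((l * D : ℝ≥0) : ℝ≥0∞) * (c * ‖x‖ₑ)) := by
    calc _ ≤ ellNorm p.normExp (fun b => M * ellNorm p.normExp fun a => ‖v b a‖ₑ) :=
          ellNorm_mono fun b => ellNorm_op_family_le B hB _
      _ = M * ellNorm p.normExp (fun a => ellNorm p.normExp fun b => ‖v b a‖ₑ) := by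
          rw [ellNorm_const_mul, ellNorm_comm]
      _ ≤ M * ellNorm p.normExp
            (fun a => ((l * D : ℝ≥0) : ℝ≥0∞) * ‖scalarMul p (θ a) x‖ₑ) := by
          gcongr
          exact ellNorm_mono hv
      _ ≤ _ := by
          rw [ellNorm_const_mul]
          gcongr
          exact hθ.ellNorm_scalarMul_le x
  calc ellNorm p.normExp (fun b => ‖scalarMul p (ψ b) (R x) - R (scalarMul p (ψ b) x)‖ₑ)
      ≤ ellNorm p.normExp (fun b => ellNorm p.normExp (fun i =>
          ‖ψ b i - ψ b (z (t i))‖ₑ * ‖coord i (R x)‖ₑ) +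
          ellNorm p.normExp fun a => ‖B a (v b a)‖ₑ) := by
        refine ellNorm_mono fun b => ?_
        rw [← ellNorm_enorm]
        refine (ellNorm_mono (hcomm b)).trans ((ellNorm_add_le _ _).trans ?_)
        gcongr
        exact ellNorm_diag_le t fun a => B a (v b a)
    _ ≤ ((l * D : ℝ≥0) : ℝ≥0∞) * (‖R‖ₑ * ‖x‖ₑ) + M * (((l * D : ℝ≥0) : ℝ≥0∞) * (c * ‖x‖ₑ)) := by
        refine (ellNorm_add_le _ _).trans (add_le_add (hfirst.trans ?_) hsecond)
        gcongr
        exact enorm_op_apply_le R x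
    _ = ((l * s : ℝ≥0) : ℝ≥0∞) * ‖x‖ₑ := by
        have h1 : ‖R‖ₑ = (‖R‖₊ : ℝ≥0∞) := rfl
        rw [h1, hs]
        push_cast
        ring
    _ ≤ ε * ‖x‖ₑ := by
        gcongr
        rw [hl, div_mul_eq_mul_div, div_le_iff₀ (by positivity)]
        gcongr
        simp

/-- Far out, `A` is locally almost invertible, with bounds on the local inverses. -/
theorem exists_local_inverses {A : SeqSpace N X p →L[ℂ] SeqSpace N X p} (hrich : IsRich A)
    {M : ℝ} (hinv : ∀ C ∈ opSpec A, ∃ S, S * C = 1 ∧ ‖S‖ ≤ M) (k : ℕ) {ε : ℝ} (hε : 0 < ε) :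
    ∃ m : ℕ, ∀ a : Idx N, m ≤ ‖a‖ → ∃ B : SeqSpace N X p →L[ℂ] SeqSpace N X p,
      ‖B‖ ≤ M ∧ ‖(B * A - 1) * (shift p a * proj N X p k)‖ ≤ ε := by
  -- The points of failure tend to infinity, so by richness a subsequence yields a limit operator,
  -- whose left inverse contradicts the failure after being shifted back.
  by_contra! hcon
  choose h hh hB using hcon
  have hinf : TendsToInfinity h := tendsToInfinity_of_le hh
  obtain ⟨φ, hφ, C, hC⟩ := hrich h hinf
  obtain ⟨S, hSC, hSM⟩ := hinv C ⟨_, hinf.comp hφ, hC⟩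
  have h1 : Tendsto (fun n => S * (shiftConj A ((h ∘ φ) n) * proj N X p k - C * proj N X p k))
      atTop (𝓝 0) := by
    refine tendsto_mul_zero_of_bounded (M := ‖S‖) (fun n => le_rfl) ?_
    have := ((isLimitOp_iff.1 hC _ (proj_mem_pCompact k)).2).sub
      (tendsto_const_nhds (x := C * proj N X p k))
    rwa [sub_self] at this
  obtain ⟨n, hn⟩ := Metric.tendsto_atTop.1 h1 ε hε
  have hn := hn n le_rfl
  rw [dist_zero_right] at hn
  have h2 := hB (φ n) (shift p (h (φ n)) * S * shift p (-h (φ n))) (by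
    rwa [norm_mul_shift, norm_shift_mul])
  have e : (shift p (h (φ n)) * S * shift p (-h (φ n)) * A - 1) * (shift p (h (φ n)) * proj N X p k)
      = shift p (h (φ n)) * (S * (shiftConj A ((h ∘ φ) n) * proj N X p k - C * proj N X p k)) := by
    rw [mul_sub S, ← mul_assoc S C, hSC, one_mul, sub_mul, one_mul, mul_sub, shiftConj]
    simp only [mul_assoc, Function.comp_apply]
  rw [e, norm_shift_mul] at h2
  linarith

/-- A left inverse of `A` up to a small error and a `P`-compact operator. -/
theorem exists_approx_left_inverse {A : SeqSpace N X p →L[ℂ] SeqSpace N X p} (hA : FamilyComm A)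
    (hrich : IsRich A) {M : ℝ} (hinv : ∀ C ∈ opSpec A, ∃ S, S * C = 1 ∧ ‖S‖ ≤ M) (hM : 0 ≤ M) :
    ∃ R, FamilyComm R ∧ ∃ m, ‖(1 - proj N X p m) * (R * A - 1)‖ ≤ 1 / 2 := by
  classical
  lift M to ℝ≥0 using hM
  -- The commutator contributes at most `M / (4 (M + 1)) ≤ 1 / 4`, and the local inverses, accurate
  -- to `1 / (4 · 5 ^ N)` with overlap `5 ^ N`, contribute another `1 / 4`.
  obtain ⟨lam, hlam, hcomm⟩ := hA (5 ^ N) (1 / (4 * (M + 1))) (by positivity)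
  obtain ⟨D, t, z, θ, hθ, hθ1, htD, hθD⟩ := exists_tile_family (N := N) p.normExp hlam
  obtain ⟨m, hm⟩ := exists_local_inverses hrich hinv D
    (show (0 : ℝ) < 1 / (4 * 5 ^ N) by positivity)
  have hB : ∀ a : Idx N, ∃ B : SeqSpace N X p →L[ℂ] SeqSpace N X p, ‖B‖ ≤ M ∧
      (m ≤ ‖z a‖ → ‖(B * A - 1) * (shift p (z a) * proj N X p D)‖ ≤ 1 / (4 * 5 ^ N)) := by
    intro a
    by_cases ha : m ≤ ‖z a‖
    · obtain ⟨B, h1, h2⟩ := hm _ ha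
      exact ⟨B, h1, fun _ => h2⟩
    -- Tiles near the origin receive the zero operator; the projection `1 - P_{m+D}` discards their
    -- entries.
    · exact ⟨0, by simp, fun h => absurd h ha⟩
  choose B hBM hBA using hB
  obtain ⟨R, hR⟩ := exists_glued hθ htD hθD B hBM
  refine ⟨R, familyComm_of_glued hθ htD hθD B hBM hR, m + D,
    ContinuousLinearMap.opNorm_le_bound _ (by norm_num) fun x => ?_⟩
  have hloc : ∀ a, scalarMul p (θ a) x
      = shift p (z a) (proj N X p D (shift p (-z a) (scalarMul p (θ a) x))) := fun a =>
    seq_ext fun i => by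
      rw [coord_shift, coord_proj, coord_shift]
      split_ifs with hi
      · rw [sub_neg_eq_add, sub_add_cancel]
      · by_contra hne
        exact hi (hθD a i (coord_scalarMul_ne_zero (hθ.abs_le a) hne).1)
  -- On the tile `a`, where `θ a = 1`, the error `R A x - x` coincides with `B_a θ_a A x - θ_a x =
  -- B_a (θ_a A - A θ_a) x + (B_a A - 1) θ_a x`.
  let y : Idx N → SeqSpace N X p := fun a => if m ≤ ‖z a‖ then
    B a (scalarMul p (θ a) (A x) - A (scalarMul p (θ a) x)) + (B a * A - 1) (scalarMul p (θ a) x)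
    else 0
  have hy : ∀ a, ‖y a‖ₑ ≤ M * ‖scalarMul p (θ a) (A x) - A (scalarMul p (θ a) x)‖ₑ
      + ENNReal.ofReal (1 / (4 * 5 ^ N)) * ‖scalarMul p (θ a) x‖ₑ := by
    intro a
    simp only [y]
    split_ifs with ha
    · refine (enorm_add_le _ _).trans (add_le_add ?_ ?_)
      · rw [← ENNReal.ofReal_coe_nnreal, enorm_le_mul_iff M.coe_nonneg]
        exact (B a).le_of_opNorm_le (hBM a) _
      · rw [enorm_le_mul_iff (by positivity)]
        have h1 := ((B a * A - 1) * (shift p (z a) * proj N X p D)).le_of_opNorm_le (hBA a ha)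
          (shift p (-z a) (scalarMul p (θ a) x))
        rw [mul_apply_eq_comp, mul_apply_eq_comp, ← hloc, norm_shift_apply] at h1
        exact h1
    · rw [enorm_zero]
      exact zero_le
  have hcoord : ∀ i, ‖coord i (((1 - proj N X p (m + D)) * (R * A - 1)) x)‖ₑ
      ≤ ‖coord i (y (t i))‖ₑ := by
    intro i
    by_cases hi : ‖i‖ ≤ (m + D : ℕ)
    · have e : coord i (((1 - proj N X p (m + D)) * (R * A - 1)) x) = 0 := by
        rw [mul_apply_eq_comp, sub_apply, one_apply_eq_self, map_sub, coord_proj_of_le hi, sub_self]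
      rw [e, enorm_zero]
      exact zero_le
    · rw [not_le] at hi
      have hz : m ≤ ‖z (t i)‖ := by
        have h1 := htD i
        have h2 := norm_sub_norm_le i (z (t i))
        push_cast at hi
        linarith
      have e : coord i (((1 - proj N X p (m + D)) * (R * A - 1)) x) = coord i (y (t i)) := by
        have hx : coord i (scalarMul p (θ (t i)) x) = coord i x := by
          rw [coord_scalarMul (hθ.abs_le _), hθ1]; simp
        simp only [y, if_pos hz]
        rw [mul_apply_eq_comp, sub_apply, one_apply_eq_self, map_sub, coord_proj_of_lt hi, sub_zero,
          sub_apply, mul_apply_eq_comp, one_apply_eq_self, map_sub, hR, map_sub (B (t i)),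
          map_add, map_sub, sub_apply, mul_apply_eq_comp, one_apply_eq_self, map_sub, hx]
        abel
      rw [e]
  have h5 : (1 : ℝ) / 2 = 1 / 4 + 1 / (4 * 5 ^ N) * 5 ^ N := by
    field_simp; norm_num
  rw [← enorm_le_mul_iff (by norm_num), ← ellNorm_enorm]
  calc _ ≤ ellNorm p.normExp (fun i => ‖coord i (y (t i))‖ₑ) := ellNorm_mono hcoord
    _ ≤ ellNorm p.normExp (fun a => ‖y a‖ₑ) := ellNorm_diag_le t y
    _ ≤ M * ellNorm p.normExp
          (fun a => ‖scalarMul p (θ a) (A x) - A (scalarMul p (θ a) x)‖ₑ)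
        + ENNReal.ofReal (1 / (4 * 5 ^ N)) *
          ellNorm p.normExp (fun a => ‖scalarMul p (θ a) x‖ₑ) := by
        rw [← ellNorm_const_mul, ← ellNorm_const_mul]
        exact (ellNorm_mono hy).trans (ellNorm_add_le _ _)
    _ ≤ M * (((1 / (4 * (M + 1)) : ℝ≥0) : ℝ≥0∞) * ‖x‖ₑ)
        + ENNReal.ofReal (1 / (4 * 5 ^ N)) * (((5 ^ N : ℝ≥0) : ℝ≥0∞) * ‖x‖ₑ) := by
        gcongr
        · exact hcomm _ θ hθ x
        · exact hθ.ellNorm_scalarMul_le x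
    _ ≤ ENNReal.ofReal (1 / 4) * ‖x‖ₑ + ENNReal.ofReal (1 / (4 * 5 ^ N) * 5 ^ N) * ‖x‖ₑ := by
        rw [← mul_assoc, ← mul_assoc]
        gcongr
        · rw [← ENNReal.coe_mul, ← ENNReal.ofReal_coe_nnreal]
          refine ENNReal.ofReal_le_ofReal ?_
          push_cast
          rw [mul_one_div, div_le_div_iff₀ (by positivity) (by norm_num)]
          linarith
        · rw [← ENNReal.ofReal_coe_nnreal, ← ENNReal.ofReal_mul (by positivity)]
          push_cast
          exact le_rfl
    _ = ENNReal.ofReal (1 / 2) * ‖x‖ₑ := by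
        rw [← add_mul, ← ENNReal.ofReal_add (by norm_num) (by positivity), ← h5]

end Gluing

/-! ### Invertibility of all limit operators implies `P`-Fredholmness -/

section Fredholm

variable {N : ℕ} {X : Type*} [NormedAddCommGroup X] [NormedSpace ℂ X] {p : Exponent}

/-- An operator that vanishes at infinity along subsequences is `P`-compact. -/
theorem FamilyComm.mem_pCompact {Q : SeqSpace N X p →L[ℂ] SeqSpace N X p} (hQ : FamilyComm Q)
    (H : ∀ h : ℕ → Idx N, TendsToInfinity h → ∃ φ : ℕ → ℕ, StrictMono φ ∧
      ∀ k, Tendsto (fun n => shiftConj Q ((h ∘ φ) n) * proj N X p k) atTop (𝓝 0)) :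
    Q ∈ pCompact (proj N X p) := by
  refine mem_pCompact_of_approx fun ε hε => ?_
  -- Smallness on one side is enough: `Q P_m` is already `P`-compact because `Q` lies in `L(X, P)`.
  suffices h : ∃ m, ‖Q * (1 - proj N X p m)‖ ≤ ε by
    obtain ⟨m, hm⟩ := h
    refine ⟨Q * proj N X p m, (hQ.slowComm.mem_pAlg _ (proj_mem_pCompact m)).1, ?_⟩
    rwa [mul_sub, mul_one] at hm
  by_contra! hcon
  obtain ⟨D, hD⟩ := hQ.exists_localized_ge (half_pos hε)
  have hx : ∀ m, ∃ x, x ≠ 0 ∧ proj N X p m x = 0 ∧ (ε / 2 + ε / 2) * ‖x‖ ≤ ‖Q x‖ := by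
    intro m
    obtain ⟨u, hu⟩ : ∃ u, ε * ‖u‖ < ‖(Q * (1 - proj N X p m)) u‖ := by
      by_contra! h
      exact (hcon m).not_ge (ContinuousLinearMap.opNorm_le_bound _ hε.le h)
    refine ⟨u - proj N X p m u, fun h0 => ?_, ?_, ?_⟩
    · rw [mul_apply_eq_comp, sub_apply, one_apply_eq_self, h0, map_zero, norm_zero] at hu
      have : 0 ≤ ε * ‖u‖ := by positivity
      linarith
    · rw [map_sub, proj_proj_apply le_rfl, sub_self]
    · rw [add_halves]
      refine le_trans ?_ hu.le
      gcongr
      exact norm_sub_proj_apply_le m u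
  choose x hx0 hxP hxQ using hx
  -- Almost maximizers outside the cube `m` are localized to a fixed diameter `D`. Recentred at
  -- points `h m` of their supports, they contradict the convergence to zero on the cube `D`.
  choose y hy0 hyx hyD hyQ using fun m => hD (ε / 2) (x m) (by positivity) (hx0 m) (hxQ m)
  choose h hh using fun m => exists_coord_ne_zero (hy0 m)
  have hinf : TendsToInfinity h := tendsToInfinity_of_le fun n => by
    by_contra! hlt
    refine hyx n _ (hh n) ?_
    rw [← coord_proj_of_le hlt.le, hxP, map_zero]
  obtain ⟨φ, hφ, hlim⟩ := H h hinf
  obtain ⟨n, hn⟩ := Metric.tendsto_atTop.1 (hlim D) (ε / 2) (by positivity)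
  have hn := hn n le_rfl
  rw [dist_zero_right] at hn
  have hu : proj N X p D (shift p (-h (φ n)) (y (φ n))) = shift p (-h (φ n)) (y (φ n)) :=
    seq_ext fun i => by
      rw [coord_proj, coord_shift, sub_neg_eq_add]
      split_ifs with hi
      · rfl
      · by_contra hne
        have := hyD (φ n) _ _ (Ne.symm hne) (hh (φ n))
        rw [add_sub_cancel_right] at this
        exact hi this
  have h1 := (shiftConj Q ((h ∘ φ) n) * proj N X p D).le_opNorm (shift p (-h (φ n)) (y (φ n)))
  have e : (shiftConj Q ((h ∘ φ) n) * proj N X p D) (shift p (-h (φ n)) (y (φ n)))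
      = shift p (-h (φ n)) (Q (y (φ n))) := by
    rw [mul_apply_eq_comp, hu, shiftConj]
    simp only [mul_apply_eq_comp, Function.comp_apply]
    rw [shift_shift_apply, add_neg_cancel, shift_zero_apply]
  rw [e, norm_shift_apply, norm_shift_apply] at h1
  have h2 := hyQ (φ n)
  have h3 : 0 < ‖y (φ n)‖ := norm_pos_iff.2 (hy0 _)
  nlinarith

/-- If all limit operators are invertible, their inverses are uniformly bounded. -/
theorem exists_bound_inverse {A : SeqSpace N X p →L[ℂ] SeqSpace N X p} (hA : FamilyComm A)
    (hrich : IsRich A) (hinv : ∀ C ∈ opSpec A, ∃ S, S * C = 1 ∧ C * S = 1) :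
    ∃ M : ℝ, 0 ≤ M ∧ ∀ C ∈ opSpec A, ∃ S, S * C = 1 ∧ C * S = 1 ∧ ‖S‖ ≤ M := by
  -- If `A` had no positive lower bound outside some cube, `exists_opSpec_lower` with `ν = 0` would
  -- produce a limit operator that is not bounded below.
  obtain ⟨m, ν, hν, hlow⟩ : ∃ m : ℕ, ∃ ν > 0, ∀ x, proj N X p m x = 0 → ν * ‖x‖ ≤ ‖A x‖ := by
    by_contra! hcon
    obtain ⟨C, hC, hClow⟩ := exists_opSpec_lower hA hrich le_rfl fun m ε hε => by
      obtain ⟨x, hx, hlt⟩ := hcon m ε hε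
      refine ⟨x, fun h0 => ?_, hx, by rw [zero_add]; exact hlt.le⟩
      rw [h0] at hlt
      simp at hlt
    obtain ⟨S, hS, -⟩ := hinv C hC
    obtain ⟨x, hx, hCx⟩ := hClow (1 / (2 * (‖S‖ + 1))) (by positivity)
    have hx' : 0 < ‖x‖ := norm_pos_iff.2 hx
    have h2 : S (C x) = x := DFunLike.congr_fun hS x
    have h1 : ‖x‖ ≤ ‖x‖ / 2 := by
      calc ‖x‖ = ‖S (C x)‖ := by rw [h2]
        _ ≤ (‖S‖ + 1) * (1 / (2 * (‖S‖ + 1)) * ‖x‖) := by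
            refine (S.le_opNorm _).trans ?_
            rw [zero_add] at hCx
            gcongr
            linarith
        _ = ‖x‖ / 2 := by field_simp
    linarith
  refine ⟨ν⁻¹, by positivity, fun C hC => ?_⟩
  obtain ⟨S, hSC, hCS⟩ := hinv C hC
  obtain ⟨h, hh, hC⟩ := hC
  -- A finitely supported vector shifted far out avoids the cube `m`, so every limit operator
  -- inherits the same lower bound `ν`.
  have hClow : ∀ x, ν * ‖x‖ ≤ ‖C x‖ := by
    refine (hC.slowComm hA).lower_bound hν.le fun k x => ?_
    have h1 := (tendsto_op_apply (isLimitOp_iff.1 hC _ (proj_mem_pCompact k)).2 x).norm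
    refine ge_of_tendsto h1 ?_
    filter_upwards [tendsto_atTop.1 hh (m + k + 1 : ℝ)] with n hn
    have e := (proj_mul_shiftConj_proj (X := X) (p := p) (k := k) (m := m)
      (show (k + m : ℝ) < ‖h n‖ by linarith)).2
    have h2 := hlow (shift p (h n) (proj N X p k x)) (DFunLike.congr_fun e x)
    rw [norm_shift_apply] at h2
    refine h2.trans_eq ?_
    rw [shiftConj]
    simp only [mul_apply_eq_comp]
    rw [norm_shift_apply]
  refine ⟨S, hSC, hCS, ContinuousLinearMap.opNorm_le_bound _ (by positivity) fun x => ?_⟩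
  rw [le_inv_mul_iff₀ hν]
  have h2 : C (S x) = x := DFunLike.congr_fun hCS x
  simpa [h2] using hClow (S x)

/-- If all limit operators of `A` are invertible, then `A` has a `P`-regularizer in `L(X, P)`. -/
theorem exists_regularizer_of_opSpec [CompleteSpace X]
    {A : SeqSpace N X p →L[ℂ] SeqSpace N X p} (hA : FamilyComm A) (hrich : IsRich A)
    (hinv : ∀ C ∈ opSpec A, ∃ S, S * C = 1 ∧ C * S = 1) :
    ∃ B ∈ pAlg (proj N X p), IsPRegularizer (proj N X p) A B := by
  obtain ⟨M, hM, hinvM⟩ := exists_bound_inverse hA hrich hinv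
  obtain ⟨R, hR, m, hRA⟩ := exists_approx_left_inverse hA hrich
    (fun C hC => by obtain ⟨S, h1, -, h2⟩ := hinvM C hC; exact ⟨S, h1, h2⟩) hM
  -- `R A = 1 + E + K` with `‖E‖ ≤ 1 / 2` and `K` `P`-compact. Inverting `1 + E` by a Neumann series
  -- gives `V R A = 1 + V K`; `V` still almost commutes with slow families.
  set E := (1 - proj N X p m) * (R * A - 1) with hE
  set K := proj N X p m * (R * A - 1) with hK
  have hRA1 : FamilyComm (R * A - 1) := (hR.mul hA).sub familyComm_one
  have hKmem : K ∈ pCompact (proj N X p) := (hRA1.slowComm.mem_pAlg _ (proj_mem_pCompact m)).2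
  have hEcomm : FamilyComm E := (familyComm_one.sub (familyComm_proj m)).mul hRA1
  have hRAeq : R * A = (1 + E) + K := by rw [hE, hK, sub_mul, one_mul]; abel
  obtain ⟨V, hV1, hV2⟩ : ∃ V, V * (1 + E) = 1 ∧ (1 + E) * V = 1 := by
    have hlt : ‖-E‖ < 1 := by rw [norm_neg]; linarith
    have hu : ((Units.oneSub (-E) hlt : (SeqSpace N X p →L[ℂ] SeqSpace N X p)ˣ) :
        SeqSpace N X p →L[ℂ] SeqSpace N X p) = 1 + E := by
      rw [Units.val_oneSub, sub_neg_eq_add]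
    refine ⟨↑(Units.oneSub (-E) hlt)⁻¹, ?_, ?_⟩
    · rw [← hu, Units.inv_mul]
    · rw [← hu, Units.mul_inv]
  have hV : FamilyComm V := (familyComm_one.add hEcomm).inverse hV1 hV2
  have hVR : FamilyComm (V * R) := hV.mul hR
  have hVK : V * K ∈ pCompact (proj N X p) := (hV.slowComm.mem_pAlg _ hKmem).1
  have hQ : FamilyComm (A * (V * R) - 1) := (hA.mul hVR).sub familyComm_one
  -- `(A V R - 1) A = A (V R A - 1) = A V K`.
  have hQA : (A * (V * R) - 1) * A ∈ pCompact (proj N X p) := by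
    have e : (A * (V * R) - 1) * A = A * (V * K) := by
      have : (A * (V * R) - 1) * A = A * (V * (R * A)) - A := by noncomm_ring
      rw [this, hRAeq, mul_add, hV1, mul_add, mul_one, add_sub_cancel_left]
    rw [e]
    exact (hA.slowComm.mem_pAlg _ hVK).1
  refine ⟨V * R, hVR.slowComm.mem_pAlg, ?_, ?_⟩
  · refine hQ.mem_pCompact fun h hh => ?_
    obtain ⟨φ, hφ, C, hC⟩ := hrich h hh
    obtain ⟨S, hSC, hCS⟩ := hinv C ⟨_, hh.comp hφ, hC⟩
    have hS : S ∈ pAlg (proj N X p) := ((hC.slowComm hA).inverse hSC hCS).mem_pAlg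
    refine ⟨φ, hφ, fun k => ?_⟩
    have hSk := (hS _ (proj_mem_pCompact k)).1
    have h1 := (isLimitOp_iff.1 (isLimitOp_zero_of_mem_pCompact hQA (hh.comp hφ)) _ hSk).2
    -- Since `C S = 1`, the shifts satisfy `Q_n P_k = Q_n (C - A_n) S P_k + (Q A)_n S P_k`. The
    -- first term vanishes by boundedness of `Q_n`, the second because `Q A` is `P`-compact.
    have h2 : Tendsto (fun n => shiftConj (A * (V * R) - 1) ((h ∘ φ) n) *
        (C * (S * proj N X p k) - shiftConj A ((h ∘ φ) n) * (S * proj N X p k))) atTop (𝓝 0) := by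
      refine tendsto_mul_zero_of_bounded (fun n => (norm_shiftConj _ _).le) ?_
      have := (tendsto_const_nhds (x := C * (S * proj N X p k))).sub (isLimitOp_iff.1 hC _ hSk).2
      rwa [sub_self] at this
    have h3 := h2.add h1
    rw [zero_mul, zero_add] at h3
    refine h3.congr fun n => ?_
    rw [shiftConj_mul, mul_sub, ← mul_assoc C S, hCS, one_mul]
    simp only [mul_assoc]
    abel
  · have e : V * R * A - 1 = V * K := by
      rw [mul_assoc, hRAeq, mul_add, hV1, add_sub_cancel_left]
    rw [e]
    exact hVK

end Fredholm

end LimitOp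

end

/-! ### The norm of the inverse in the quotient algebra -/

theorem corollary3p6 (N : ℕ) (hN : 1 ≤ N) (X : Type*) [NormedAddCommGroup X] [NormedSpace ℂ X]
    [CompleteSpace X] (p : LimitOp.Exponent) (A : LimitOp.pAlg (LimitOp.proj N X p))
    (hA : LimitOp.IsBandDominated A.1) (hrich : LimitOp.IsRich A.1) :
    (LimitOp.IsPFredholm (LimitOp.proj N X p) A →
      ∀ B : LimitOp.SeqSpace N X p →L[ℂ] LimitOp.SeqSpace N X p,
        LimitOp.IsPRegularizer (LimitOp.proj N X p) A.1 B →
        ∃ hB : B ∈ LimitOp.pAlg (LimitOp.proj N X p),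
          LimitOp.invNorm (LimitOp.coset (LimitOp.proj N X p) A)
              = ENNReal.ofReal ‖LimitOp.coset (LimitOp.proj N X p) ⟨B, hB⟩‖ ∧
          IsGreatest ((fun C => ENNReal.ofReal ‖C‖) '' LimitOp.opSpec B)
            (LimitOp.invNorm (LimitOp.coset (LimitOp.proj N X p) A)) ∧
          IsGreatest (LimitOp.invNorm '' LimitOp.opSpec A.1)
            (LimitOp.invNorm (LimitOp.coset (LimitOp.proj N X p) A))) ∧
    (¬ LimitOp.IsPFredholm (LimitOp.proj N X p) A →
      LimitOp.invNorm (LimitOp.coset (LimitOp.proj N X p) A) = ∞ ∧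
      IsGreatest (LimitOp.invNorm '' LimitOp.opSpec A.1) ∞) := by
  have hcomm := hA.familyComm
  refine ⟨fun hF B hreg => ?_, fun hF => ⟨if_neg hF, ?_, fun _ _ => le_top⟩⟩
  · have hB := hreg.mem_pAlg hF
    have hcoset : LimitOp.invNorm (LimitOp.coset (LimitOp.proj N X p) A)
        = ENNReal.ofReal ‖LimitOp.coset (LimitOp.proj N X p) ⟨B, hB⟩‖ :=
      LimitOp.invNorm_of_mul_eq_one
        (LimitOp.coset_mul_eq_one_iff (A := A) (B := ⟨B, hB⟩) |>.2 hreg.1)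
        (LimitOp.coset_mul_eq_one_iff (A := ⟨B, hB⟩) (B := A) |>.2 hreg.2)
    -- The pair `C`, `S = C⁻¹` attains both maxima at once.
    obtain ⟨C, hC, S, hS, hSC, hCS, hnorm⟩ :=
      LimitOp.exists_limitOp_norm_eq hN (B := ⟨B, hB⟩) hcomm hrich hreg
    refine ⟨hB, hcoset, ⟨⟨S, hS, by rw [hcoset, ← hnorm]⟩, ?_⟩,
      ⟨⟨C, hC, by rw [hcoset, ← hnorm, LimitOp.invNorm_of_mul_eq_one hCS hSC]⟩, ?_⟩⟩
    · rintro _ ⟨T, hT, rfl⟩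
      rw [hcoset]
      exact ENNReal.ofReal_le_ofReal (LimitOp.norm_le_norm_coset (B := ⟨B, hB⟩) hT)
    · rintro _ ⟨T, ⟨h, hh, hT⟩, rfl⟩
      obtain ⟨S', h1, h2, hS'⟩ := hT.exists_inverse hcomm hreg.1 hreg.2 hh
      rw [hcoset, LimitOp.invNorm_of_mul_eq_one h2 h1]
      exact ENNReal.ofReal_le_ofReal (LimitOp.norm_le_norm_coset (B := ⟨B, hB⟩) ⟨h, hh, hS'⟩)
  -- If `∞` is not a value of `invNorm` on the operator spectrum, then all limit operators are units
  -- and `A` has a regularizer in `L(X, P)`.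
  · by_contra hcon
    refine hF ?_
    have hunit : ∀ C ∈ LimitOp.opSpec A.1, IsUnit C := fun C hC => by
      by_contra hu
      exact hcon ⟨C, hC, if_neg hu⟩
    obtain ⟨B, hB, h1, h2⟩ := LimitOp.exists_regularizer_of_opSpec hcomm hrich fun C hC => by
      obtain ⟨u, rfl⟩ := hunit C hC
      exact ⟨↑u⁻¹, u.inv_mul, u.mul_inv⟩
    exact ⟨⟨_, LimitOp.coset (LimitOp.proj N X p) ⟨B, hB⟩,
      LimitOp.coset_mul_eq_one_iff (A := A) (B := ⟨B, hB⟩) |>.2 h1,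
      LimitOp.coset_mul_eq_one_iff (A := ⟨B, hB⟩) (B := A) |>.2 h2⟩, rfl⟩
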